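/- A spherical triangle is a surface homeomorphic to the closed disc with a Riemannian metric of constant curvature $1$, whose boundary consists of three geodesic arcs forming inner angles $\pi\vartheta_1,\pi\vartheta_2,\pi\vartheta_3$ at the vertices $x_1,x_2,x_3$; it is convex if all $\vartheta_i\le 1$. Its double $DT$, two copies of $T$ glued isometrically along the boundary, is a sphere with a metric of curvature $1$ with conical singularities of angles $2\pi\vartheta_i$ at the points $x_i$. The triangle $T$ is angle-deformable if there are a neighbourhood $\mathcal N$ of $\vartheta$ in $\mathbb R^3$ and a continuous (in the Lipschitz topology) family $(g_\nu)_{\nu\in\mathcal N}$ of such metrics on $T$, where $g_\nu$ has angles $\pi\nu_i$ at $x_i$ and $g_\vartheta$ is the given metric; angle-deformability of $DT$ is defined in the same way, with metrics of curvature $1$ on $DT$ with conical angles $2\pi\nu_i$ at $x_i$. The triangle is non-coaxial if the image of the holonomy representation $\pi_1(DT\setminus\{x_1,x_2,x_3\})\to \mathrm{SO}(3,\mathbb R)$ is not contained in the group of rotations about a single axis. Let $\vartheta=(\vartheta_1,\vartheta_2,\vartheta_3)\in[0,2]\times[0,1]\times[0,1]$ satisfy the holonomy inequalities strictly, that is,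 $$\sum_{i=1}^3|\vartheta_i-1-m_i|>1\quad\text{for all } m\in\mathbb Z^3 \text{ with } m_1+m_2+m_3 \text{ odd}.$$ Then there exists a non-coaxial spherical triangle $T$ with inner angles $\pi\vartheta_1,\pi\vartheta_2,\pi\vartheta_3$ such that $T$ and its double $DT$ are angle-deformable. If $1<\vartheta_1<2$, then $T$ can moreover be chosen as the metric completion (for the intrinsic metric) of $H\setminus T'$, where $H$ is a closed hemisphere of $\mathbb S^2$ and $T'\subset H$ is a convex spherical triangle with the same vertices as $T$, of which $x_2$ and $x_3$ lie on the great circle $\partial H$, and with angles $\pi(2-\vartheta_1),\pi(1-\vartheta_2),\pi(1-\vartheta_3)$ at $x_1,x_2,x_3$. -/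

import Mathlib

open Filter Topology Set

noncomputable section

/-- The unit sphere `S²`; the spherical distance of two points is the angle between them. -/
abbrev Sphere2 : Type := Metric.sphere (0 : EuclideanSpace ℝ (Fin 3)) 1

/-- The spherical distance on `S²`. -/
def sphDist (u v : Sphere2) : ℝ :=
  InnerProductGeometry.angle (u : EuclideanSpace ℝ (Fin 3)) (v : EuclideanSpace ℝ (Fin 3))

/-- The underlying bordered surface of a triangle: the closed unit disc. -/
abbrev Disc : Type := Metric.closedBall (0 : ℂ) 1

/-- The boundary circle of the closed disc. -/
def discBoundary : Set Disc := {z | ‖(z : ℂ)‖ = 1}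

/-- `d` is a distance on `S` that induces the given topology and is intrinsic: any two points are
joined by a path whose length is their distance. (On a compact surface this holds for the distance
of any Riemannian metric with geodesic boundary and conical or corner points.) -/
structure IsGeodesicMetric {S : Type*} [TopologicalSpace S] (d : S → S → ℝ) : Prop where
  self : ∀ a, d a a = 0
  comm : ∀ a b, d a b = d b a
  triangle : ∀ a b c, d a c ≤ d a b + d b c
  eq_of_zero : ∀ a b, d a b = 0 → a = b
  isOpen_iff : ∀ U : Set S, IsOpen U ↔ ∀ a ∈ U, ∃ ε > 0, ∀ b, d a b < ε → b ∈ U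
  geodesic : ∀ a b, ∃ γ : ℝ → S, γ 0 = a ∧ γ (d a b) = b ∧
    ∀ s ∈ Icc 0 (d a b), ∀ t ∈ Icc 0 (d a b), d (γ s) (γ t) = |s - t|

/-- The curvature-one cone metric in polar coordinates: the distance of two points at distances
`ρ`, `ρ'` from the cone point, seen from there under the angle `δ`. For `δ < π` it is the
spherical law of cosines, for `δ ≥ π` the shortest path goes through the cone point. -/
def sphConeDist (ρ ρ' δ : ℝ) : ℝ :=
  if δ < Real.pi then
    Real.arccos (Real.cos ρ * Real.cos ρ' + Real.sin ρ * Real.sin ρ' * Real.cos δ)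
  else ρ + ρ'

/-- A ball around `p` is isometric to the standard neighbourhood of a cone point of total angle
`θ` and curvature one; for `θ = 2π` this is a round disc of `S²`. The isometry is given by polar
coordinates `(d p ·, φ)`. -/
def IsConePoint {S : Type*} (d : S → S → ℝ) (p : S) (θ : ℝ) : Prop :=
  0 < θ ∧ ∃ r : ℝ, 0 < r ∧ r ≤ Real.pi / 2 ∧ ∃ φ : S → AddCircle θ,
    (∀ a b, d p a < r → d p b < r → d a b = sphConeDist (d p a) (d p b) ‖φ a - φ b‖) ∧
    ∀ ρ ∈ Ioo 0 r, ∀ ψ : AddCircle θ, ∃ a, d p a = ρ ∧ φ a = ψ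

/-- A ball around the point `p` of the boundary `B` is isometric to the standard neighbourhood of a
vertex of interior angle `θ` of a spherical polygon (a sector of angle `θ` and curvature one), the
boundary `B` corresponding to the two geodesic sides of the sector; for `θ = π` this is a half
disc of `S²`, i.e. `B` is geodesic at `p`. -/
def IsSectorPoint {S : Type*} (B : Set S) (d : S → S → ℝ) (p : S) (θ : ℝ) : Prop :=
  0 < θ ∧ p ∈ B ∧ ∃ r : ℝ, 0 < r ∧ r ≤ Real.pi / 2 ∧ ∃ φ : S → ℝ,
    (∀ a, d p a < r → φ a ∈ Icc 0 θ) ∧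
    (∀ a b, d p a < r → d p b < r → d a b = sphConeDist (d p a) (d p b) |φ a - φ b|) ∧
    (∀ ρ ∈ Ioo 0 r, ∀ ψ ∈ Icc 0 θ, ∃ a, d p a = ρ ∧ φ a = ψ) ∧
    ∀ a, a ≠ p → d p a < r → (a ∈ B ↔ φ a = 0 ∨ φ a = θ)

/-- `d` is the distance of a spherical triangle with vertices `x i` and inner angles `π ϑ i`: a
metric of curvature one on the closed disc whose boundary consists of geodesic arcs joining
the `x i`. -/
structure IsSphericalTriangle (x : Fin 3 → Disc) (ϑ : Fin 3 → ℝ) (d : Disc → Disc → ℝ) :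
    Prop where
  metric : IsGeodesicMetric d
  injective : Function.Injective x
  interior : ∀ p, p ∉ discBoundary → IsConePoint d p (2 * Real.pi)
  edge : ∀ p ∈ discBoundary, p ∉ range x → IsSectorPoint discBoundary d p Real.pi
  vertex : ∀ i, IsSectorPoint discBoundary d (x i) (Real.pi * ϑ i)

/-- A spherical triangle is convex if no inner angle exceeds `π`. -/
def IsConvexSphericalTriangle (x : Fin 3 → Disc) (ϑ : Fin 3 → ℝ) (d : Disc → Disc → ℝ) : Prop :=
  IsSphericalTriangle x ϑ d ∧ ∀ i, ϑ i ≤ 1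

/-- `d` is the distance of a spherical metric on the closed surface `S` with conical
singularities of angles `2π ϑ i` at the points `x i`. -/
structure IsSphericalSurface {S : Type*} [TopologicalSpace S] {n : ℕ} (x : Fin n → S)
    (ϑ : Fin n → ℝ) (d : S → S → ℝ) : Prop where
  compact : CompactSpace S
  metric : IsGeodesicMetric d
  injective : Function.Injective x
  smooth : ∀ p, p ∉ range x → IsConePoint d p (2 * Real.pi)
  cone : ∀ i, IsConePoint d (x i) (2 * Real.pi * ϑ i)

/-- Continuity of a family of metrics on a fixed space, in the Lipschitz sense: for `μ` close to
`ν` the metrics `D μ` and `D ν` have quotient uniformly close to `1`. -/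
def IsContinuousMetricFamily {S : Type*} {n : ℕ} (N : Set (Fin n → ℝ))
    (D : (Fin n → ℝ) → S → S → ℝ) : Prop :=
  ∀ ν ∈ N, ∀ ε > 0, ∀ᶠ μ in 𝓝[N] ν, ∀ a b,
    D μ a b ≤ (1 + ε) * D ν a b ∧ D ν a b ≤ (1 + ε) * D μ a b

/-- Angle-deformability of a metric `d` on a spherical triangle. -/
def IsAngleDeformableTriangle (x : Fin 3 → Disc) (ϑ : Fin 3 → ℝ) (d : Disc → Disc → ℝ) : Prop :=
  ∃ N ∈ 𝓝 ϑ, ∃ D : (Fin 3 → ℝ) → Disc → Disc → ℝ,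
    IsContinuousMetricFamily N D ∧ (∀ ν ∈ N, IsSphericalTriangle x ν (D ν)) ∧ D ϑ = d

/-- Angle-deformability of a spherical metric with conical singularities on a closed surface. -/
def IsAngleDeformableSurface {S : Type*} [TopologicalSpace S] {n : ℕ} (x : Fin n → S)
    (ϑ : Fin n → ℝ) (d : S → S → ℝ) : Prop :=
  ∃ N ∈ 𝓝 ϑ, ∃ D : (Fin n → ℝ) → S → S → ℝ,
    IsContinuousMetricFamily N D ∧ (∀ ν ∈ N, IsSphericalSurface x ν (D ν)) ∧ D ϑ = d

/-- Two copies of the disc, identified along the boundary circle. -/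
def doubleSetoid : Setoid (Disc × Bool) where
  r p q := p.1 = q.1 ∧ (p.2 = q.2 ∨ p.1 ∈ discBoundary)
  iseqv :=
    { refl := fun _ => ⟨rfl, Or.inl rfl⟩
      symm := fun h => ⟨h.1.symm, h.2.imp Eq.symm (fun hb => h.1 ▸ hb)⟩
      trans := fun h k => ⟨h.1.trans k.1, by
        rcases h.2 with h2 | h2
        · rcases k.2 with k2 | k2
          · exact Or.inl (h2.trans k2)
          · exact Or.inr (h.1.symm ▸ k2)
        · exact Or.inr h2⟩ }

/-- The double of the disc, with the quotient topology. -/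
abbrev DoubleDisc : Type := Quotient doubleSetoid

/-- The point of the double given by the point `a` of the sheet `s`. -/
def toDouble (s : Bool) (a : Disc) : DoubleDisc := Quotient.mk doubleSetoid (a, s)

/-- The folding map from the double onto the disc. -/
def foldDouble (p : DoubleDisc) : Disc :=
  Quotient.lift (s := doubleSetoid) (fun q : Disc × Bool => q.1)
    (fun _ _ h => And.left h) p

open Classical in
/-- The distance on the double of a disc with distance `d`: on each of the two sheets it is `d`,
and a path between different sheets has to cross the boundary. -/
def doubleDist (d : Disc → Disc → ℝ) (p q : DoubleDisc) : ℝ :=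
  if ∃ s, p ∈ range (toDouble s) ∧ q ∈ range (toDouble s) then d (foldDouble p) (foldDouble q)
  else ⨅ z : discBoundary, (d (foldDouble p) z + d z (foldDouble q))

/-- `f` is, near `p`, an isometry into the unit sphere. -/
def IsLocalIsometryAt {S : Type*} (d : S → S → ℝ) (f : S → Sphere2) (p : S) : Prop :=
  ∃ r > 0, ∀ a b, d p a < r → d p b < r → sphDist (f a) (f b) = d a b

/-- The action of a matrix on `ℝ³`. -/
def matAct (A : Matrix (Fin 3) (Fin 3) ℝ) (v : EuclideanSpace ℝ (Fin 3)) :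
    EuclideanSpace ℝ (Fin 3) :=
  WithLp.toLp 2 (A.mulVec (WithLp.ofLp v))

/-- The image of the holonomy representation of the punctured surface `S ∖ {x i}`, based at `p`
and at the germ at `p` of a local isometry `f` into `S²`: the rotations `A` for which the
continuation `F` of `f` along some loop `γ` in the punctured surface ends at the germ of
`A ∘ f`. -/
def holonomyImage {S : Type*} [TopologicalSpace S] {n : ℕ} (x : Fin n → S) (d : S → S → ℝ)
    (p : S) (f : S → Sphere2) : Set (Matrix.specialOrthogonalGroup (Fin 3) ℝ) :=
  {A | ∃ (γ : Path p p) (F : unitInterval → S → Sphere2),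
    (∀ t, γ t ∉ range x) ∧
    (∀ t, IsLocalIsometryAt d (F t) (γ t)) ∧
    (∀ t, ∀ᶠ s in 𝓝 t, F s =ᶠ[𝓝 (γ s)] F t) ∧
    F 0 =ᶠ[𝓝 p] f ∧
    ∀ᶠ q in 𝓝 p, (F 1 q : EuclideanSpace ℝ (Fin 3)) = matAct A.1 (f q)}

/-- The holonomy is non-coaxial: its image is not contained in the group of rotations about one
axis. (For a connected surface the choice of the base point and of the initial germ is
immaterial.) -/
def HasNonCoaxialHolonomy {S : Type*} [TopologicalSpace S] {n : ℕ} (x : Fin n → S)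
    (d : S → S → ℝ) : Prop :=
  ∃ p, p ∉ range x ∧ ∃ f : S → Sphere2, IsLocalIsometryAt d f p ∧
    ¬ ∃ v : EuclideanSpace ℝ (Fin 3), v ≠ 0 ∧ ∀ A ∈ holonomyImage x d p f, matAct A.1 v = v

/-- The vertices of a triangle as points of its double. -/
def doubleVertex (x : Fin 3 → Disc) (i : Fin 3) : DoubleDisc := toDouble false (x i)

/-- The holonomy inequalities hold strictly: the `ℓ¹`-distance of `ϑ - (1, 1, 1)` from the integer
vectors with odd coordinate sum is larger than `1`. (The distance is attained.) -/
def StrictHolonomyInequalities (ϑ : Fin 3 → ℝ) : Prop :=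
  ∀ m : Fin 3 → ℤ, Odd (∑ i, m i) → 1 < ∑ i, |ϑ i - 1 - (m i : ℝ)|

/-- The triangle with distance `d` and vertices `x` is isometrically realized by the region `R` of
`S²` with its intrinsic metric, through `f`. -/
def IsRealizedBy (x : Fin 3 → Disc) (d : Disc → Disc → ℝ) (f : Disc → Sphere2)
    (R : Set Sphere2) : Prop :=
  Continuous f ∧ Function.Injective f ∧ range f = R ∧ ∀ p, p ∉ range x → IsLocalIsometryAt d f p

/-- The closed hemisphere with pole `u`. -/
def hemisphere (u : Sphere2) : Set Sphere2 :=
  {w | 0 ≤ inner ℝ (u : EuclideanSpace ℝ (Fin 3)) (w : EuclideanSpace ℝ (Fin 3))}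

/-- The great circle with pole `u`. -/
def greatCircle (u : Sphere2) : Set Sphere2 :=
  {w | inner ℝ (u : EuclideanSpace ℝ (Fin 3)) (w : EuclideanSpace ℝ (Fin 3)) = 0}

/-- The triangle is the completion of `H ∖ T'`, where `T'` is a convex spherical triangle with
angles `π (2 - ϑ 0, 1 - ϑ 1, 1 - ϑ 2)` embedded in a closed hemisphere `H` of `S²`, with second
and third vertex on the great circle bounding `H`; the vertices of both triangles correspond. -/
def IsComplementInHemisphere (x : Fin 3 → Disc) (ϑ : Fin 3 → ℝ) (d : Disc → Disc → ℝ) : Prop :=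
  ∃ (u : Sphere2) (x' : Fin 3 → Disc) (d' : Disc → Disc → ℝ) (f' f : Disc → Sphere2)
    (T' : Set Sphere2),
    IsConvexSphericalTriangle x' ![2 - ϑ 0, 1 - ϑ 1, 1 - ϑ 2] d' ∧
    IsRealizedBy x' d' f' T' ∧ T' ⊆ hemisphere u ∧
    f' (x' 1) ∈ greatCircle u ∧ f' (x' 2) ∈ greatCircle u ∧
    IsRealizedBy x d f (closure (hemisphere u \ T')) ∧ ∀ i, f (x i) = f' (x' i)

end

/-! Everything is built inside the round sphere. The first vertex is the pole e₀ of the standard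
frame. For 0 < τ < π and a unit vector u with ⟨u, e₀⟩ > 0, `region u τ` is the part of the
hemisphere ⟨u, w⟩ ≥ 0 that is seen from e₀ within angle τ of a fixed horizontal direction. Its sides
are two meridian arcs from e₀ and an arc of the great circle with pole u. The angle at e₀ is 2τ, and
a base angle α is given by -cos α = ⟨u, n⟩, where n is the inward unit normal of the adjacent
meridian side. For τ = πϑ₀/2, prescribing both base angles is therefore a linear system for the
horizontal part of u. It has a unique solution when sin τ and cos τ do not vanish, and it comes from
a u of positive height exactly when its norm is less than 1.

With k = |ϑ₀ - 1|, that norm condition is equivalent to cos π(ϑ₁ + ϑ₂) < cos πk < cos π(ϑ₁ - ϑ₂)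
(`pole_sq_lt_one` proves the needed implication). On the given box this follows from six of the
strict holonomy inequalities (`StrictHolonomyInequalities.mem_triangleAngles`), which also give k >
0, hence cos τ ≠ 0.

For 2τ > π the region is not convex, so its intrinsic metric is `coneDist`: the spherical distance
for directions from e₀ differing by less than π, and otherwise the length of the path through e₀.
The triangle inequality and the existence of geodesics rest on the fact that an arc between points
of the first kind stays in the region. The local charts follow because near any point other than e₀
the region is a disc, a half-disc or a convex wedge, while at e₀ `coneDist` is the cone metric
itself (`IsRegionChart.isSphericalTriangle`).

For deformability, all regions are parametrized by one planar triangle through a map that is linear,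
up to normalization, on each of two halves (`dev`). Distances within a half are angles between
images under a linear map, and nearby injective linear maps distort angles by a factor near 1
(`angle_le_of_near`). A shortest path between different halves is cut at the middle ray. The angles
for which the construction works form an open set, and doubling preserves every estimate
(`IsAngleDeformableTriangle.double`).

For holonomy, leaving the first sheet through one side and returning through another yields the
product of the two reflections in those sides. A common fixed vector would be orthogonal to all
three side normals, which span space because cos τ ≠ 0 and ⟨u, e₀⟩ > 0. Finally, the complement of
the sector in the hemisphere is the mirror image of a region with half-angle π - τ, which gives the
description as hemisphere minus triangle. -/

noncomputable section

/-! ### The unit sphere and its angular distance -/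

/-- Euclidean three-space. -/
abbrev E3 : Type := EuclideanSpace ℝ (Fin 3)

theorem Sphere2.norm_coe (v : Sphere2) : ‖(v : E3)‖ = 1 := by
  simp

theorem Sphere2.ne_zero (v : Sphere2) : (v : E3) ≠ 0 := by
  intro h
  have := v.norm_coe
  simp [h] at this

theorem Sphere2.inner_self (v : Sphere2) : inner ℝ (v : E3) v = 1 := by
  rw [real_inner_self_eq_norm_sq, v.norm_coe, one_pow]

theorem sphDist_eq_arccos (u v : Sphere2) : sphDist u v = Real.arccos (inner ℝ (u : E3) v) := by
  simp [sphDist, InnerProductGeometry.angle]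

theorem abs_inner_le_one (u v : Sphere2) : |inner ℝ (u : E3) v| ≤ 1 := by
  have := abs_real_inner_le_norm (u : E3) (v : E3)
  simpa [Sphere2.norm_coe] using this

theorem cos_sphDist (u v : Sphere2) : Real.cos (sphDist u v) = inner ℝ (u : E3) v := by
  have := abs_le.1 (abs_inner_le_one u v)
  rw [sphDist_eq_arccos, Real.cos_arccos this.1 this.2]

theorem sphDist_nonneg (u v : Sphere2) : 0 ≤ sphDist u v := InnerProductGeometry.angle_nonneg _ _

theorem sphDist_le_pi (u v : Sphere2) : sphDist u v ≤ Real.pi := InnerProductGeometry.angle_le_pi _ _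

theorem sphDist_comm (u v : Sphere2) : sphDist u v = sphDist v u :=
  InnerProductGeometry.angle_comm _ _

theorem sphDist_self (u : Sphere2) : sphDist u u = 0 :=
  InnerProductGeometry.angle_self u.ne_zero

theorem sphDist_triangle (u v w : Sphere2) : sphDist u w ≤ sphDist u v + sphDist v w :=
  InnerProductGeometry.angle_le_angle_add_angle _ _ _

theorem Sphere2.eq_of_inner_eq_one {u v : Sphere2} (h : inner ℝ (u : E3) v = 1) : u = v :=
  Subtype.ext ((inner_eq_one_iff_of_norm_eq_one u.norm_coe v.norm_coe).1 h)

theorem eq_of_sphDist_eq_zero {u v : Sphere2} (h : sphDist u v = 0) : u = v := by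
  apply Sphere2.eq_of_inner_eq_one
  rw [← cos_sphDist, h, Real.cos_zero]

theorem continuous_sphDist : Continuous fun p : Sphere2 × Sphere2 => sphDist p.1 p.2 := by
  simp only [sphDist_eq_arccos]
  exact Real.continuous_arccos.comp (by fun_prop)

/-- A point of the arc from `u` to `w` splits the distance. -/
theorem sphDist_eq_add_of_combination {u v w : Sphere2} {c l k : ℝ} (hc : 0 < c) (hl : 0 ≤ l)
    (hk : 0 ≤ k) (h : c • (v : E3) = l • (u : E3) + k • (w : E3)) :
    sphDist u w = sphDist u v + sphDist v w := by
  refine InnerProductGeometry.angle_eq_angle_add_add_angle_add_of_mem_span v.ne_zero ?_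
  rw [Submodule.mem_span_pair]
  refine ⟨(l / c).toNNReal, (k / c).toNNReal, ?_⟩
  have : (v : E3) = c⁻¹ • (c • (v : E3)) := by rw [smul_smul, inv_mul_cancel₀ hc.ne', one_smul]
  rw [this, h, smul_add, smul_smul, smul_smul]
  rw [NNReal.smul_def, NNReal.smul_def, Real.coe_toNNReal _ (by positivity),
    Real.coe_toNNReal _ (by positivity)]
  congr 2 <;> ring

/-- The point of the sphere in the direction of a nonzero vector. -/
def toSphere (v : E3) (hv : v ≠ 0) : Sphere2 :=
  ⟨‖v‖⁻¹ • v, by simp [norm_smul, hv]⟩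

theorem norm_smul_toSphere (v : E3) (hv : v ≠ 0) : ‖v‖ • (toSphere v hv : E3) = v := by
  simp [toSphere, smul_smul, hv]

theorem sphDist_toSphere (v w : E3) (hv : v ≠ 0) (hw : w ≠ 0) :
    sphDist (toSphere v hv) (toSphere w hw) = InnerProductGeometry.angle v w := by
  simp only [sphDist, toSphere]
  rw [InnerProductGeometry.angle_smul_left_of_pos _ _ (by positivity),
    InnerProductGeometry.angle_smul_right_of_pos _ _ (by positivity)]

/-! ### Polar coordinates in an orthonormal frame -/

/-- The component orthogonal to the first vector of a frame, as a complex number. -/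
def horiz (b : OrthonormalBasis (Fin 3) ℝ E3) (w : E3) : ℂ :=
  ⟨inner ℝ (b 1) w, inner ℝ (b 2) w⟩

/-- The first vector of a frame. -/
def framePole (b : OrthonormalBasis (Fin 3) ℝ E3) : Sphere2 := ⟨b 0, by simp⟩

/-- The distance from the pole of a frame. -/
def polarDist (b : OrthonormalBasis (Fin 3) ℝ E3) (w : Sphere2) : ℝ := sphDist (framePole b) w

theorem horiz_add (b : OrthonormalBasis (Fin 3) ℝ E3) (v w : E3) :
    horiz b (v + w) = horiz b v + horiz b w := by
  apply Complex.ext <;> simp [horiz, inner_add_right]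

theorem horiz_smul (b : OrthonormalBasis (Fin 3) ℝ E3) (c : ℝ) (w : E3) :
    horiz b (c • w) = c * horiz b w := by
  apply Complex.ext <;> simp [horiz, inner_smul_right]

@[fun_prop]
theorem continuous_horiz (b : OrthonormalBasis (Fin 3) ℝ E3) : Continuous (horiz b) := by
  have : horiz b = fun w => ((inner ℝ (b 1) w : ℝ) : ℂ) + ((inner ℝ (b 2) w : ℝ) : ℂ) * Complex.I := by
    funext w
    apply Complex.ext <;> simp [horiz]
  rw [this]
  fun_prop

theorem inner_eq_frame (b : OrthonormalBasis (Fin 3) ℝ E3) (v w : E3) :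
    inner ℝ v w = inner ℝ (b 0) v * inner ℝ (b 0) w + (horiz b v).re * (horiz b w).re
      + (horiz b v).im * (horiz b w).im := by
  rw [← b.sum_inner_mul_inner v w, Fin.sum_univ_three]
  simp [horiz, real_inner_comm]

theorem cos_polarDist (b : OrthonormalBasis (Fin 3) ℝ E3) (w : Sphere2) :
    Real.cos (polarDist b w) = inner ℝ (b 0) (w : E3) := cos_sphDist _ _

theorem polarDist_nonneg (b : OrthonormalBasis (Fin 3) ℝ E3) (w : Sphere2) : 0 ≤ polarDist b w :=
  sphDist_nonneg _ _

theorem polarDist_le_pi (b : OrthonormalBasis (Fin 3) ℝ E3) (w : Sphere2) :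
    polarDist b w ≤ Real.pi := sphDist_le_pi _ _

theorem norm_horiz (b : OrthonormalBasis (Fin 3) ℝ E3) (w : Sphere2) :
    ‖horiz b w‖ = Real.sin (polarDist b w) := by
  have h1 := inner_eq_frame b w w
  rw [w.inner_self, ← cos_polarDist] at h1
  have h2 : ‖horiz b w‖ ^ 2 = Real.sin (polarDist b w) ^ 2 := by
    rw [← Complex.normSq_eq_norm_sq, Complex.normSq_apply]
    nlinarith [Real.sin_sq_add_cos_sq (polarDist b w)]
  have h3 : 0 ≤ Real.sin (polarDist b w) :=
    Real.sin_nonneg_of_nonneg_of_le_pi (polarDist_nonneg b w) (polarDist_le_pi b w)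
  exact (sq_eq_sq₀ (norm_nonneg _) h3).1 h2

theorem horiz_re (b : OrthonormalBasis (Fin 3) ℝ E3) (w : Sphere2) :
    (horiz b w).re = Real.sin (polarDist b w) * Real.cos (horiz b w).arg := by
  rw [← norm_horiz, Complex.norm_mul_cos_arg]

theorem horiz_im (b : OrthonormalBasis (Fin 3) ℝ E3) (w : Sphere2) :
    (horiz b w).im = Real.sin (polarDist b w) * Real.sin (horiz b w).arg := by
  rw [← norm_horiz, Complex.norm_mul_sin_arg]

/-- The spherical law of cosines. -/
theorem sphDist_polar (b : OrthonormalBasis (Fin 3) ℝ E3) {v w : Sphere2} {φ ψ : ℝ}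
    (hv : horiz b v = Real.sin (polarDist b v) * Complex.exp (φ * Complex.I))
    (hw : horiz b w = Real.sin (polarDist b w) * Complex.exp (ψ * Complex.I)) :
    sphDist v w = Real.arccos (Real.cos (polarDist b v) * Real.cos (polarDist b w) +
      Real.sin (polarDist b v) * Real.sin (polarDist b w) * Real.cos (φ - ψ)) := by
  rw [sphDist_eq_arccos, inner_eq_frame b, cos_polarDist, cos_polarDist, hv, hw, Real.cos_sub]
  simp only [Complex.re_ofReal_mul, Complex.exp_ofReal_mul_I_re, Complex.im_ofReal_mul,
    Complex.exp_ofReal_mul_I_im]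
  congr 1
  ring

theorem horiz_eq_exp_arg (b : OrthonormalBasis (Fin 3) ℝ E3) (w : Sphere2) :
    horiz b w = Real.sin (polarDist b w) * Complex.exp ((horiz b w).arg * Complex.I) := by
  rw [← norm_horiz, Complex.norm_mul_exp_arg_mul_I]

theorem sphDist_arg (b : OrthonormalBasis (Fin 3) ℝ E3) (v w : Sphere2) :
    sphDist v w = Real.arccos (Real.cos (polarDist b v) * Real.cos (polarDist b w) +
      Real.sin (polarDist b v) * Real.sin (polarDist b w) *
        Real.cos ((horiz b v).arg - (horiz b w).arg)) :=
  sphDist_polar b (horiz_eq_exp_arg b v) (horiz_eq_exp_arg b w)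

/-- The point with given polar coordinates. -/
def polarPoint (b : OrthonormalBasis (Fin 3) ℝ E3) (ρ φ : ℝ) : Sphere2 :=
  ⟨Real.cos ρ • b 0 + (Real.sin ρ * Real.cos φ) • b 1 + (Real.sin ρ * Real.sin φ) • b 2, by
    have h : ∀ i j, inner ℝ (b i) (b j) = if i = j then (1 : ℝ) else 0 :=
      fun i j => orthonormal_iff_ite.1 b.orthonormal i j
    rw [mem_sphere_zero_iff_norm, ← sq_eq_sq₀ (norm_nonneg _) zero_le_one,
      ← real_inner_self_eq_norm_sq]
    simp only [inner_add_left, inner_add_right, inner_smul_left, inner_smul_right, h]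
    simp
    nlinarith [Real.sin_sq_add_cos_sq ρ, Real.sin_sq_add_cos_sq φ]⟩

theorem inner_polarPoint (b : OrthonormalBasis (Fin 3) ℝ E3) (ρ φ : ℝ) (w : E3) :
    inner ℝ (polarPoint b ρ φ : E3) w = Real.cos ρ * inner ℝ (b 0) w
      + Real.sin ρ * Real.cos φ * inner ℝ (b 1) w + Real.sin ρ * Real.sin φ * inner ℝ (b 2) w := by
  simp [polarPoint, inner_add_left, inner_smul_left]

theorem inner_frame (b : OrthonormalBasis (Fin 3) ℝ E3) (i j : Fin 3) :
    inner ℝ (b i) (b j) = if i = j then (1 : ℝ) else 0 :=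
  orthonormal_iff_ite.1 b.orthonormal i j

theorem polarDist_polarPoint (b : OrthonormalBasis (Fin 3) ℝ E3) {ρ : ℝ} (φ : ℝ)
    (hρ : ρ ∈ Icc 0 Real.pi) : polarDist b (polarPoint b ρ φ) = ρ := by
  rw [polarDist, sphDist_comm, sphDist_eq_arccos, inner_polarPoint]
  simp [framePole, Real.arccos_cos hρ.1 hρ.2]

theorem horiz_polarPoint (b : OrthonormalBasis (Fin 3) ℝ E3) (ρ φ : ℝ) :
    horiz b (polarPoint b ρ φ) = Real.sin ρ * Complex.exp (φ * Complex.I) := by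
  apply Complex.ext
  · simp only [horiz, real_inner_comm, inner_polarPoint, inner_frame, Complex.re_ofReal_mul,
      Complex.exp_ofReal_mul_I_re]
    simp
  · simp only [horiz, real_inner_comm, inner_polarPoint, inner_frame, Complex.im_ofReal_mul,
      Complex.exp_ofReal_mul_I_im]
    simp

theorem arg_horiz_polarPoint (b : OrthonormalBasis (Fin 3) ℝ E3) {ρ φ : ℝ}
    (hρ : ρ ∈ Ioo 0 Real.pi) (hφ : φ ∈ Ioc (-Real.pi) Real.pi) :
    (horiz b (polarPoint b ρ φ)).arg = φ := by
  rw [horiz_polarPoint, Complex.arg_real_mul _ (Real.sin_pos_of_pos_of_lt_pi hρ.1 hρ.2),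
    Complex.exp_mul_I, Complex.arg_cos_add_sin_mul_I hφ]

theorem sphDist_polarPoint (b : OrthonormalBasis (Fin 3) ℝ E3) {ρ σ φ ψ : ℝ}
    (hρ : ρ ∈ Icc 0 Real.pi) (hσ : σ ∈ Icc 0 Real.pi) :
    sphDist (polarPoint b ρ φ) (polarPoint b σ ψ) =
      Real.arccos (Real.cos ρ * Real.cos σ + Real.sin ρ * Real.sin σ * Real.cos (φ - ψ)) := by
  rw [sphDist_polar b (φ := φ) (ψ := ψ), polarDist_polarPoint b φ hρ, polarDist_polarPoint b ψ hσ]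
  · rw [polarDist_polarPoint b φ hρ, horiz_polarPoint]
  · rw [polarDist_polarPoint b ψ hσ, horiz_polarPoint]

/-- The arc between two points crosses every ray from the pole in the convex angle between
their directions. -/
theorem exists_arc_crosses_ray (b : OrthonormalBasis (Fin 3) ℝ E3) {v w : Sphere2} {r r' φ φ' ψ : ℝ}
    (hr : 0 ≤ r) (hr' : 0 ≤ r') (hv : horiz b v = r * Complex.exp (φ * Complex.I))
    (hw : horiz b w = r' * Complex.exp (φ' * Complex.I)) (h1 : φ ≤ ψ) (h2 : ψ ≤ φ')
    (h3 : φ' - φ < Real.pi) :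
    ∃ z : Sphere2, (∃ c l k : ℝ, 0 < c ∧ 0 ≤ l ∧ 0 ≤ k ∧ c • (z : E3) = l • (v : E3) + k • (w : E3)) ∧
      ∃ s : ℝ, 0 ≤ s ∧ horiz b z = s * Complex.exp (ψ * Complex.I) := by
  -- Degenerate cases: an end point lying on the axis or on the ray itself serves as the crossing
  -- point.
  have left : (r = 0 ∨ φ = ψ) → ∃ z : Sphere2, (∃ c l k : ℝ, 0 < c ∧ 0 ≤ l ∧ 0 ≤ k ∧
      c • (z : E3) = l • (v : E3) + k • (w : E3)) ∧
      ∃ s : ℝ, 0 ≤ s ∧ horiz b z = s * Complex.exp (ψ * Complex.I) := by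
    intro h
    refine ⟨v, ⟨1, 1, 0, one_pos, zero_le_one, le_rfl, by simp⟩, r, hr, ?_⟩
    rcases h with h | h <;> simp [hv, h]
  have right : (r' = 0 ∨ φ' = ψ) → ∃ z : Sphere2, (∃ c l k : ℝ, 0 < c ∧ 0 ≤ l ∧ 0 ≤ k ∧
      c • (z : E3) = l • (v : E3) + k • (w : E3)) ∧
      ∃ s : ℝ, 0 ≤ s ∧ horiz b z = s * Complex.exp (ψ * Complex.I) := by
    intro h
    refine ⟨w, ⟨1, 0, 1, one_pos, le_rfl, zero_le_one, by simp⟩, r', hr', ?_⟩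
    rcases h with h | h <;> simp [hw, h]
  by_cases hl : r = 0 ∨ φ = ψ
  · exact left hl
  by_cases hk : r' = 0 ∨ φ' = ψ
  · exact right hk
  push Not at hl hk
  have hr0 : 0 < r := lt_of_le_of_ne hr (Ne.symm hl.1)
  have hr0' : 0 < r' := lt_of_le_of_ne hr' (Ne.symm hk.1)
  have hφ : φ < ψ := lt_of_le_of_ne h1 hl.2
  have hφ' : ψ < φ' := lt_of_le_of_ne h2 (Ne.symm hk.2)
  have s1 : 0 < Real.sin (φ' - ψ) := Real.sin_pos_of_pos_of_lt_pi (by linarith) (by linarith)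
  have s2 : 0 < Real.sin (ψ - φ) := Real.sin_pos_of_pos_of_lt_pi (by linarith) (by linarith)
  have s3 : 0 < Real.sin (φ' - φ) := Real.sin_pos_of_pos_of_lt_pi (by linarith) (by linarith)
  -- The weights come from the identity sin(φ' - ψ) e^{iφ} + sin(ψ - φ) e^{iφ'} = sin(φ' - φ)
  -- e^{iψ}, multiplied by r r'.
  set l := r' * Real.sin (φ' - ψ) with hldef
  set k := r * Real.sin (ψ - φ) with hkdef
  have key : horiz b (l • (v : E3) + k • (w : E3)) =
      ((r * r' * Real.sin (φ' - φ) : ℝ) : ℂ) * Complex.exp (ψ * Complex.I) := by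
    rw [horiz_add, horiz_smul, horiz_smul, hv, hw]
    apply Complex.ext
    · simp only [Complex.add_re, Complex.re_ofReal_mul, Complex.exp_ofReal_mul_I_re, hldef, hkdef,
        Real.sin_sub]
      ring
    · simp only [Complex.add_im, Complex.im_ofReal_mul, Complex.exp_ofReal_mul_I_im, hldef, hkdef,
        Real.sin_sub]
      ring
  have hne : l • (v : E3) + k • (w : E3) ≠ 0 := by
    intro h0
    rw [h0] at key
    have h0' : horiz b 0 = 0 := by apply Complex.ext <;> simp [horiz]
    rw [h0'] at key
    have : (r * r' * Real.sin (φ' - φ)) ≠ 0 := by positivity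
    exact (mul_ne_zero (Complex.ofReal_ne_zero.2 this) (Complex.exp_ne_zero _)) key.symm
  refine ⟨toSphere _ hne, ⟨‖l • (v : E3) + k • (w : E3)‖, l, k, norm_pos_iff.2 hne, by positivity,
    by positivity, norm_smul_toSphere _ hne⟩,
    ‖l • (v : E3) + k • (w : E3)‖⁻¹ * (r * r' * Real.sin (φ' - φ)), by positivity, ?_⟩
  rw [toSphere, horiz_smul, key]
  push_cast
  ring

/-! ### The cone distance -/

/-- The standard frame of Euclidean three-space. -/
abbrev stdFrame : OrthonormalBasis (Fin 3) ℝ E3 := EuclideanSpace.basisFun (Fin 3) ℝ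

/-- The two branches of the definition agree at δ = π: the cosine law there reads arccos (cos (ρ +
σ)), which is ρ + σ as long as this is at most π. -/
theorem sphConeDist_of_le_pi {ρ σ δ : ℝ} (hρ : 0 ≤ ρ) (hσ : 0 ≤ σ) (h : ρ + σ ≤ Real.pi)
    (hδ : δ ≤ Real.pi) : sphConeDist ρ σ δ =
      Real.arccos (Real.cos ρ * Real.cos σ + Real.sin ρ * Real.sin σ * Real.cos δ) := by
  rcases hδ.lt_or_eq with h1 | h1
  · rw [sphConeDist, if_pos h1]
  · rw [sphConeDist, if_neg h1.not_lt, h1, Real.cos_pi, mul_neg_one, ← sub_eq_add_neg,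
      ← Real.cos_add, Real.arccos_cos (by linarith) h]

theorem sphConeDist_of_pi_le {ρ σ δ : ℝ} (hδ : Real.pi ≤ δ) : sphConeDist ρ σ δ = ρ + σ := by
  rw [sphConeDist, if_neg hδ.not_gt]

theorem sphConeDist_eq_sphDist {ρ σ φ ψ : ℝ} (hρ : 0 ≤ ρ) (hσ : 0 ≤ σ) (h : ρ + σ ≤ Real.pi)
    (hδ : |φ - ψ| ≤ Real.pi) :
    sphConeDist ρ σ |φ - ψ| = sphDist (polarPoint stdFrame ρ φ) (polarPoint stdFrame σ ψ) := by
  rw [sphConeDist_of_le_pi hρ hσ h hδ, sphDist_polarPoint, Real.cos_abs]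
  · exact ⟨hρ, by linarith⟩
  · exact ⟨hσ, by linarith⟩

theorem sphConeDist_comm (ρ σ δ : ℝ) : sphConeDist ρ σ δ = sphConeDist σ ρ δ := by
  simp only [sphConeDist, mul_comm, add_comm]

theorem sphConeDist_mono {ρ σ δ δ' : ℝ} (hρ : 0 ≤ ρ) (hσ : 0 ≤ σ) (h : ρ + σ ≤ Real.pi)
    (hδ : 0 ≤ δ) (hδδ : δ ≤ δ') : sphConeDist ρ σ δ ≤ sphConeDist ρ σ δ' := by
  have key : ∀ ε, δ ≤ ε → ε ≤ Real.pi → sphConeDist ρ σ δ ≤ sphConeDist ρ σ ε := by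
    intro ε h1 h2
    rw [sphConeDist_of_le_pi hρ hσ h (h1.trans h2), sphConeDist_of_le_pi hρ hσ h h2]
    apply Real.arccos_le_arccos
    have := Real.cos_le_cos_of_nonneg_of_le_pi hδ h2 h1
    have s1 := Real.sin_nonneg_of_nonneg_of_le_pi hρ (by linarith)
    have s2 := Real.sin_nonneg_of_nonneg_of_le_pi hσ (by linarith)
    gcongr
  rcases le_total δ' Real.pi with h1 | h1
  · exact key _ hδδ h1
  · rw [sphConeDist_of_pi_le h1, ← sphConeDist_of_pi_le (ρ := ρ) (σ := σ) le_rfl]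
    rcases le_total δ Real.pi with h2 | h2
    · exact key _ h2 le_rfl
    · rw [sphConeDist_of_pi_le h2, sphConeDist_of_pi_le le_rfl]

theorem sphConeDist_zero_angle {ρ σ : ℝ} (hρ : 0 ≤ ρ) (hσ : 0 ≤ σ) (h : ρ + σ ≤ Real.pi) :
    sphConeDist ρ σ 0 = |ρ - σ| := by
  rw [sphConeDist_of_le_pi hρ hσ h Real.pi_nonneg, Real.cos_zero, mul_one, ← Real.cos_sub,
    ← Real.cos_abs, Real.arccos_cos (abs_nonneg _)]
  rw [abs_le]; constructor <;> linarith

theorem abs_sub_le_sphConeDist {ρ σ δ : ℝ} (hρ : 0 ≤ ρ) (hσ : 0 ≤ σ) (h : ρ + σ ≤ Real.pi)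
    (hδ : 0 ≤ δ) : |ρ - σ| ≤ sphConeDist ρ σ δ := by
  rw [← sphConeDist_zero_angle hρ hσ h]
  exact sphConeDist_mono hρ hσ h le_rfl hδ

theorem sphConeDist_le_add {ρ σ δ : ℝ} (hρ : 0 ≤ ρ) (hσ : 0 ≤ σ) (h : ρ + σ ≤ Real.pi)
    (hδ : 0 ≤ δ) : sphConeDist ρ σ δ ≤ ρ + σ := by
  rw [← sphConeDist_of_pi_le (ρ := ρ) (σ := σ) (le_max_right δ Real.pi)]
  exact sphConeDist_mono hρ hσ h hδ (le_max_left _ _)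

/-- If one leg already passes through the cone point, the bound is elementary. Otherwise the three
points can be laid out on the round sphere, provided the total angle does not exceed π, and the
spherical triangle inequality applies. -/
theorem sphConeDist_triangle {ρ σ t α β γ : ℝ} (hρ : ρ ∈ Icc 0 (Real.pi / 2))
    (hσ : σ ∈ Icc 0 (Real.pi / 2)) (ht : t ∈ Icc 0 (Real.pi / 2)) (hα : 0 ≤ α) (hβ : 0 ≤ β)
    (hγ : 0 ≤ γ) (h : γ ≤ α + β) :
    sphConeDist ρ σ γ ≤ sphConeDist ρ t α + sphConeDist t σ β := by
  have hadd := sphConeDist_le_add hρ.1 hσ.1 (by linarith [hρ.2, hσ.2]) hγ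
  rcases le_total Real.pi α with h1 | h1
  · rw [sphConeDist_of_pi_le h1]
    have := abs_sub_le_sphConeDist ht.1 hσ.1 (by linarith [ht.2, hσ.2]) hβ
    have := neg_abs_le (t - σ)
    linarith
  rcases le_total Real.pi β with h2 | h2
  · rw [sphConeDist_of_pi_le h2]
    have := abs_sub_le_sphConeDist hρ.1 ht.1 (by linarith [ht.2, hρ.2]) hα
    have := le_abs_self (ρ - t)
    linarith
  -- Shrinking β so that the total angle is at most π only shortens the second leg, and it does not
  -- lower the left side below ρ + σ when the cap is active.
  set β' := min β (Real.pi - α) with hβ'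
  have hb0 : 0 ≤ β' := le_min hβ (by linarith)
  have hb1 : β' ≤ β := min_le_left _ _
  have hb2 : α + β' ≤ Real.pi := by linarith [min_le_right β (Real.pi - α)]
  have h3 : sphConeDist ρ σ γ ≤ sphConeDist ρ σ (α + β') := by
    rcases min_choice β (Real.pi - α) with h4 | h4
    · rw [hβ', h4]
      exact sphConeDist_mono hρ.1 hσ.1 (by linarith [hρ.2, hσ.2]) hγ h
    · rw [hβ', h4, add_sub_cancel, sphConeDist_of_pi_le le_rfl]
      exact hadd
  have h5 : sphConeDist t σ β' ≤ sphConeDist t σ β :=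
    sphConeDist_mono ht.1 hσ.1 (by linarith [ht.2, hσ.2]) hb0 hb1
  have e1 : α + β' = |0 - (α + β')| := by rw [zero_sub, abs_neg, abs_of_nonneg (by linarith)]
  have e2 : α = |0 - α| := by rw [zero_sub, abs_neg, abs_of_nonneg hα]
  have e3 : β' = |α - (α + β')| := by rw [sub_add_cancel_left, abs_neg, abs_of_nonneg hb0]
  have h6 : sphConeDist ρ σ (α + β') ≤ sphConeDist ρ t α + sphConeDist t σ β' := by
    rw [e1, sphConeDist_eq_sphDist hρ.1 hσ.1 (by linarith [hρ.2, hσ.2]) (by rw [← e1]; exact hb2)]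
    nth_rw 2 [e2]
    nth_rw 2 [e3]
    rw [sphConeDist_eq_sphDist hρ.1 ht.1 (by linarith [hρ.2, ht.2]) (by rw [← e2]; exact h1),
      sphConeDist_eq_sphDist ht.1 hσ.1 (by linarith [hσ.2, ht.2]) (by rw [← e3]; linarith)]
    exact sphDist_triangle _ _ _
  linarith

/-- In a cone, the geodesic between two points seen under an angle less than `π` crosses every
ray between them. -/
theorem exists_sphConeDist_eq_add {ρ σ α β : ℝ} (hρ : ρ ∈ Icc 0 (Real.pi / 2))
    (hσ : σ ∈ Icc 0 (Real.pi / 2)) (hα : 0 ≤ α) (hβ : 0 ≤ β) (h : α + β < Real.pi) :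
    ∃ t, 0 ≤ t ∧ t ≤ ρ + sphConeDist ρ t α ∧
      sphConeDist ρ σ (α + β) = sphConeDist ρ t α + sphConeDist t σ β := by
  have hπ := Real.pi_pos
  have hρ' : ρ ∈ Icc 0 Real.pi := ⟨hρ.1, by linarith [hρ.2]⟩
  have hσ' : σ ∈ Icc 0 Real.pi := ⟨hσ.1, by linarith [hσ.2]⟩
  have p1 := horiz_polarPoint stdFrame ρ α
  have p2 := horiz_polarPoint stdFrame σ (-β)
  -- The end points are placed on the sphere at longitudes α and -β, so that the ray between them
  -- has longitude 0.
  obtain ⟨z, ⟨c, l, k, hc, hl, hk, hz⟩, s, hs, hzs⟩ := exists_arc_crosses_ray stdFrame (ψ := 0)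
    (Real.sin_nonneg_of_nonneg_of_le_pi hσ'.1 hσ'.2)
    (Real.sin_nonneg_of_nonneg_of_le_pi hρ'.1 hρ'.2) p2 p1 (by linarith) hα (by linarith)
  have hadd := sphDist_eq_add_of_combination hc hl hk hz
  have hsin : s = Real.sin (polarDist stdFrame z) := by
    rw [← norm_horiz, hzs]
    simp [abs_of_nonneg hs]
  rw [hsin] at hzs
  have d1 : sphDist z (polarPoint stdFrame ρ α) = sphConeDist ρ (polarDist stdFrame z) α := by
    rw [sphDist_polar stdFrame hzs (by rw [polarDist_polarPoint _ _ hρ']; exact p1),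
      polarDist_polarPoint _ _ hρ', sphConeDist, if_pos (by linarith), zero_sub, Real.cos_neg]
    congr 1; ring
  have d2 : sphDist (polarPoint stdFrame σ (-β)) z = sphConeDist (polarDist stdFrame z) σ β := by
    rw [sphDist_polar stdFrame (by rw [polarDist_polarPoint _ _ hσ']; exact p2) hzs,
      polarDist_polarPoint _ _ hσ', sphConeDist, if_pos (by linarith), sub_zero, Real.cos_neg]
    congr 1; ring
  have d3 : sphDist (polarPoint stdFrame σ (-β)) (polarPoint stdFrame ρ α) =
      sphConeDist ρ σ (α + β) := by
    rw [sphDist_polarPoint _ hσ' hρ', sphConeDist, if_pos h, ← Real.cos_neg (-β - α)]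
    congr 1
    ring_nf
  -- The bound on t later keeps the crossing point inside the domain of a local chart.
  refine ⟨polarDist stdFrame z, polarDist_nonneg _ _, ?_, ?_⟩
  · have := sphDist_triangle (framePole stdFrame) (polarPoint stdFrame ρ α) z
    rw [sphDist_comm (polarPoint stdFrame ρ α) z, d1] at this
    exact this.trans_eq (congrArg (· + _) (polarDist_polarPoint stdFrame α hρ'))
  rw [← d1, ← d2, ← d3, hadd, add_comm]

/-! ### Geodesic metrics -/

/-- `a` and `b` are joined by a path whose length is their distance. -/
def HasGeodesic {S : Type*} (d : S → S → ℝ) (a b : S) : Prop :=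
  ∃ γ : ℝ → S, γ 0 = a ∧ γ (d a b) = b ∧
    ∀ s ∈ Icc 0 (d a b), ∀ t ∈ Icc 0 (d a b), d (γ s) (γ t) = |s - t|

theorem dist_nonneg_of_triangle {S : Type*} {d : S → S → ℝ} (self : ∀ a, d a a = 0)
    (comm : ∀ a b, d a b = d b a) (triangle : ∀ a b c, d a c ≤ d a b + d b c) (a b : S) :
    0 ≤ d a b := by
  have := triangle a b a
  rw [self, comm b a] at this
  linarith

theorem HasGeodesic.concat {S : Type*} {d : S → S → ℝ} (self : ∀ a, d a a = 0)
    (comm : ∀ a b, d a b = d b a) (triangle : ∀ a b c, d a c ≤ d a b + d b c) {a z b : S}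
    (h : d a b = d a z + d z b) (h1 : HasGeodesic d a z) (h2 : HasGeodesic d z b) :
    HasGeodesic d a b := by
  obtain ⟨γ, g0, g1, g2⟩ := h1
  obtain ⟨η, e0, e1, e2⟩ := h2
  have n1 := dist_nonneg_of_triangle self comm triangle a z
  have n2 := dist_nonneg_of_triangle self comm triangle z b
  have ha : ∀ s ∈ Icc 0 (d a z), d a (γ s) = s := by
    intro s hs
    rw [← g0, g2 0 ⟨le_rfl, n1⟩ s hs, zero_sub, abs_neg, abs_of_nonneg hs.1]
  have hz : ∀ s ∈ Icc 0 (d a z), d (γ s) z = d a z - s := by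
    intro s hs
    have := g2 s hs _ ⟨n1, le_rfl⟩
    rw [g1] at this
    rw [this, abs_sub_comm, abs_of_nonneg (by linarith [hs.2])]
  have hz' : ∀ s ∈ Icc 0 (d z b), d z (η s) = s := by
    intro s hs
    rw [← e0, e2 0 ⟨le_rfl, n2⟩ s hs, zero_sub, abs_neg, abs_of_nonneg hs.1]
  have hb : ∀ s ∈ Icc 0 (d z b), d (η s) b = d z b - s := by
    intro s hs
    have := e2 s hs _ ⟨n2, le_rfl⟩
    rw [e1] at this
    rw [this, abs_sub_comm, abs_of_nonneg (by linarith [hs.2])]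
  -- The upper bound goes through z. The lower bound holds because a shorter connection would make
  -- the distance from a to b less than the sum of the two legs.
  have mixed : ∀ s ∈ Icc 0 (d a z), ∀ t ∈ Icc 0 (d z b), d (γ s) (η t) = t + d a z - s := by
    intro s hs t ht
    apply le_antisymm
    · have := triangle (γ s) z (η t)
      rw [hz s hs, hz' t ht] at this
      linarith
    · have t1 := triangle a (γ s) b
      have t2 := triangle (γ s) (η t) b
      rw [ha s hs] at t1
      rw [hb t ht] at t2
      linarith
  refine ⟨fun s => if s ≤ d a z then γ s else η (s - d a z), by simp [n1, g0], ?_, ?_⟩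
  · by_cases hc : d a b ≤ d a z
    · have h0 : d z b = 0 := by linarith
      simp only [if_pos hc]
      rw [h0, e0] at e1
      rw [← e1, g1]
    · simp only [if_neg hc]
      rw [h, add_sub_cancel_left, e1]
  · intro s hs t ht
    by_cases c1 : s ≤ d a z <;> by_cases c2 : t ≤ d a z
    · simp only [if_pos c1, if_pos c2]
      exact g2 s ⟨hs.1, c1⟩ t ⟨ht.1, c2⟩
    · simp only [if_pos c1, if_neg c2]
      push Not at c2
      rw [mixed s ⟨hs.1, c1⟩ _ ⟨by linarith, by linarith [ht.2]⟩, abs_sub_comm,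
        abs_of_nonneg (by linarith)]
      ring
    · simp only [if_neg c1, if_pos c2]
      push Not at c1
      rw [comm, mixed t ⟨ht.1, c2⟩ _ ⟨by linarith, by linarith [hs.2]⟩,
        abs_of_nonneg (by linarith)]
      ring
    · simp only [if_neg c1, if_neg c2]
      push Not at c1 c2
      rw [e2 _ ⟨by linarith, by linarith [hs.2]⟩ _ ⟨by linarith, by linarith [ht.2]⟩]
      congr 1
      ring

/-- On a compact space, a distance that is continuous at the diagonal induces the topology. -/
theorem isOpen_iff_of_compact {S : Type*} [TopologicalSpace S] [CompactSpace S] {d : S → S → ℝ}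
    (self : ∀ a, d a a = 0) (comm : ∀ a b, d a b = d b a)
    (triangle : ∀ a b c, d a c ≤ d a b + d b c) (eq_of_zero : ∀ a b, d a b = 0 → a = b)
    (cont : ∀ a, ContinuousAt (fun b => d a b) a) (U : Set S) :
    IsOpen U ↔ ∀ a ∈ U, ∃ ε > 0, ∀ b, d a b < ε → b ∈ U := by
  have nonneg := dist_nonneg_of_triangle self comm triangle
  have small : ∀ a, ∀ ε > 0, ∀ᶠ b in 𝓝 a, d a b < ε := by
    intro a ε hε
    have h0 : d a a < ε := by rw [self]; exact hε
    exact (cont a).eventually (eventually_lt_nhds h0)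
  constructor
  · intro hU a ha
    have hc : Continuous fun b => d a b := by
      rw [continuous_iff_continuousAt]
      intro b
      rw [ContinuousAt, Metric.tendsto_nhds]
      intro ε hε
      filter_upwards [small b ε hε] with c hbc
      rw [Real.dist_eq, abs_lt]
      have t1 := triangle a b c
      have t2 := triangle a c b
      rw [comm c b] at t2
      constructor <;> linarith
    rcases Uᶜ.eq_empty_or_nonempty with he | hne
    · refine ⟨1, one_pos, fun b _ => ?_⟩
      rw [compl_empty_iff] at he
      rw [he]; trivial
    -- The radius is the distance to the compact complement, which is attained and hence positive.
    · obtain ⟨c, hcU, hmin⟩ := (hU.isClosed_compl.isCompact).exists_isMinOn hne hc.continuousOn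
      refine ⟨d a c, lt_of_le_of_ne (nonneg a c) ?_, fun b hb => ?_⟩
      · intro h0
        exact hcU (eq_of_zero a c h0.symm ▸ ha)
      · by_contra hbU
        exact absurd (hmin hbU) (not_le.2 hb)
  · intro h
    rw [isOpen_iff_mem_nhds]
    intro a ha
    obtain ⟨ε, hε, h1⟩ := h a ha
    filter_upwards [small a ε hε] with b hb using h1 b hb

namespace IsGeodesicMetric

variable {S : Type*} [TopologicalSpace S] {d : S → S → ℝ} (hd : IsGeodesicMetric d)
include hd

theorem nonneg (a b : S) : 0 ≤ d a b := dist_nonneg_of_triangle hd.self hd.comm hd.triangle a b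

theorem eventually_lt (a : S) {ε : ℝ} (hε : 0 < ε) : ∀ᶠ b in 𝓝 a, d a b < ε := by
  have : IsOpen {b | d a b < ε} := by
    rw [hd.isOpen_iff]
    intro b hb
    refine ⟨ε - d a b, sub_pos.2 hb, fun c hc => ?_⟩
    have := hd.triangle a b c
    exact lt_of_le_of_lt this (by linarith)
  exact this.mem_nhds (by simpa [hd.self] using hε)

theorem continuous_right (a : S) : Continuous (d a) := by
  rw [continuous_iff_continuousAt]
  intro b
  rw [ContinuousAt, Metric.tendsto_nhds]
  intro ε hε
  filter_upwards [hd.eventually_lt b hε] with c hbc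
  rw [Real.dist_eq, abs_lt]
  have t1 := hd.triangle a b c
  have t2 := hd.triangle a c b
  rw [hd.comm c b] at t2
  constructor <;> linarith

end IsGeodesicMetric

/-! ### The double of a disc -/

theorem foldDouble_toDouble (s : Bool) (a : Disc) : foldDouble (toDouble s a) = a := rfl

theorem toDouble_eq_iff {s t : Bool} {a b : Disc} :
    toDouble s a = toDouble t b ↔ a = b ∧ (s = t ∨ a ∈ discBoundary) :=
  ⟨fun h => Quotient.exact h, fun h => Quotient.sound h⟩

theorem toDouble_of_mem {a : Disc} (ha : a ∈ discBoundary) (s t : Bool) :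
    toDouble s a = toDouble t a := toDouble_eq_iff.2 ⟨rfl, Or.inr ha⟩

theorem exists_toDouble (p : DoubleDisc) : ∃ s a, toDouble s a = p := by
  induction p using Quotient.inductionOn with
  | h q => exact ⟨q.2, q.1, rfl⟩

theorem toDouble_mem_range {s t : Bool} {a : Disc} :
    toDouble s a ∈ range (toDouble t) ↔ s = t ∨ a ∈ discBoundary := by
  constructor
  · rintro ⟨b, hb⟩
    obtain ⟨rfl, h⟩ := toDouble_eq_iff.1 hb
    exact h.imp Eq.symm id
  · intro h
    exact ⟨a, toDouble_eq_iff.2 ⟨rfl, h.imp Eq.symm id⟩⟩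

theorem continuous_toDouble (s : Bool) : Continuous (toDouble s) :=
  continuous_quotient_mk'.comp (by fun_prop : Continuous fun a : Disc => (a, s))

theorem isClosed_discBoundary : IsClosed discBoundary :=
  isClosed_eq (by fun_prop) continuous_const

theorem discBoundary_nonempty : discBoundary.Nonempty := ⟨⟨1, by simp⟩, by simp [discBoundary]⟩

instance : CompactSpace Disc := isCompact_iff_compactSpace.1 (isCompact_closedBall (0 : ℂ) 1)

/-- The length of a shortest path from `a` to `b` through the boundary. -/
def crossDist (d : Disc → Disc → ℝ) (a b : Disc) : ℝ :=
  ⨅ z : discBoundary, (d a z + d z b)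

section Double

variable {d : Disc → Disc → ℝ} (hd : IsGeodesicMetric d)
include hd

theorem crossDist_le (a b : Disc) {z : Disc} (hz : z ∈ discBoundary) :
    crossDist d a b ≤ d a z + d z b :=
  ciInf_le (f := fun z : discBoundary => d a z + d z b)
    ⟨0, by rintro _ ⟨y, rfl⟩; exact add_nonneg (hd.nonneg _ _) (hd.nonneg _ _)⟩ ⟨z, hz⟩

theorem exists_crossDist_eq (a b : Disc) : ∃ z ∈ discBoundary, crossDist d a b = d a z + d z b := by
  have hc : Continuous fun z => d a z + d z b := by
    simp only [hd.comm _ b]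
    exact (hd.continuous_right a).add (hd.continuous_right b)
  obtain ⟨z, hz, hmin⟩ := isClosed_discBoundary.isCompact.exists_isMinOn discBoundary_nonempty
    hc.continuousOn
  refine ⟨z, hz, le_antisymm (crossDist_le hd a b hz) ?_⟩
  have : Nonempty discBoundary := ⟨⟨z, hz⟩⟩
  exact le_ciInf fun y => hmin y.2

theorem le_crossDist {a b : Disc} {c : ℝ} (h : ∀ z ∈ discBoundary, c ≤ d a z + d z b) :
    c ≤ crossDist d a b := by
  obtain ⟨z, hz, h1⟩ := exists_crossDist_eq hd a b
  exact h1 ▸ h z hz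

theorem crossDist_comm (a b : Disc) : crossDist d a b = crossDist d b a := by
  simp only [crossDist, hd.comm _ b, hd.comm a, add_comm]

/-- A boundary point can itself be taken as the crossing point. Hence the two cases in the
definition of the distance on the double are consistent along the seam. -/
theorem crossDist_of_mem {a b : Disc} (h : a ∈ discBoundary ∨ b ∈ discBoundary) :
    crossDist d a b = d a b := by
  apply le_antisymm
  · rcases h with h | h
    · simpa [hd.self] using crossDist_le hd a b h
    · simpa [hd.self] using crossDist_le hd a b h
  · exact le_crossDist hd fun z _ => hd.triangle a z b

omit hd in
theorem doubleDist_same (s : Bool) (a b : Disc) :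
    doubleDist d (toDouble s a) (toDouble s b) = d a b := by
  rw [doubleDist, if_pos ⟨s, mem_range_self _, mem_range_self _⟩]
  rfl

theorem doubleDist_cross {s t : Bool} (h : s ≠ t) (a b : Disc) :
    doubleDist d (toDouble s a) (toDouble t b) = crossDist d a b := by
  by_cases hm : a ∈ discBoundary ∨ b ∈ discBoundary
  · rw [crossDist_of_mem hd hm]
    rcases hm with hm | hm
    · rw [toDouble_of_mem hm s t, doubleDist_same]
    · rw [toDouble_of_mem hm t s, doubleDist_same]
  · push Not at hm
    rw [doubleDist, if_neg]
    · rfl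
    · rintro ⟨u, h1, h2⟩
      rw [toDouble_mem_range] at h1 h2
      have := h1.resolve_right hm.1
      have := h2.resolve_right hm.2
      exact h (by simp_all)

theorem crossDist_triangle (a b c : Disc) : crossDist d a c ≤ d a b + crossDist d b c := by
  obtain ⟨z, hz, h⟩ := exists_crossDist_eq hd b c
  have := crossDist_le hd a c hz
  have := hd.triangle a b z
  linarith

theorem dist_le_crossDist_add (a b c : Disc) : d a c ≤ crossDist d a b + crossDist d b c := by
  obtain ⟨z, hz, h⟩ := exists_crossDist_eq hd a b
  obtain ⟨y, hy, h'⟩ := exists_crossDist_eq hd b c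
  have := hd.triangle a z b
  have := hd.triangle b y c
  have := hd.triangle a b c
  linarith

theorem dist_fold_le_doubleDist (p q : DoubleDisc) :
    d (foldDouble p) (foldDouble q) ≤ doubleDist d p q := by
  obtain ⟨s, a, rfl⟩ := exists_toDouble p
  obtain ⟨t, b, rfl⟩ := exists_toDouble q
  by_cases h : s = t
  · subst h; rw [doubleDist_same]; rfl
  · rw [doubleDist_cross hd h]
    exact le_crossDist hd fun z _ => hd.triangle a z b

theorem doubleDist_self (p : DoubleDisc) : doubleDist d p p = 0 := by
  obtain ⟨s, a, rfl⟩ := exists_toDouble p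
  rw [doubleDist_same, hd.self]

theorem doubleDist_comm (p q : DoubleDisc) : doubleDist d p q = doubleDist d q p := by
  obtain ⟨s, a, rfl⟩ := exists_toDouble p
  obtain ⟨t, b, rfl⟩ := exists_toDouble q
  by_cases h : s = t
  · subst h; rw [doubleDist_same, doubleDist_same, hd.comm]
  · rw [doubleDist_cross hd h, doubleDist_cross hd (Ne.symm h), crossDist_comm hd]

theorem doubleDist_triangle (p q r : DoubleDisc) :
    doubleDist d p r ≤ doubleDist d p q + doubleDist d q r := by
  obtain ⟨s, a, rfl⟩ := exists_toDouble p
  obtain ⟨t, b, rfl⟩ := exists_toDouble q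
  obtain ⟨u, c, rfl⟩ := exists_toDouble r
  by_cases h1 : s = t
  · subst h1
    by_cases h2 : s = u
    · subst h2
      simp only [doubleDist_same]
      exact hd.triangle _ _ _
    · simp only [doubleDist_same, doubleDist_cross hd h2]
      exact crossDist_triangle hd _ _ _
  · by_cases h2 : t = u
    · subst h2
      simp only [doubleDist_same, doubleDist_cross hd h1]
      rw [crossDist_comm hd a c, crossDist_comm hd a b, hd.comm b c, add_comm]
      exact crossDist_triangle hd _ _ _
    · have : s = u := by cases s <;> cases t <;> cases u <;> simp_all
      subst this
      simp only [doubleDist_same, doubleDist_cross hd h1, doubleDist_cross hd h2]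
      exact dist_le_crossDist_add hd _ _ _

theorem eq_of_doubleDist_eq_zero (p q : DoubleDisc) (h0 : doubleDist d p q = 0) : p = q := by
  obtain ⟨s, a, rfl⟩ := exists_toDouble p
  obtain ⟨t, b, rfl⟩ := exists_toDouble q
  have hab : a = b := by
    have := dist_fold_le_doubleDist hd (toDouble s a) (toDouble t b)
    rw [h0] at this
    exact hd.eq_of_zero _ _ (le_antisymm this (hd.nonneg _ _))
  subst hab
  by_cases h : s = t
  · rw [h]
  · rw [doubleDist_cross hd h] at h0
    obtain ⟨z, hz, h1⟩ := exists_crossDist_eq hd a a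
    have n1 := hd.nonneg a z
    have n2 := hd.nonneg z a
    have : a = z := hd.eq_of_zero _ _ (by linarith)
    exact toDouble_of_mem (this ▸ hz) _ _

theorem continuous_doubleDist_right (p : DoubleDisc) : Continuous (doubleDist d p) := by
  apply isQuotientMap_quotient_mk'.continuous_iff.2
  have : ∀ t : Bool, Continuous fun b : Disc => doubleDist d p (toDouble t b) := by
    intro t
    rw [continuous_iff_continuousAt]
    intro b
    rw [ContinuousAt, Metric.tendsto_nhds]
    intro ε hε
    filter_upwards [hd.eventually_lt b hε] with c hbc
    rw [Real.dist_eq, abs_lt]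
    have t1 := doubleDist_triangle hd p (toDouble t b) (toDouble t c)
    have t2 := doubleDist_triangle hd p (toDouble t c) (toDouble t b)
    rw [doubleDist_same] at t1 t2
    rw [hd.comm c b] at t2
    constructor <;> linarith
  rw [continuous_prod_of_discrete_right]
  exact this

theorem hasGeodesic_doubleDist_same (s : Bool) (a b : Disc) :
    HasGeodesic (doubleDist d) (toDouble s a) (toDouble s b) := by
  obtain ⟨γ, g0, g1, g2⟩ := hd.geodesic a b
  refine ⟨fun t => toDouble s (γ t), by simp only [g0], ?_, ?_⟩
  · simp only [doubleDist_same, g1]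
  · simp only [doubleDist_same]
    exact g2

/-- Since the boundary is compact, an optimal crossing point exists. A geodesic between the sheets
is the concatenation of geodesics to and from that point. -/
theorem isGeodesicMetric_doubleDist : IsGeodesicMetric (doubleDist d) where
  self := doubleDist_self hd
  comm := doubleDist_comm hd
  triangle := doubleDist_triangle hd
  eq_of_zero := eq_of_doubleDist_eq_zero hd
  isOpen_iff := isOpen_iff_of_compact (doubleDist_self hd) (doubleDist_comm hd)
    (doubleDist_triangle hd) (eq_of_doubleDist_eq_zero hd)
    fun a => (continuous_doubleDist_right hd a).continuousAt
  geodesic := by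
    intro p q
    change HasGeodesic (doubleDist d) p q
    obtain ⟨s, a, rfl⟩ := exists_toDouble p
    obtain ⟨t, b, rfl⟩ := exists_toDouble q
    by_cases h : s = t
    · subst h
      exact hasGeodesic_doubleDist_same hd s a b
    · obtain ⟨z, hz, h1⟩ := exists_crossDist_eq hd a b
      refine HasGeodesic.concat (z := toDouble s z) (doubleDist_self hd) (doubleDist_comm hd)
        (doubleDist_triangle hd) ?_ (hasGeodesic_doubleDist_same hd s a z) ?_
      · rw [doubleDist_cross hd h, h1, doubleDist_same, toDouble_of_mem hz s t,
          doubleDist_same]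
      · rw [toDouble_of_mem hz s t]
        exact hasGeodesic_doubleDist_same hd t z b

end Double

/-! ### Charts at boundary points and cone points -/

/-- `φ` is an angular coordinate of a sector of angle `θ` on the ball of radius `r` about `p`. -/
structure IsSectorChart {S : Type*} (B : Set S) (d : S → S → ℝ) (p : S) (θ r : ℝ) (φ : S → ℝ) :
    Prop where
  radius_pos : 0 < r
  radius_le : r ≤ Real.pi / 2
  mem_Icc : ∀ a, d p a < r → φ a ∈ Icc 0 θ
  dist_eq : ∀ a b, d p a < r → d p b < r → d a b = sphConeDist (d p a) (d p b) |φ a - φ b|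
  surj : ∀ ρ ∈ Ioo 0 r, ∀ ψ ∈ Icc 0 θ, ∃ a, d p a = ρ ∧ φ a = ψ
  boundary : ∀ a, a ≠ p → d p a < r → (a ∈ B ↔ φ a = 0 ∨ φ a = θ)

theorem IsSectorChart.isSectorPoint {S : Type*} {B : Set S} {d : S → S → ℝ} {p : S} {θ r : ℝ}
    {φ : S → ℝ} (h : IsSectorChart B d p θ r φ) (hθ : 0 < θ) (hp : p ∈ B) :
    IsSectorPoint B d p θ :=
  ⟨hθ, hp, r, h.radius_pos, h.radius_le, φ, h.mem_Icc, h.dist_eq, h.surj, h.boundary⟩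

theorem IsSectorPoint.exists_chart {S : Type*} {B : Set S} {d : S → S → ℝ} {p : S} {θ : ℝ}
    (h : IsSectorPoint B d p θ) : ∃ r φ, IsSectorChart B d p θ r φ := by
  obtain ⟨_, _, r, h1, h2, φ, h3, h4, h5, h6⟩ := h
  exact ⟨r, φ, h1, h2, h3, h4, h5, h6⟩

theorem sphConeDist_zero_left {σ : ℝ} (δ : ℝ) (hσ : 0 ≤ σ) (h : σ ≤ Real.pi) :
    sphConeDist 0 σ δ = σ := by
  by_cases hδ : δ < Real.pi
  · rw [sphConeDist, if_pos hδ]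
    simp [Real.arccos_cos hσ h]
  · rw [sphConeDist, if_neg hδ, zero_add]

theorem AddCircle.norm_coe_of_abs_le {θ x : ℝ} (hθ : 0 < θ) (hx : |x| ≤ θ) :
    ‖(x : AddCircle (2 * θ))‖ = |x| := by
  have h2 : 0 < 2 * θ := by positivity
  refine (AddCircle.norm_coe_eq_abs_iff (2 * θ) h2.ne').2 ?_
  rw [abs_of_pos h2]
  linarith

/-- Negation on the circle of length 2θ fixes 0 and θ, the angles of the two sides of the sector.
This lets φ on one sheet and -φ on the other agree along the seam. -/
theorem AddCircle.neg_half_period (θ : ℝ) : -((θ : ℝ) : AddCircle (2 * θ)) = (θ : ℝ) := by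
  rw [neg_eq_iff_add_eq_zero, ← AddCircle.coe_add, ← two_mul]
  exact AddCircle.coe_period _

/-! ### Doubled sectors as cones -/

section Double

variable {d : Disc → Disc → ℝ} (hd : IsGeodesicMetric d) {p : Disc} {θ r : ℝ} {φ : Disc → ℝ}

open Classical in
/-- The angular coordinate on the double induced by an angular coordinate of a sector. -/
def doubleAngle (θ : ℝ) (φ : Disc → ℝ) (q : DoubleDisc) : AddCircle (2 * θ) :=
  if q ∈ range (toDouble false) then ((φ (foldDouble q) : ℝ) : AddCircle (2 * θ))
  else -((φ (foldDouble q) : ℝ) : AddCircle (2 * θ))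

theorem doubleAngle_false (a : Disc) : doubleAngle θ φ (toDouble false a) = (φ a : ℝ) := by
  rw [doubleAngle, if_pos (mem_range_self _)]
  rfl

theorem doubleAngle_true (hc : IsSectorChart discBoundary d p θ r φ) {a : Disc} (ha : a ≠ p)
    (har : d p a < r) : doubleAngle θ φ (toDouble true a) = -((φ a : ℝ) : AddCircle (2 * θ)) := by
  by_cases h : a ∈ discBoundary
  · rw [toDouble_of_mem h true false, doubleAngle_false]
    rcases (hc.boundary a ha har).1 h with h1 | h1
    · simp [h1]
    · rw [h1, AddCircle.neg_half_period]
  · rw [doubleAngle, if_neg]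
    · rfl
    · rw [toDouble_mem_range]
      simp [h]

include hd

/-- In the doubled sector the points sit at angles φ a and -φ b, and the norm of φ a + φ b is the
smaller of the two angles between them, measured across the side 0 or the side θ. A path realizing
it crosses that side, or passes through p when the angle is at least π. Conversely, no crossing
point does better, by the triangle inequality in the cone. -/
theorem crossDist_eq_sphConeDist (hθ : 0 < θ) (hp : p ∈ discBoundary)
    (hc : IsSectorChart discBoundary d p θ r φ) {a b : Disc} (ha : d p a < r / 3)
    (hb : d p b < r / 3) :
    crossDist d a b = sphConeDist (d p a) (d p b) ‖((φ a + φ b : ℝ) : AddCircle (2 * θ))‖ := by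
  have hr := hc.radius_pos
  have hr2 := hc.radius_le
  have har : d p a < r := by linarith
  have hbr : d p b < r := by linarith
  have na := hd.nonneg p a
  have nb := hd.nonneg p b
  have φa := hc.mem_Icc a har
  have φb := hc.mem_Icc b hbr
  have ia : d p a ∈ Icc 0 (Real.pi / 2) := ⟨na, by linarith⟩
  have ib : d p b ∈ Icc 0 (Real.pi / 2) := ⟨nb, by linarith⟩
  have hle := sphConeDist_le_add na nb (by linarith)
    (norm_nonneg ((φ a + φ b : ℝ) : AddCircle (2 * θ)))
  apply le_antisymm
  · have thru : ∀ ψ : ℝ, (ψ = 0 ∨ ψ = θ) → |φ a - ψ| + |ψ - φ b| < Real.pi →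
        crossDist d a b ≤ sphConeDist (d p a) (d p b) (|φ a - ψ| + |ψ - φ b|) := by
      intro ψ hψ hlt
      obtain ⟨t, ht, l2, h1⟩ := exists_sphConeDist_eq_add ia ib (abs_nonneg (φ a - ψ))
        (abs_nonneg (ψ - φ b)) hlt
      rw [h1]
      rcases ht.eq_or_lt with h0 | h0
      · subst h0
        have := crossDist_le hd a b hp
        rw [sphConeDist_comm (d p a), sphConeDist_zero_left _ na (by linarith),
          sphConeDist_zero_left _ nb (by linarith)]
        rwa [hd.comm a p] at this
      -- Here t ≤ d p a + (d p a + d p b), a sum of three terms below r / 3. This is why the radius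
      -- is divided by three.
      · have htr : t < r := by
          by_contra hge
          push Not at hge
          have l1 : sphConeDist (d p a) t |φ a - ψ| ≤ d p a + d p b := by
            have := sphConeDist_le_add na nb (by linarith)
              (add_nonneg (abs_nonneg (φ a - ψ)) (abs_nonneg (ψ - φ b)))
            have nn : 0 ≤ sphConeDist t (d p b) |ψ - φ b| := by
              rw [sphConeDist]
              split_ifs
              · exact Real.arccos_nonneg _
              · linarith
            linarith
          linarith
        obtain ⟨z, hz1, hz2⟩ := hc.surj t ⟨h0, htr⟩ ψ (by
          rcases hψ with h | h <;> rw [h]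
          · exact ⟨le_rfl, hθ.le⟩
          · exact ⟨hθ.le, le_rfl⟩)
        have hzp : z ≠ p := by
          rintro rfl
          rw [hd.self] at hz1
          linarith
        have hzB : z ∈ discBoundary := by
          rw [hc.boundary z hzp (by rw [hz1]; exact htr), hz2]
          exact hψ
        have := crossDist_le hd a b hzB
        rw [hc.dist_eq a z har (by rw [hz1]; exact htr),
          hc.dist_eq z b (by rw [hz1]; exact htr) hbr, hz1, hz2] at this
        exact this
    have norm_cases : ∃ ψ : ℝ, (ψ = 0 ∨ ψ = θ) ∧
        ‖((φ a + φ b : ℝ) : AddCircle (2 * θ))‖ = |φ a - ψ| + |ψ - φ b| := by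
      rcases le_total (φ a + φ b) θ with h | h
      · refine ⟨0, Or.inl rfl, ?_⟩
        rw [AddCircle.norm_coe_of_abs_le hθ (by rw [abs_le]; constructor <;> linarith [φa.1, φb.1]),
          abs_of_nonneg (by linarith [φa.1, φb.1]), sub_zero, zero_sub, abs_neg,
          abs_of_nonneg φa.1, abs_of_nonneg φb.1]
      · refine ⟨θ, Or.inr rfl, ?_⟩
        have : ((φ a + φ b : ℝ) : AddCircle (2 * θ)) = ((φ a + φ b - 2 * θ : ℝ) : AddCircle (2 * θ)) := by
          rw [AddCircle.coe_sub, AddCircle.coe_period, sub_zero]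
        rw [this, AddCircle.norm_coe_of_abs_le hθ
          (by rw [abs_le]; constructor <;> linarith [φa.2, φb.2]),
          abs_of_nonpos (by linarith [φa.2, φb.2]), abs_of_nonpos (by linarith [φa.2]),
          abs_of_nonneg (by linarith [φb.2])]
        ring
    obtain ⟨ψ, hψ, hn⟩ := norm_cases
    rw [hn]
    by_cases hlt : |φ a - ψ| + |ψ - φ b| < Real.pi
    · exact thru ψ hψ hlt
    · rw [sphConeDist_of_pi_le (not_lt.1 hlt), hd.comm p a]
      exact crossDist_le hd a b hp
  · refine le_crossDist hd fun z hz => ?_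
    by_cases hzr : d p z < r
    · by_cases hzp : z = p
      · subst hzp
        rw [hd.comm a z]
        exact hle
      have hψ := (hc.boundary z hzp hzr).1 hz
      rw [hc.dist_eq a z har hzr, hc.dist_eq z b hzr hbr]
      refine sphConeDist_triangle ia ib ⟨hd.nonneg p z, by linarith⟩ (abs_nonneg _) (abs_nonneg _)
        (norm_nonneg _) ?_
      -- A boundary point z has angle 0 or θ, so 2 φ z vanishes on the circle and z may be inserted
      -- between a and -b.
      have e : ((φ a + φ b : ℝ) : AddCircle (2 * θ)) =
          ((φ a - φ z : ℝ) : AddCircle (2 * θ)) - ((φ z - φ b : ℝ) : AddCircle (2 * θ)) := by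
        have : ((φ z : ℝ) : AddCircle (2 * θ)) + (φ z : ℝ) = 0 := by
          rcases hψ with h | h <;> rw [h]
          · simp
          · rw [← neg_eq_iff_add_eq_zero, AddCircle.neg_half_period]
        rw [AddCircle.coe_sub, AddCircle.coe_sub, AddCircle.coe_add]
        calc ((φ a : ℝ) : AddCircle (2 * θ)) + (φ b : ℝ)
            = (φ a : ℝ) + (φ b : ℝ) - (((φ z : ℝ) : AddCircle (2 * θ)) + (φ z : ℝ)) := by
              rw [this, sub_zero]
          _ = _ := by abel
      have φz : φ z ∈ Icc 0 θ := hc.mem_Icc z hzr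
      rw [e]
      refine (norm_sub_le _ _).trans (add_le_add (le_of_eq ?_) (le_of_eq ?_))
      · exact AddCircle.norm_coe_of_abs_le hθ
          (by rw [abs_le]; constructor <;> linarith [φa.1, φa.2, φz.1, φz.2])
      · exact AddCircle.norm_coe_of_abs_le hθ
          (by rw [abs_le]; constructor <;> linarith [φb.1, φb.2, φz.1, φz.2])
    -- A crossing point outside the chart has distance more than 2r/3 from both a and b, longer than
    -- the detour through p.
    · push Not at hzr
      have t1 := hd.triangle p a z
      have t2 := hd.triangle p b z
      rw [hd.comm b z] at t2
      linarith

/-- On the double, the distance near a boundary point in doubled polar coordinates. -/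
theorem doubleDist_eq_sphConeDist (hθ : 0 < θ) (hp : p ∈ discBoundary)
    (hc : IsSectorChart discBoundary d p θ r φ) {x y : DoubleDisc}
    (hx : d p (foldDouble x) < r / 3) (hy : d p (foldDouble y) < r / 3) :
    doubleDist d x y = sphConeDist (d p (foldDouble x)) (d p (foldDouble y))
      ‖doubleAngle θ φ x - doubleAngle θ φ y‖ := by
  obtain ⟨s, a, rfl⟩ := exists_toDouble x
  obtain ⟨t, b, rfl⟩ := exists_toDouble y
  rw [foldDouble_toDouble] at hx hy ⊢
  rw [foldDouble_toDouble]
  have hr := hc.radius_pos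
  have hr2 := hc.radius_le
  have har : d p a < r := by linarith
  have hbr : d p b < r := by linarith
  have φa := hc.mem_Icc a har
  have φb := hc.mem_Icc b hbr
  have hdiff : ‖((φ a : ℝ) : AddCircle (2 * θ)) - (φ b : ℝ)‖ = |φ a - φ b| := by
    rw [← AddCircle.coe_sub]
    exact AddCircle.norm_coe_of_abs_le hθ
      (by rw [abs_le]; constructor <;> linarith [φa.1, φa.2, φb.1, φb.2])
  by_cases hap : a = p
  · subst hap
    rw [hd.self, sphConeDist_zero_left _ (hd.nonneg _ _) (by linarith), toDouble_of_mem hp s t,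
      doubleDist_same]
  by_cases hbp : b = p
  · subst hbp
    rw [hd.self, sphConeDist_comm, sphConeDist_zero_left _ (hd.nonneg _ _) (by linarith),
      toDouble_of_mem hp t s, doubleDist_same, hd.comm]
  cases s <;> cases t
  · rw [doubleDist_same, doubleAngle_false, doubleAngle_false, hdiff, hc.dist_eq a b har hbr]
  · rw [doubleDist_cross hd (by decide), doubleAngle_false, doubleAngle_true hc hbp hbr,
      sub_neg_eq_add, ← AddCircle.coe_add, crossDist_eq_sphConeDist hd hθ hp hc hx hy]
  · rw [doubleDist_cross hd (by decide), doubleAngle_false, doubleAngle_true hc hap har,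
      ← neg_add', norm_neg, ← AddCircle.coe_add, crossDist_eq_sphConeDist hd hθ hp hc hx hy]
  · rw [doubleDist_same, doubleAngle_true hc hap har, doubleAngle_true hc hbp hbr,
      ← neg_sub', norm_neg, hdiff, hc.dist_eq a b har hbr]

omit hd in
theorem doubleDist_toDouble_left (hp : p ∈ discBoundary) (s : Bool) (x : DoubleDisc) :
    doubleDist d (toDouble s p) x = d p (foldDouble x) := by
  obtain ⟨t, b, rfl⟩ := exists_toDouble x
  rw [toDouble_of_mem hp s t, doubleDist_same, foldDouble_toDouble]

theorem isConePoint_double_of_sector (hs : IsSectorPoint discBoundary d p θ) (s : Bool) :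
    IsConePoint (doubleDist d) (toDouble s p) (2 * θ) := by
  have hθ := hs.1
  have hp := hs.2.1
  obtain ⟨r, φ, hc⟩ := hs.exists_chart
  have hr := hc.radius_pos
  refine ⟨by positivity, r / 3, by positivity, by linarith [hc.radius_le], doubleAngle θ φ, ?_, ?_⟩
  · intro x y hx hy
    rw [doubleDist_toDouble_left hp] at hx hy ⊢
    rw [doubleDist_toDouble_left hp]
    exact doubleDist_eq_sphConeDist hd hθ hp hc hx hy
  · intro ρ hρ ψ
    have : Fact (0 < 2 * θ) := ⟨by positivity⟩
    -- With representatives in (-θ, θ], nonnegative angles are realized on the first sheet and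
    -- negative ones on the second.
    obtain ⟨x, hx, rfl⟩ : ∃ x : ℝ, x ∈ Ioc (-θ) (-θ + 2 * θ) ∧ (x : AddCircle (2 * θ)) = ψ := by
      have := AddCircle.coe_image_Ioc_eq (2 * θ) (-θ)
      have h2 : ψ ∈ (univ : Set (AddCircle (2 * θ))) := trivial
      rw [← this] at h2
      exact h2
    have hρr : ρ ∈ Ioo 0 r := ⟨hρ.1, by linarith [hρ.2]⟩
    rcases le_or_gt 0 x with h0 | h0
    · obtain ⟨a, ha1, ha2⟩ := hc.surj ρ hρr x ⟨h0, by linarith [hx.2]⟩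
      refine ⟨toDouble false a, ?_, ?_⟩
      · rw [doubleDist_toDouble_left hp, foldDouble_toDouble, ha1]
      · rw [doubleAngle_false, ha2]
    · obtain ⟨a, ha1, ha2⟩ := hc.surj ρ hρr (-x) ⟨by linarith, by linarith [hx.1]⟩
      refine ⟨toDouble true a, ?_, ?_⟩
      · rw [doubleDist_toDouble_left hp, foldDouble_toDouble, ha1]
      · have hap : a ≠ p := by
          rintro rfl
          rw [hd.self] at ha1
          linarith [hρ.1]
        rw [doubleAngle_true hc hap (by rw [ha1]; exact hρr.2), ha2, AddCircle.coe_neg, neg_neg]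

/-- A path to the other sheet must reach the boundary, so a ball smaller than the distance to the
boundary stays in one sheet. -/
theorem doubleDist_lt_mem_range (hp : p ∉ discBoundary) (s : Bool) :
    ∃ ε > 0, ∀ x, doubleDist d (toDouble s p) x < ε → ∃ b, b ∉ discBoundary ∧ x = toDouble s b := by
  obtain ⟨ε, hε, h⟩ := (hd.isOpen_iff discBoundaryᶜ).1 isClosed_discBoundary.isOpen_compl p hp
  refine ⟨ε, hε, fun x hx => ?_⟩
  obtain ⟨t, b, rfl⟩ := exists_toDouble x
  have hb : d p b < ε := lt_of_le_of_lt (dist_fold_le_doubleDist hd (toDouble s p) (toDouble t b)) hx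
  refine ⟨b, h b hb, ?_⟩
  by_cases hst : s = t
  · rw [hst]
  · exfalso
    rw [doubleDist_cross hd hst] at hx
    obtain ⟨z, hz, h1⟩ := exists_crossDist_eq hd p b
    have := hd.nonneg z b
    exact h z (by linarith) hz

theorem isConePoint_double_of_interior (hp : p ∉ discBoundary) (hs : IsConePoint d p θ) (s : Bool) :
    IsConePoint (doubleDist d) (toDouble s p) θ := by
  obtain ⟨hθ, r, hr, hr2, φ, h1, h2⟩ := hs
  obtain ⟨ε, hε, h3⟩ := doubleDist_lt_mem_range hd hp s
  refine ⟨hθ, min r ε, by positivity, (min_le_left _ _).trans hr2, fun x => φ (foldDouble x), ?_, ?_⟩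
  · intro x y hx hy
    obtain ⟨a, -, rfl⟩ := h3 x (hx.trans_le (min_le_right _ _))
    obtain ⟨b, -, rfl⟩ := h3 y (hy.trans_le (min_le_right _ _))
    simp only [doubleDist_same, foldDouble_toDouble] at hx hy ⊢
    exact h1 a b (hx.trans_le (min_le_left _ _)) (hy.trans_le (min_le_left _ _))
  · intro ρ hρ ψ
    obtain ⟨a, ha1, ha2⟩ := h2 ρ ⟨hρ.1, hρ.2.trans_le (min_le_left _ _)⟩ ψ
    exact ⟨toDouble s a, by rw [doubleDist_same, ha1], ha2⟩

end Double

/-- The double of a spherical triangle is a sphere with three conical points. -/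
theorem IsSphericalTriangle.double {x : Fin 3 → Disc} {ϑ : Fin 3 → ℝ} {d : Disc → Disc → ℝ}
    (h : IsSphericalTriangle x ϑ d) : IsSphericalSurface (doubleVertex x) ϑ (doubleDist d) where
  compact := inferInstance
  metric := isGeodesicMetric_doubleDist h.metric
  injective := fun i j hij => h.injective (toDouble_eq_iff.1 hij).1
  smooth := by
    intro q hq
    obtain ⟨s, a, rfl⟩ := exists_toDouble q
    by_cases ha : a ∈ discBoundary
    · refine isConePoint_double_of_sector h.metric (h.edge a ha ?_) s
      rintro ⟨i, rfl⟩
      exact hq ⟨i, toDouble_of_mem ha _ _⟩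
    · exact isConePoint_double_of_interior h.metric ha (h.interior a ha) s
  cone := by
    intro i
    have := isConePoint_double_of_sector h.metric (h.vertex i) false
    rwa [← mul_assoc] at this

/-- The crossing point that is optimal for d is a test point for d', so a Lipschitz bound passes to
the double with the same constant. -/
theorem doubleDist_le_of_le {d d' : Disc → Disc → ℝ} (hd : IsGeodesicMetric d)
    (hd' : IsGeodesicMetric d') {K : ℝ} (h : ∀ a b, d' a b ≤ K * d a b) (p q : DoubleDisc) :
    doubleDist d' p q ≤ K * doubleDist d p q := by
  obtain ⟨s, a, rfl⟩ := exists_toDouble p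
  obtain ⟨t, b, rfl⟩ := exists_toDouble q
  by_cases hst : s = t
  · subst hst
    simpa only [doubleDist_same] using h a b
  · rw [doubleDist_cross hd hst, doubleDist_cross hd' hst]
    obtain ⟨z, hz, h1⟩ := exists_crossDist_eq hd a b
    rw [h1, mul_add]
    exact (crossDist_le hd' a b hz).trans (add_le_add (h a z) (h z b))

theorem IsAngleDeformableTriangle.double {x : Fin 3 → Disc} {ϑ : Fin 3 → ℝ} {d : Disc → Disc → ℝ}
    (h : IsAngleDeformableTriangle x ϑ d) :
    IsAngleDeformableSurface (doubleVertex x) ϑ (doubleDist d) := by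
  obtain ⟨N, hN, D, h1, h2, h3⟩ := h
  refine ⟨N, hN, fun ν => doubleDist (D ν), ?_, fun ν hν => (h2 ν hν).double, congrArg doubleDist h3⟩
  intro ν hν ε hε
  filter_upwards [h1 ν hν ε hε, self_mem_nhdsWithin] with μ hμ hμN p q
  exact ⟨doubleDist_le_of_le (h2 ν hν).metric (h2 μ hμN).metric (fun a b => (hμ a b).1) p q,
    doubleDist_le_of_le (h2 μ hμN).metric (h2 ν hν).metric (fun a b => (hμ a b).2) p q⟩

/-! ### Triangular regions of the sphere and their intrinsic distance -/

theorem exists_sphDist_ball_subset {p : Sphere2} {U : Set Sphere2} (hU : U ∈ 𝓝 p) :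
    ∃ r > 0, ∀ w, sphDist p w < r → w ∈ U := by
  have h := isOpen_iff_of_compact sphDist_self sphDist_comm sphDist_triangle
    (fun _ _ h => eq_of_sphDist_eq_zero h)
    (fun a => (continuous_sphDist.comp (by fun_prop : Continuous fun b => (a, b))).continuousAt)
    (interior U)
  obtain ⟨r, hr, h1⟩ := h.1 isOpen_interior p (mem_interior_iff_mem_nhds.2 hU)
  exact ⟨r, hr, fun w hw => interior_subset (h1 w hw)⟩

/-- After rotation by the mean m of the two angles, the directions are -β and β with β < π/2, so the
combination lies in the right half-plane. There its argument is compared with ±β through the sign of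
a sine. Rotating back does not meet the branch cut because φ and ψ lie in (-π, π). -/
theorem arg_add_mem_Icc {l k φ ψ : ℝ} (hl : 0 ≤ l) (hk : 0 ≤ k) (hlk : 0 < l + k)
    (hφ : -Real.pi < φ) (hψ : ψ < Real.pi) (h : φ ≤ ψ) (hlt : ψ - φ < Real.pi) :
    (l * Complex.exp (φ * Complex.I) + k * Complex.exp (ψ * Complex.I)).arg ∈ Icc φ ψ := by
  have hπ := Real.pi_pos
  set m := (φ + ψ) / 2 with hm
  set β := (ψ - φ) / 2 with hβ
  set w : ℂ := l * Complex.exp ((-β : ℝ) * Complex.I) + k * Complex.exp (β * Complex.I) with hw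
  have e : l * Complex.exp (φ * Complex.I) + k * Complex.exp (ψ * Complex.I)
      = w * Complex.exp (m * Complex.I) := by
    rw [hw, add_mul, mul_assoc, mul_assoc, ← Complex.exp_add, ← Complex.exp_add, ← add_mul,
      ← add_mul, ← Complex.ofReal_add, ← Complex.ofReal_add]
    congr 5 <;> simp only [hm, hβ] <;> ring
  have wre : w.re = (l + k) * Real.cos β := by
    rw [hw, Complex.add_re, Complex.re_ofReal_mul, Complex.re_ofReal_mul,
      Complex.exp_ofReal_mul_I_re, Complex.exp_ofReal_mul_I_re, Real.cos_neg]
    ring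
  have wim : w.im = (k - l) * Real.sin β := by
    rw [hw, Complex.add_im, Complex.im_ofReal_mul, Complex.im_ofReal_mul,
      Complex.exp_ofReal_mul_I_im, Complex.exp_ofReal_mul_I_im, Real.sin_neg]
    ring
  have cβ : 0 < Real.cos β := Real.cos_pos_of_mem_Ioo ⟨by linarith, by linarith⟩
  have sβ : 0 ≤ Real.sin β := Real.sin_nonneg_of_nonneg_of_le_pi (by linarith) (by linarith)
  have wpos : 0 < w.re := by rw [wre]; positivity
  set χ := w.arg with hχ
  have w0 : w ≠ 0 := by
    intro h0
    rw [h0] at wpos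
    simp at wpos
  have wn : 0 < ‖w‖ := norm_pos_iff.2 w0
  have hχ2 : |χ| < Real.pi / 2 := Complex.abs_arg_lt_pi_div_two_iff.2 (Or.inl wpos)
  obtain ⟨c1, c2⟩ := abs_lt.1 hχ2
  have re' : w.re = ‖w‖ * Real.cos χ := (Complex.norm_mul_cos_arg w).symm
  have im' : w.im = ‖w‖ * Real.sin χ := (Complex.norm_mul_sin_arg w).symm
  have u1 : χ ≤ β := by
    by_contra hcon
    push Not at hcon
    have s : 0 < Real.sin (χ - β) :=
      Real.sin_pos_of_pos_of_lt_pi (by linarith) (by linarith)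
    have : ‖w‖ * Real.sin (χ - β) = -(2 * l * Real.sin β * Real.cos β) := by
      rw [Real.sin_sub]
      calc ‖w‖ * (Real.sin χ * Real.cos β - Real.cos χ * Real.sin β)
          = w.im * Real.cos β - w.re * Real.sin β := by rw [re', im']; ring
        _ = _ := by rw [wre, wim]; ring
    have h1 : 0 < ‖w‖ * Real.sin (χ - β) := by positivity
    have h2 : 0 ≤ 2 * l * Real.sin β * Real.cos β := by positivity
    linarith
  have u2 : -β ≤ χ := by
    by_contra hcon
    push Not at hcon
    have s : 0 < Real.sin (-β - χ) :=
      Real.sin_pos_of_pos_of_lt_pi (by linarith) (by linarith)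
    have : ‖w‖ * Real.sin (-β - χ) = -(2 * k * Real.sin β * Real.cos β) := by
      rw [Real.sin_sub, Real.sin_neg, Real.cos_neg]
      calc ‖w‖ * (-Real.sin β * Real.cos χ - Real.cos β * Real.sin χ)
          = - w.im * Real.cos β - w.re * Real.sin β := by rw [re', im']; ring
        _ = _ := by rw [wre, wim]; ring
    have h1 : 0 < ‖w‖ * Real.sin (-β - χ) := by positivity
    have h2 : 0 ≤ 2 * k * Real.sin β * Real.cos β := by positivity
    linarith
  have e2 : (w * Complex.exp (m * Complex.I)) =
      (‖w‖ : ℝ) * (Complex.cos ((χ + m : ℝ) : ℂ) + Complex.sin ((χ + m : ℝ) : ℂ) * Complex.I) := by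
    rw [← Complex.exp_mul_I, Complex.ofReal_add, add_mul (χ : ℂ), Complex.exp_add, ← mul_assoc,
      Complex.norm_mul_exp_arg_mul_I]
  rw [e, e2, Complex.arg_mul_cos_add_sin_mul_I wn ⟨by linarith, by linarith⟩]
  constructor <;> linarith

/-- The intrinsic distance of a region that is star-shaped about the pole: points seen from the
pole under an angle of at least `π` are joined through the pole. -/
def coneDist (v w : Sphere2) : ℝ :=
  if |(horiz stdFrame v).arg - (horiz stdFrame w).arg| < Real.pi then sphDist v w
  else polarDist stdFrame v + polarDist stdFrame w

/-- The points of the hemisphere with pole `u` in the sector of angle `2 τ` at the pole. -/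
def region (u : Sphere2) (τ : ℝ) : Set Sphere2 :=
  {w | 0 ≤ inner ℝ (u : E3) (w : E3) ∧ ‖horiz stdFrame w‖ * Real.cos τ ≤ (horiz stdFrame w).re}

theorem coneDist_comm (v w : Sphere2) : coneDist v w = coneDist w v := by
  simp only [coneDist, sphDist_comm v w, abs_sub_comm (horiz stdFrame v).arg, add_comm]

theorem coneDist_self (v : Sphere2) : coneDist v v = 0 := by
  simp [coneDist, Real.pi_pos, sphDist_self]

theorem sphDist_le_coneDist (v w : Sphere2) : sphDist v w ≤ coneDist v w := by
  rw [coneDist]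
  split_ifs
  · exact le_rfl
  · have := sphDist_triangle v (framePole stdFrame) w
    rwa [sphDist_comm v (framePole stdFrame)] at this

theorem coneDist_le_add (v w : Sphere2) :
    coneDist v w ≤ polarDist stdFrame v + polarDist stdFrame w := by
  rw [coneDist]
  split_ifs
  · have := sphDist_triangle v (framePole stdFrame) w
    rwa [sphDist_comm v (framePole stdFrame)] at this
  · exact le_rfl

theorem polarDist_le_add_coneDist (v w : Sphere2) :
    polarDist stdFrame v ≤ polarDist stdFrame w + coneDist v w := by
  have := sphDist_triangle (framePole stdFrame) w v
  have h := sphDist_le_coneDist w v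
  rw [coneDist_comm v w]
  exact this.trans (by unfold polarDist; linarith)

theorem eq_of_coneDist_eq_zero {v w : Sphere2} (h : coneDist v w = 0) : v = w :=
  eq_of_sphDist_eq_zero (le_antisymm (h ▸ sphDist_le_coneDist v w) (sphDist_nonneg _ _))

/-- The pole of the standard frame. -/
abbrev stdPole : Sphere2 := framePole stdFrame

theorem horiz_stdPole : horiz stdFrame (stdPole : E3) = 0 := by
  apply Complex.ext <;> simp only [horiz, framePole, inner_frame] <;> simp

/-! ### Star-shaped regions: triangle inequality and geodesics -/

section Region

variable {u : Sphere2} {τ : ℝ} (hu : 0 < inner ℝ (u : E3) (stdPole : E3)) (h0 : 0 < τ)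
  (hπ : τ < Real.pi)

include h0 in
-- The cosine form of the sector condition is closed and includes the apex without a special case.
-- This lemma and the next translate between it and the angular form.
theorem abs_arg_le_of_mem {z : ℂ} (h : ‖z‖ * Real.cos τ ≤ z.re) : |z.arg| ≤ τ := by
  by_cases hz : z = 0
  · simp [hz, h0.le]
  · rw [← Complex.norm_mul_cos_arg z] at h
    have h1 := le_of_mul_le_mul_left h (norm_pos_iff.2 hz)
    rw [← Real.cos_abs z.arg] at h1
    by_contra hcon
    push Not at hcon
    have := Real.cos_lt_cos_of_nonneg_of_le_pi h0.le (Complex.abs_arg_le_pi z) hcon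
    linarith

include hπ in
theorem norm_mul_cos_le_re {z : ℂ} (h : |z.arg| ≤ τ) : ‖z‖ * Real.cos τ ≤ z.re := by
  rw [← Complex.norm_mul_cos_arg z, ← Real.cos_abs z.arg]
  exact mul_le_mul_of_nonneg_left
    (Real.cos_le_cos_of_nonneg_of_le_pi (abs_nonneg _) hπ.le h) (norm_nonneg _)

include hu in
-- The antipode of the apex lies outside the hemisphere, so polar coordinates degenerate only at the
-- apex.
theorem polarDist_lt_pi {w : Sphere2} (hw : 0 ≤ inner ℝ (u : E3) (w : E3)) :
    polarDist stdFrame w < Real.pi := by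
  refine lt_of_le_of_ne (polarDist_le_pi _ _) fun h => ?_
  have h1 : inner ℝ (stdPole : E3) (w : E3) = -1 := by
    rw [← cos_sphDist]
    change Real.cos (polarDist stdFrame w) = -1
    rw [h, Real.cos_pi]
  have h2 : (stdPole : E3) = -w :=
    (inner_eq_neg_one_iff_of_norm_eq_one stdPole.norm_coe w.norm_coe).1 h1
  rw [h2, inner_neg_right] at hu
  linarith

include hu in
theorem eq_stdPole_of_horiz_eq_zero {w : Sphere2} (hw : 0 ≤ inner ℝ (u : E3) (w : E3))
    (h : horiz stdFrame w = 0) : w = stdPole := by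
  have h1 := polarDist_lt_pi hu hw
  have h2 := norm_horiz stdFrame w
  rw [h, norm_zero] at h2
  have h3 : polarDist stdFrame w = 0 := by
    by_contra hne
    have := Real.sin_pos_of_pos_of_lt_pi
      (lt_of_le_of_ne (polarDist_nonneg stdFrame w) (Ne.symm hne)) h1
    linarith
  exact (eq_of_sphDist_eq_zero h3).symm

include hu in
/-- Two points of the hemisphere in opposite directions from the pole are joined through it. -/
theorem sphDist_opposite {v w : Sphere2} (hv : 0 ≤ inner ℝ (u : E3) (v : E3))
    (hw : 0 ≤ inner ℝ (u : E3) (w : E3)) {φ s : ℝ} (hs : 0 ≤ s)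
    (hφ : horiz stdFrame v = Real.sin (polarDist stdFrame v) * Complex.exp (φ * Complex.I))
    (hψ : horiz stdFrame w = s * Complex.exp ((φ + Real.pi : ℝ) * Complex.I)) :
    sphDist v w = polarDist stdFrame v + polarDist stdFrame w := by
  have hs' : s = Real.sin (polarDist stdFrame w) := by
    rw [← norm_horiz, hψ]
    simp [abs_of_nonneg hs, Complex.norm_exp_ofReal_mul_I, -Complex.ofReal_add]
  rw [hs'] at hψ
  rw [sphDist_polar stdFrame hφ hψ, show φ - (φ + Real.pi) = -Real.pi by ring, Real.cos_neg,
    Real.cos_pi, mul_neg_one, ← sub_eq_add_neg, ← Real.cos_add]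
  have nv := polarDist_nonneg stdFrame v
  have nw := polarDist_nonneg stdFrame w
  have lv := polarDist_lt_pi hu hv
  have lw := polarDist_lt_pi hu hw
  apply Real.arccos_cos (by linarith)
  by_contra hcon
  push Not at hcon
  have neg : Real.sin (polarDist stdFrame v + polarDist stdFrame w) < 0 := by
    rw [← Real.sin_sub_two_pi]
    exact Real.sin_neg_of_neg_of_neg_pi_lt (by linarith) (by linarith)
  have sv : 0 ≤ Real.sin (polarDist stdFrame v) := Real.sin_nonneg_of_nonneg_of_le_pi nv lv.le
  have sw : 0 ≤ Real.sin (polarDist stdFrame w) := Real.sin_nonneg_of_nonneg_of_le_pi nw lw.le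
  -- In this combination the horizontal parts cancel, as the directions are opposite. The left side
  -- is nonnegative, so the two polar distances cannot add up to more than π.
  have key : Real.sin (polarDist stdFrame w) * inner ℝ (u : E3) (v : E3) +
      Real.sin (polarDist stdFrame v) * inner ℝ (u : E3) (w : E3) =
      inner ℝ (u : E3) (stdPole : E3) *
        Real.sin (polarDist stdFrame v + polarDist stdFrame w) := by
    rw [inner_eq_frame stdFrame (u : E3) v, inner_eq_frame stdFrame (u : E3) w, hφ, hψ,
      Real.sin_add, ← cos_polarDist, ← cos_polarDist, ← cos_polarDist]
    simp only [Complex.re_ofReal_mul, Complex.exp_ofReal_mul_I_re, Complex.im_ofReal_mul,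
      Complex.exp_ofReal_mul_I_im, Real.cos_add_pi, Real.sin_add_pi]
    rw [cos_polarDist stdFrame u, real_inner_comm]
    simp only [framePole]
    ring
  have := mul_nonneg sw hv
  have := mul_nonneg sv hw
  have := mul_neg_of_pos_of_neg hu neg
  linarith

theorem inner_nonneg_of_combination {x v z w : E3} {c l k : ℝ} (hc : 0 < c) (hl : 0 ≤ l)
    (hk : 0 ≤ k) (h : c • z = l • v + k • w) (hv : 0 ≤ inner ℝ x v) (hw : 0 ≤ inner ℝ x w) :
    0 ≤ inner ℝ x z := by
  have : c * inner ℝ x z = l * inner ℝ x v + k * inner ℝ x w := by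
    rw [← inner_smul_right, h, inner_add_right, inner_smul_right, inner_smul_right]
  have : 0 ≤ c * inner ℝ x z := by rw [this]; positivity
  exact nonneg_of_mul_nonneg_right this hc

include hu in
-- The arc from c to b crosses the ray opposite to a at some z. The distance from a to z is already
-- that of the path through the apex, so passing through c is no shortcut.
theorem polarDist_add_le_of_pi_le {a b c : Sphere2} (ha : 0 ≤ inner ℝ (u : E3) (a : E3))
    (hb : 0 ≤ inner ℝ (u : E3) (b : E3)) (hc : 0 ≤ inner ℝ (u : E3) (c : E3))
    (h1 : Real.pi ≤ (horiz stdFrame b).arg - (horiz stdFrame a).arg)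
    (h2 : |(horiz stdFrame a).arg - (horiz stdFrame c).arg| < Real.pi)
    (h3 : |(horiz stdFrame c).arg - (horiz stdFrame b).arg| < Real.pi) :
    polarDist stdFrame a + polarDist stdFrame b ≤ sphDist a c + sphDist c b := by
  rw [abs_lt] at h2 h3
  obtain ⟨z, ⟨k, l, m, hk, hl, hm, hz⟩, s, hs, hzs⟩ := exists_arc_crosses_ray stdFrame
    (ψ := (horiz stdFrame a).arg + Real.pi)
    (Real.sin_nonneg_of_nonneg_of_le_pi (polarDist_nonneg stdFrame c) (polarDist_le_pi _ c))
    (Real.sin_nonneg_of_nonneg_of_le_pi (polarDist_nonneg stdFrame b) (polarDist_le_pi _ b))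
    (horiz_eq_exp_arg stdFrame c) (horiz_eq_exp_arg stdFrame b) (by linarith) (by linarith)
    (by linarith)
  have huz := inner_nonneg_of_combination hk hl hm hz hc hb
  have e1 := sphDist_opposite hu ha huz hs (horiz_eq_exp_arg stdFrame a) hzs
  have e2 := sphDist_eq_add_of_combination hk hl hm hz
  have t1 := sphDist_triangle a c z
  have t2 := sphDist_triangle stdPole z b
  change polarDist stdFrame b ≤ polarDist stdFrame z + _ at t2
  linarith

include hu in
-- The only case with content is that both legs are spherical arcs while a and b are seen under an
-- angle of at least π. If a leg runs through the apex, the two radial inequalities suffice.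
theorem coneDist_triangle {a b c : Sphere2} (ha : 0 ≤ inner ℝ (u : E3) (a : E3))
    (hc : 0 ≤ inner ℝ (u : E3) (c : E3)) (hb : 0 ≤ inner ℝ (u : E3) (b : E3)) :
    coneDist a b ≤ coneDist a c + coneDist c b := by
  by_cases h1 : |(horiz stdFrame a).arg - (horiz stdFrame c).arg| < Real.pi
  · by_cases h2 : |(horiz stdFrame c).arg - (horiz stdFrame b).arg| < Real.pi
    · have e1 : coneDist a c = sphDist a c := if_pos h1
      have e2 : coneDist c b = sphDist c b := if_pos h2
      rw [e1, e2]
      by_cases h3 : |(horiz stdFrame a).arg - (horiz stdFrame b).arg| < Real.pi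
      · rw [coneDist, if_pos h3]
        exact sphDist_triangle _ _ _
      · rw [coneDist, if_neg h3]
        push Not at h3
        rcases le_abs.1 h3 with h4 | h4
        · rw [abs_sub_comm] at h1 h2
          have := polarDist_add_le_of_pi_le hu hb ha hc h4 h2 h1
          rw [sphDist_comm b c, sphDist_comm c a] at this
          linarith
        · exact polarDist_add_le_of_pi_le hu ha hb hc (by linarith) h1 h2
    · have e2 : coneDist c b = polarDist stdFrame c + polarDist stdFrame b := if_neg h2
      have := coneDist_le_add a b
      have := polarDist_le_add_coneDist a c
      linarith
  · have e1 : coneDist a c = polarDist stdFrame a + polarDist stdFrame c := if_neg h1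
    have := coneDist_le_add a b
    have := polarDist_le_add_coneDist b c
    rw [coneDist_comm b c] at this
    linarith

include h0 hπ in
/-- The directions of the points of an arc lie between those of its end points. -/
theorem arg_mem_uIcc_of_combination {v z w : Sphere2} (hv : v ∈ region u τ) (hw : w ∈ region u τ)
    (hvw : |(horiz stdFrame v).arg - (horiz stdFrame w).arg| < Real.pi) {c l k : ℝ} (hc : 0 < c)
    (hl : 0 ≤ l) (hk : 0 ≤ k) (h : c • (z : E3) = l • (v : E3) + k • (w : E3)) :
    (horiz stdFrame z).arg ∈ uIcc (horiz stdFrame v).arg (horiz stdFrame w).arg := by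
  wlog hle : (horiz stdFrame v).arg ≤ (horiz stdFrame w).arg generalizing v w l k
  · rw [uIcc_comm]
    exact this hw hv (by rwa [abs_sub_comm]) hk hl (by rw [h, add_comm]) (le_of_not_ge hle)
  rw [uIcc_of_le hle]
  have av := abs_le.1 (abs_arg_le_of_mem h0 hv.2)
  have aw := abs_le.1 (abs_arg_le_of_mem h0 hw.2)
  have hz : c * horiz stdFrame z = ((l * ‖horiz stdFrame v‖ : ℝ) : ℂ) *
      Complex.exp ((horiz stdFrame v).arg * Complex.I) + ((k * ‖horiz stdFrame w‖ : ℝ) : ℂ) *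
      Complex.exp ((horiz stdFrame w).arg * Complex.I) := by
    rw [← horiz_smul, h, horiz_add, horiz_smul, horiz_smul, Complex.ofReal_mul, Complex.ofReal_mul,
      mul_assoc, mul_assoc, Complex.norm_mul_exp_arg_mul_I, Complex.norm_mul_exp_arg_mul_I]
  have n1 : 0 ≤ l * ‖horiz stdFrame v‖ := by positivity
  have n2 : 0 ≤ k * ‖horiz stdFrame w‖ := by positivity
  by_cases hpos : 0 < l * ‖horiz stdFrame v‖ + k * ‖horiz stdFrame w‖
  · have := arg_add_mem_Icc n1 n2 hpos (φ := (horiz stdFrame v).arg)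
      (ψ := (horiz stdFrame w).arg) (by linarith) (by linarith) hle
      (by rw [abs_sub_comm] at hvw; linarith [le_abs_self ((horiz stdFrame w).arg - (horiz stdFrame v).arg)])
    rw [← hz, Complex.arg_real_mul _ hc] at this
    exact this
  · have z1 : l * ‖horiz stdFrame v‖ = 0 := by linarith
    have z2 : k * ‖horiz stdFrame w‖ = 0 := by linarith
    rw [z1, z2] at hz
    have hz0 : horiz stdFrame z = 0 := by
      simpa [hc.ne'] using hz
    rw [hz0, Complex.arg_zero]
    rcases mul_eq_zero.1 z1 with hl0 | hv0
    · rcases mul_eq_zero.1 z2 with hk0 | hw0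
      · exfalso
        rw [hl0, hk0] at h
        simp [hc.ne', z.ne_zero] at h
      · rw [norm_eq_zero.1 hw0, Complex.arg_zero] at hle ⊢
        exact ⟨hle, le_rfl⟩
    · rw [norm_eq_zero.1 hv0, Complex.arg_zero] at hle ⊢
      exact ⟨le_rfl, hle⟩

include h0 hπ in
theorem mem_region_of_combination {v z w : Sphere2} (hv : v ∈ region u τ) (hw : w ∈ region u τ)
    (hvw : |(horiz stdFrame v).arg - (horiz stdFrame w).arg| < Real.pi) {c l k : ℝ} (hc : 0 < c)
    (hl : 0 ≤ l) (hk : 0 ≤ k) (h : c • (z : E3) = l • (v : E3) + k • (w : E3)) :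
    z ∈ region u τ := by
  refine ⟨inner_nonneg_of_combination hc hl hk h hv.1 hw.1, norm_mul_cos_le_re hπ ?_⟩
  have hz := arg_mem_uIcc_of_combination h0 hπ hv hw hvw hc hl hk h
  have av := abs_le.1 (abs_arg_le_of_mem h0 hv.2)
  have aw := abs_le.1 (abs_arg_le_of_mem h0 hw.2)
  rw [abs_le]
  rcases mem_uIcc.1 hz with hz | hz <;> constructor <;> linarith [hz.1, hz.2]

include hu in
-- Antipodal points would have polar distances strictly between 0 and π. By the cosine law -1 would
-- then exceed cos (ρ + σ), as the directions differ by less than π.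
theorem sphDist_lt_pi_of_mem {v w : Sphere2} (hv : v ∈ region u τ) (hw : w ∈ region u τ)
    (hvw : |(horiz stdFrame v).arg - (horiz stdFrame w).arg| < Real.pi) :
    sphDist v w < Real.pi := by
  refine lt_of_le_of_ne (sphDist_le_pi _ _) fun h => ?_
  have lv := polarDist_lt_pi hu hv.1
  have lw := polarDist_lt_pi hu hw.1
  have nv := polarDist_nonneg stdFrame v
  have nw := polarDist_nonneg stdFrame w
  have t1 := sphDist_triangle v stdPole w
  rw [sphDist_comm v stdPole] at t1
  change _ ≤ polarDist stdFrame v + polarDist stdFrame w at t1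
  have pv : 0 < Real.sin (polarDist stdFrame v) :=
    Real.sin_pos_of_pos_of_lt_pi (by linarith) lv
  have pw : 0 < Real.sin (polarDist stdFrame w) :=
    Real.sin_pos_of_pos_of_lt_pi (by linarith) lw
  rw [sphDist_arg stdFrame, Real.arccos_eq_pi] at h
  have c1 : -1 < Real.cos ((horiz stdFrame v).arg - (horiz stdFrame w).arg) := by
    rw [← Real.cos_abs, ← Real.cos_pi]
    exact Real.cos_lt_cos_of_nonneg_of_le_pi (abs_nonneg _) le_rfl hvw
  have c2 := Real.neg_one_le_cos (polarDist stdFrame v + polarDist stdFrame w)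
  rw [Real.cos_add] at c2
  have := mul_pos (mul_pos pv pw)
    (by linarith : 0 < 1 + Real.cos ((horiz stdFrame v).arg - (horiz stdFrame w).arg))
  nlinarith

/-- The intrinsic distance on a triangular region. -/
def regionDist (v w : region u τ) : ℝ := coneDist v w

include hu h0 hπ in
-- The geodesic is the great-circle arc. It stays in the region and its directions stay between
-- those of v and w, so `coneDist` equals the spherical distance all along it.
theorem hasGeodesic_of_abs_sub_lt {v w : region u τ}
    (hvw : |(horiz stdFrame (v : Sphere2)).arg - (horiz stdFrame (w : Sphere2)).arg| < Real.pi) :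
    HasGeodesic regionDist v w := by
  have hL : regionDist v w = sphDist v w := if_pos hvw
  have hLπ := sphDist_lt_pi_of_mem hu v.2 w.2 hvw
  set L := sphDist (v : Sphere2) w with hLdef
  rcases (sphDist_nonneg (v : Sphere2) w).eq_or_lt with hz | hpos
  · have : v = w := Subtype.ext (eq_of_sphDist_eq_zero hz.symm)
    subst this
    refine ⟨fun _ => v, rfl, rfl, ?_⟩
    rw [hL, hLdef, sphDist_self]
    intro s hs t ht
    rw [Icc_self, mem_singleton_iff] at hs ht
    rw [hs, ht, sub_self, abs_zero]
    exact coneDist_self _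
  have hsin : 0 < Real.sin L := Real.sin_pos_of_pos_of_lt_pi hpos hLπ
  have hcos : Real.cos L = inner ℝ (v : E3) (w : E3) := cos_sphDist _ _
  -- n is the unit tangent vector at v pointing towards w, and the arc is cos s · v + sin s · n.
  set n : E3 := (Real.sin L)⁻¹ • ((w : E3) - Real.cos L • (v : E3)) with hn
  have nv : inner ℝ (v : E3) n = 0 := by
    rw [hn, inner_smul_right, inner_sub_right, inner_smul_right, Sphere2.inner_self, ← hcos]
    ring
  have nn : inner ℝ n n = 1 := by
    rw [hn, inner_smul_left, inner_smul_right, inner_sub_left, inner_sub_right, inner_sub_right,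
      inner_smul_left, inner_smul_right, inner_smul_right, inner_smul_left, Sphere2.inner_self,
      Sphere2.inner_self, real_inner_comm (v : E3) (w : E3), ← hcos]
    simp only [conj_trivial]
    field_simp
    nlinarith [Real.sin_sq_add_cos_sq L]
  have inn : ∀ s t : ℝ, inner ℝ (Real.cos s • (v : E3) + Real.sin s • n)
      (Real.cos t • (v : E3) + Real.sin t • n) = Real.cos (s - t) := by
    intro s t
    simp only [inner_add_left, inner_add_right, inner_smul_left, inner_smul_right, nv, nn,
      Sphere2.inner_self, real_inner_comm (v : E3) n, conj_trivial, Real.cos_sub]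
    ring
  let γ : ℝ → Sphere2 := fun s => ⟨Real.cos s • (v : E3) + Real.sin s • n, by
    rw [mem_sphere_zero_iff_norm, ← sq_eq_sq₀ (norm_nonneg _) zero_le_one,
      ← real_inner_self_eq_norm_sq, inn, sub_self, Real.cos_zero, one_pow]⟩
  have comb : ∀ s, Real.sin L • (γ s : E3) = Real.sin (L - s) • (v : E3) + Real.sin s • (w : E3) := by
    intro s
    simp only [γ, hn, Real.sin_sub]
    rw [smul_add, smul_smul, smul_smul, smul_smul, mul_right_comm, mul_inv_cancel₀ hsin.ne',
      one_mul, smul_sub, smul_smul, sub_smul]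
    module
  have sL : ∀ s ∈ Icc 0 L, 0 ≤ Real.sin (L - s) ∧ 0 ≤ Real.sin s := fun s hs =>
    ⟨Real.sin_nonneg_of_nonneg_of_le_pi (by linarith [hs.2]) (by linarith [hs.1]),
      Real.sin_nonneg_of_nonneg_of_le_pi hs.1 (by linarith [hs.2])⟩
  have mem : ∀ s ∈ Icc 0 L, γ s ∈ region u τ := fun s hs =>
    mem_region_of_combination h0 hπ v.2 w.2 hvw hsin (sL s hs).1 (sL s hs).2 (comb s)
  have argm : ∀ s ∈ Icc 0 L, (horiz stdFrame (γ s)).arg ∈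
      uIcc (horiz stdFrame (v : Sphere2)).arg (horiz stdFrame (w : Sphere2)).arg := fun s hs =>
    arg_mem_uIcc_of_combination h0 hπ v.2 w.2 hvw hsin (sL s hs).1 (sL s hs).2 (comb s)
  have dist : ∀ s ∈ Icc 0 L, ∀ t ∈ Icc 0 L, coneDist (γ s) (γ t) = |s - t| := by
    intro s hs t ht
    have : |(horiz stdFrame (γ s)).arg - (horiz stdFrame (γ t)).arg| < Real.pi := by
      refine lt_of_le_of_lt ?_ hvw
      have := abs_sub_le_of_uIcc_subset_uIcc
        (uIcc_subset_uIcc (argm s hs) (argm t ht))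
      rw [abs_sub_comm (horiz stdFrame (γ s)).arg,
        abs_sub_comm (horiz stdFrame (v : Sphere2)).arg]
      exact this
    rw [coneDist, if_pos this, sphDist_eq_arccos]
    simp only [γ, inn]
    rw [← Real.cos_abs, Real.arccos_cos (abs_nonneg _)]
    rw [abs_le]
    constructor <;> linarith [hs.1, hs.2, ht.1, ht.2]
  have γ0 : γ 0 = v := by
    apply Subtype.ext
    simp [γ]
  have γL : γ L = w := by
    apply Subtype.ext
    have := comb L
    rw [sub_self, Real.sin_zero, zero_smul, zero_add] at this
    exact smul_right_injective _ hsin.ne' this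
  classical
  refine ⟨fun s => if hs : s ∈ Icc 0 L then ⟨γ s, mem s hs⟩ else v, ?_, ?_, ?_⟩
  · exact (dif_pos (left_mem_Icc.2 hpos.le)).trans (Subtype.ext γ0)
  · rw [hL]
    exact (dif_pos (right_mem_Icc.2 hpos.le)).trans (Subtype.ext γL)
  · rw [hL]
    intro s hs t ht
    simp only [dif_pos hs, dif_pos ht]
    exact dist s hs t ht

include hu in
theorem stdPole_mem_region : stdPole ∈ region u τ :=
  ⟨hu.le, by rw [horiz_stdPole]; simp⟩

include h0 hπ in
theorem coneDist_stdPole {w : Sphere2} (hw : w ∈ region u τ) :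
    coneDist stdPole w = polarDist stdFrame w := by
  rw [coneDist, if_pos]
  · rfl
  · rw [horiz_stdPole, Complex.arg_zero, zero_sub, abs_neg]
    exact lt_of_le_of_lt (abs_arg_le_of_mem h0 hw.2) hπ

include hu h0 hπ in
theorem hasGeodesic_regionDist (v w : region u τ) : HasGeodesic regionDist v w := by
  by_cases hvw : |(horiz stdFrame (v : Sphere2)).arg - (horiz stdFrame (w : Sphere2)).arg| < Real.pi
  · exact hasGeodesic_of_abs_sub_lt hu h0 hπ hvw
  · have arg0 : ∀ w : region u τ, |(horiz stdFrame (w : Sphere2)).arg| < Real.pi := fun w =>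
      lt_of_le_of_lt (abs_arg_le_of_mem h0 w.2.2) hπ
    refine HasGeodesic.concat (d := regionDist) (z := (⟨stdPole, stdPole_mem_region hu⟩ : region u τ))
      (fun a => coneDist_self _) (fun a b => coneDist_comm _ _)
      (fun a b c => coneDist_triangle hu a.2.1 b.2.1 c.2.1) ?_
      (hasGeodesic_of_abs_sub_lt hu h0 hπ ?_) (hasGeodesic_of_abs_sub_lt hu h0 hπ ?_)
    · have e : regionDist v w = polarDist stdFrame v + polarDist stdFrame w := if_neg hvw
      rw [e]
      simp only [regionDist]
      rw [coneDist_comm, coneDist_stdPole h0 hπ v.2, coneDist_stdPole h0 hπ w.2]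
    · simpa [horiz_stdPole] using arg0 v
    · simpa [horiz_stdPole] using arg0 w

include hu h0 hπ in
/-- Away from the pole, the intrinsic distance is locally the spherical one. -/
theorem exists_coneDist_eq_sphDist {p : Sphere2} (hp : p ∈ region u τ) (hne : p ≠ stdPole) :
    ∃ r > 0, ∀ v w, sphDist p v < r → sphDist p w < r → coneDist v w = sphDist v w := by
  -- As τ < π, the sector avoids the branch cut of the argument, so directions vary continuously
  -- away from the apex. Two directions within π/2 of that of p differ by less than π.
  have hslit : horiz stdFrame p ∈ Complex.slitPlane := by
    rw [Complex.mem_slitPlane_iff_arg]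
    refine ⟨fun h => ?_, fun h => hne (eq_stdPole_of_horiz_eq_zero hu hp.1 h)⟩
    have := abs_arg_le_of_mem h0 hp.2
    rw [h, abs_of_pos Real.pi_pos] at this
    linarith
  have hc : ContinuousAt (fun w : Sphere2 => (horiz stdFrame w).arg) p :=
    (Complex.continuousAt_arg hslit).comp (f := fun w : Sphere2 => horiz stdFrame w)
      (by fun_prop : Continuous fun w : Sphere2 => horiz stdFrame w).continuousAt
  have hU := (Metric.tendsto_nhds.1 hc) (Real.pi / 2) (by positivity)
  obtain ⟨r, hr, h⟩ := exists_sphDist_ball_subset hU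
  refine ⟨r, hr, fun v w hv hw => ?_⟩
  have h1 := h v hv
  have h2 := h w hw
  rw [coneDist, if_pos]
  have h3 : dist _ _ < Real.pi / 2 := h1
  have h4 : dist _ _ < Real.pi / 2 := h2
  rw [Real.dist_eq, abs_lt] at h3 h4
  rw [abs_lt]
  constructor <;> linarith

end Region

/-! ### Frames -/

theorem finrank_E3 : Module.finrank ℝ E3 = Fintype.card (Fin 3) := by simp

theorem exists_frame_one (p : Sphere2) : ∃ b : OrthonormalBasis (Fin 3) ℝ E3, b 0 = p := by
  obtain ⟨b, hb⟩ := Orthonormal.exists_orthonormalBasis_extension_of_card_eq finrank_E3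
    (v := fun _ => (p : E3)) (s := {0}) (by
      rw [orthonormal_iff_ite]
      rintro ⟨i, rfl⟩ ⟨j, rfl⟩
      simp)
  exact ⟨b, hb 0 rfl⟩

theorem exists_frame_two {p e : E3} (hp : ‖p‖ = 1) (he : ‖e‖ = 1) (h : inner ℝ p e = 0) :
    ∃ b : OrthonormalBasis (Fin 3) ℝ E3, b 0 = p ∧ b 2 = e := by
  obtain ⟨b, hb⟩ := Orthonormal.exists_orthonormalBasis_extension_of_card_eq finrank_E3
    (v := ![p, p, e]) (s := {0, 2}) (by
      rw [orthonormal_iff_ite]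
      rintro ⟨i, rfl | rfl⟩ ⟨j, rfl | rfl⟩
      · simp [hp]
      · simp [h, Subtype.ext_iff]
      · simp [real_inner_comm, h, Subtype.ext_iff]
      · simp [he])
  exact ⟨b, hb 0 (by simp), hb 2 (by simp)⟩

theorem exists_frame_three {p e₁ e₂ : E3} (hp : ‖p‖ = 1) (he₁ : ‖e₁‖ = 1) (he₂ : ‖e₂‖ = 1)
    (h1 : inner ℝ p e₁ = 0) (h2 : inner ℝ p e₂ = 0) (h3 : inner ℝ e₁ e₂ = 0) :
    ∃ b : OrthonormalBasis (Fin 3) ℝ E3, b 0 = p ∧ b 1 = e₁ ∧ b 2 = e₂ := by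
  obtain ⟨b, hb⟩ := Orthonormal.exists_orthonormalBasis_extension_of_card_eq finrank_E3
    (v := ![p, e₁, e₂]) (s := univ) (by
      rw [orthonormal_iff_ite]
      have h1' := (real_inner_comm p e₁).trans h1
      have h2' := (real_inner_comm p e₂).trans h2
      have h3' := (real_inner_comm e₁ e₂).trans h3
      rintro ⟨i, -⟩ ⟨j, -⟩
      fin_cases i <;> fin_cases j <;> simp_all [Subtype.ext_iff])
  exact ⟨b, hb 0 trivial, hb 1 trivial, hb 2 trivial⟩

/-! ### Local charts of a region -/

/-- A wedge of angle at most π is the intersection of the half-planes of its two sides, expressed in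
polar angle. -/
theorem sin_nonneg_and_iff {α ψ : ℝ} (hα : α ∈ Ioc 0 Real.pi) (hψ : ψ ∈ Ioc (-Real.pi) Real.pi) :
    (0 ≤ Real.sin ψ ∧ 0 ≤ Real.sin (α - ψ)) ↔ ψ ∈ Icc 0 α := by
  constructor
  · rintro ⟨h1, h2⟩
    have h0 : 0 ≤ ψ := by
      by_contra hneg
      push Not at hneg
      have := Real.sin_neg_of_neg_of_neg_pi_lt hneg hψ.1
      linarith
    refine ⟨h0, ?_⟩
    by_contra hgt
    push Not at hgt
    have := Real.sin_neg_of_neg_of_neg_pi_lt (x := α - ψ) (by linarith) (by linarith [hα.1, hψ.2])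
    linarith
  · intro h
    exact ⟨Real.sin_nonneg_of_nonneg_of_le_pi h.1 hψ.2,
      Real.sin_nonneg_of_nonneg_of_le_pi (by linarith [h.2]) (by linarith [h.1, hα.2])⟩

theorem sin_eq_zero_or_iff {α ψ : ℝ} (hα : α ∈ Ioc 0 Real.pi) (hψ : ψ ∈ Icc 0 α) :
    (Real.sin ψ = 0 ∨ Real.sin (α - ψ) = 0) ↔ ψ = 0 ∨ ψ = α := by
  constructor
  · intro h
    by_contra hne
    push Not at hne
    have l1 : 0 < ψ := lt_of_le_of_ne hψ.1 (Ne.symm hne.1)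
    have l2 : ψ < α := lt_of_le_of_ne hψ.2 hne.2
    have p1 := Real.sin_pos_of_pos_of_lt_pi l1 (by linarith [hα.2])
    have p2 := Real.sin_pos_of_pos_of_lt_pi (x := α - ψ) (by linarith) (by linarith [hα.2])
    rcases h with h | h <;> linarith
  · rintro (h | h) <;> simp [h]

/-- The boundary of a triangular region. -/
def IsRegionBoundary (u : Sphere2) (τ : ℝ) (w : Sphere2) : Prop :=
  inner ℝ (u : E3) (w : E3) = 0 ∨ (horiz stdFrame w).re = ‖horiz stdFrame w‖ * Real.cos τ

/-- The inward normal of the side of the sector of angle `2 τ` in the direction `σ τ`, `σ = ±1`. -/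
def edgeNormal (τ σ : ℝ) : E3 := !₂[0, Real.sin τ, -(σ * Real.cos τ)]

theorem inner_edgeNormal (τ σ : ℝ) (w : E3) : inner ℝ (edgeNormal τ σ) w =
    Real.sin τ * (horiz stdFrame w).re - σ * Real.cos τ * (horiz stdFrame w).im := by
  simp [edgeNormal, horiz, PiLp.inner_apply, Fin.sum_univ_three]
  ring

theorem norm_edgeNormal (τ : ℝ) {σ : ℝ} (hσ : σ ^ 2 = 1) : ‖edgeNormal τ σ‖ = 1 := by
  rw [EuclideanSpace.norm_eq, Real.sqrt_eq_one]
  simp [edgeNormal, Fin.sum_univ_three, mul_pow, hσ]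

/-- On one side of the axis the sector is cut out by a single linear inequality, even for τ > π/2.
After multiplying the imaginary part by σ the argument lies in (0, π), and the linear form equals
‖z‖ sin (τ - arg). -/
theorem sector_halfplane {z : ℂ} {τ σ : ℝ} (h0 : 0 < τ) (hπ : τ < Real.pi) (hσ : σ ^ 2 = 1)
    (hz : 0 < σ * z.im) :
    (‖z‖ * Real.cos τ ≤ z.re ↔ 0 ≤ Real.sin τ * z.re - σ * Real.cos τ * z.im) ∧
    (z.re = ‖z‖ * Real.cos τ ↔ Real.sin τ * z.re - σ * Real.cos τ * z.im = 0) := by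
  set w : ℂ := ⟨z.re, σ * z.im⟩ with hw
  have hn : ‖w‖ = ‖z‖ := by
    rw [← sq_eq_sq₀ (norm_nonneg _) (norm_nonneg _), ← Complex.normSq_eq_norm_sq,
      ← Complex.normSq_eq_norm_sq, Complex.normSq_apply, Complex.normSq_apply]
    linear_combination z.im ^ 2 * hσ
  have hre : ‖z‖ * Real.cos w.arg = z.re := by rw [← hn, Complex.norm_mul_cos_arg]
  have him : ‖z‖ * Real.sin w.arg = σ * z.im := by rw [← hn, Complex.norm_mul_sin_arg]
  have hz0 : 0 < ‖z‖ := by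
    rw [norm_pos_iff]
    rintro rfl
    simp at hz
  have hs : 0 < Real.sin w.arg := by
    rw [← him] at hz
    exact pos_of_mul_pos_right hz hz0.le
  have a0 : 0 < w.arg := by
    by_contra hcon
    push Not at hcon
    have := Real.sin_nonpos_of_nonpos_of_neg_pi_le hcon (Complex.neg_pi_lt_arg w).le
    linarith
  have a1 : w.arg < Real.pi := by
    refine lt_of_le_of_ne (Complex.arg_le_pi w) fun h => ?_
    rw [h, Real.sin_pi] at hs
    exact lt_irrefl _ hs
  have key : Real.sin τ * z.re - σ * Real.cos τ * z.im = ‖z‖ * Real.sin (τ - w.arg) := by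
    rw [Real.sin_sub]
    linear_combination (-Real.sin τ) * hre + Real.cos τ * him
  have m1 : ∀ {x y : ℝ}, x ∈ Icc 0 Real.pi → y ∈ Icc 0 Real.pi →
      (Real.cos x ≤ Real.cos y ↔ y ≤ x) := fun hx hy =>
    Real.strictAntiOn_cos.le_iff_ge hx hy
  have hτ : τ ∈ Icc 0 Real.pi := ⟨h0.le, hπ.le⟩
  have hww : w.arg ∈ Icc 0 Real.pi := ⟨a0.le, a1.le⟩
  rw [key, ← hre]
  constructor
  · rw [mul_le_mul_iff_right₀ hz0, m1 hτ hww]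
    constructor
    · intro h
      exact mul_nonneg hz0.le (Real.sin_nonneg_of_nonneg_of_le_pi (by linarith) (by linarith))
    · intro h
      by_contra hcon
      push Not at hcon
      have := Real.sin_neg_of_neg_of_neg_pi_lt (x := τ - w.arg) (by linarith) (by linarith)
      have := mul_neg_of_pos_of_neg hz0 this
      linarith
  · rw [mul_right_inj' hz0.ne']
    constructor
    · intro h
      have := Real.injOn_cos hww hτ h
      rw [this, sub_self, Real.sin_zero, mul_zero]
    · intro h
      have h1 := (mul_eq_zero.1 h).resolve_left hz0.ne'
      rw [Real.sin_eq_zero_iff_of_lt_of_lt (by linarith) (by linarith)] at h1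
      rw [show w.arg = τ by linarith]

/-- A parametrization of a triangular region by the disc, with vertices `x`. -/
structure IsRegionChart (f : Disc → Sphere2) (x : Fin 3 → Disc) (u : Sphere2) (τ : ℝ) : Prop where
  cont : Continuous f
  inj : Function.Injective f
  range_eq : range f = region u τ
  boundary : ∀ a, a ∈ discBoundary ↔ IsRegionBoundary u τ (f a)
  apex : f (x 0) = stdPole
  corner : ∀ a, (inner ℝ (u : E3) (f a : E3) = 0 ∧
    (horiz stdFrame (f a)).re = ‖horiz stdFrame (f a)‖ * Real.cos τ) ↔ a = x 1 ∨ a = x 2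
  im_neg : (horiz stdFrame (f (x 1))).im < 0
  im_pos : 0 < (horiz stdFrame (f (x 2))).im

namespace IsRegionChart

variable {f : Disc → Sphere2} {x : Fin 3 → Disc} {u : Sphere2} {τ : ℝ} (hf : IsRegionChart f x u τ)
  (hu : 0 < inner ℝ (u : E3) (stdPole : E3)) (h0 : 0 < τ) (hπ : τ < Real.pi)

include hf

theorem mem_region (a : Disc) : f a ∈ region u τ := hf.range_eq ▸ mem_range_self a

theorem exists_eq {w : Sphere2} (hw : w ∈ region u τ) : ∃ a, f a = w := by
  rwa [← hf.range_eq] at hw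

theorem eq_apex {a : Disc} (h : f a = stdPole) : a = x 0 := hf.inj (h.trans hf.apex.symm)

/-- The angular coordinate of a frame is a sector chart where the region is a wedge. -/
theorem isSectorChart_of_wedge {a₀ : Disc} {b : OrthonormalBasis (Fin 3) ℝ E3} {α r : ℝ} {n : E3}
    (hb : b 0 = f a₀) (hα : α ∈ Ioc 0 Real.pi)
    (hn : n = Real.sin α • b 1 - Real.cos α • b 2) (hr : 0 < r)
    (hcone : ∀ v w, sphDist (f a₀) v < r → sphDist (f a₀) w < r → coneDist v w = sphDist v w)
    (hreg : ∀ w, sphDist (f a₀) w < r → (w ∈ region u τ ↔ 0 ≤ inner ℝ (b 2) (w : E3) ∧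
      0 ≤ inner ℝ n (w : E3)))
    (hbd : ∀ w, sphDist (f a₀) w < r → (IsRegionBoundary u τ w ↔ inner ℝ (b 2) (w : E3) = 0 ∨
      inner ℝ n (w : E3) = 0)) :
    IsSectorChart discBoundary (fun a b => coneDist (f a) (f b)) a₀ α (min r (Real.pi / 2))
      (fun a => (horiz b (f a)).arg) := by
  have hπ0 := Real.pi_pos
  have hpole : framePole b = f a₀ := Subtype.ext hb
  have hself : sphDist (f a₀) (f a₀) < r := by rw [sphDist_self]; exact hr
  have near : ∀ w, coneDist (f a₀) w < min r (Real.pi / 2) → sphDist (f a₀) w < r := fun w hw =>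
    lt_of_le_of_lt (sphDist_le_coneDist _ _) (hw.trans_le (min_le_left _ _))
  have hρ : ∀ w, sphDist (f a₀) w < r → coneDist (f a₀) w = polarDist b w := fun w hw => by
    rw [hcone _ _ hself hw, polarDist, hpole]
  have i2 : ∀ w : Sphere2, inner ℝ (b 2) (w : E3) =
      Real.sin (polarDist b w) * Real.sin (horiz b w).arg := fun w => horiz_im b w
  -- n is the inward normal of the side at angle α, as b 2 is that of the side at angle 0.
  have i1 : ∀ w : Sphere2, inner ℝ n (w : E3) =
      Real.sin (polarDist b w) * Real.sin (α - (horiz b w).arg) := fun w => by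
    have h1 : inner ℝ (b 1) (w : E3) = _ := horiz_re b w
    rw [hn, inner_sub_left, inner_smul_left, inner_smul_left, i2, h1, Real.sin_sub]
    simp only [conj_trivial]
    ring
  have hψ : ∀ w : Sphere2, (horiz b w).arg ∈ Ioc (-Real.pi) Real.pi := fun w =>
    Complex.arg_mem_Ioc _
  have spos : ∀ w : Sphere2, polarDist b w ≠ 0 → polarDist b w < Real.pi / 2 →
      0 < Real.sin (polarDist b w) := fun w h1 h2 =>
    Real.sin_pos_of_pos_of_lt_pi (lt_of_le_of_ne (polarDist_nonneg _ _) (Ne.symm h1)) (by linarith)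
  have memIcc : ∀ a, coneDist (f a₀) (f a) < min r (Real.pi / 2) →
      (horiz b (f a)).arg ∈ Icc 0 α := by
    intro a ha
    have hs := near _ ha
    rw [hρ _ hs] at ha
    have hw := (hreg _ hs).1 (hf.mem_region a)
    rw [i1, i2] at hw
    -- At the centre the angular coordinate is the default value `Complex.arg 0 = 0`, which lies in
    -- the required interval.
    by_cases hz : polarDist b (f a) = 0
    · have h1 := norm_horiz b (f a)
      rw [hz, Real.sin_zero, norm_eq_zero] at h1
      rw [h1, Complex.arg_zero]
      exact ⟨le_rfl, hα.1.le⟩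
    · have sp := spos _ hz (ha.trans_le (min_le_right _ _))
      rw [← sin_nonneg_and_iff hα (hψ _)]
      exact ⟨nonneg_of_mul_nonneg_right hw.1 sp, nonneg_of_mul_nonneg_right hw.2 sp⟩
  refine ⟨by positivity, min_le_right _ _, memIcc, ?_, ?_, ?_⟩
  · intro a c ha hc
    have hs := near _ ha
    have ht := near _ hc
    have ma := memIcc a ha
    have mc := memIcc c hc
    rw [hρ _ hs] at ha ⊢
    rw [hρ _ ht] at hc ⊢
    have ha2 := ha.trans_le (min_le_right _ _)
    have hc2 := hc.trans_le (min_le_right _ _)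
    rw [hcone _ _ hs ht, sphDist_arg b, sphConeDist_of_le_pi (polarDist_nonneg _ _)
      (polarDist_nonneg _ _) (by linarith), Real.cos_abs]
    rw [abs_le]
    constructor <;> linarith [ma.1, ma.2, mc.1, mc.2, hα.2]
  · intro ρ hρ' ψ hψ'
    have hρ2 : ρ < Real.pi / 2 := hρ'.2.trans_le (min_le_right _ _)
    have hρI : ρ ∈ Ioo 0 Real.pi := ⟨hρ'.1, by linarith⟩
    have e1 := polarDist_polarPoint b ψ ⟨hρI.1.le, hρI.2.le⟩
    have e2 := arg_horiz_polarPoint b hρI (φ := ψ) ⟨by linarith [hψ'.1], by linarith [hψ'.2, hα.2]⟩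
    have hs : sphDist (f a₀) (polarPoint b ρ ψ) < r := by
      rw [← hpole]
      change polarDist b _ < r
      rw [e1]
      exact hρ'.2.trans_le (min_le_left _ _)
    have hmem : polarPoint b ρ ψ ∈ region u τ := by
      rw [hreg _ hs, i1, i2, e1, e2]
      have sp := (Real.sin_pos_of_pos_of_lt_pi hρI.1 hρI.2).le
      have := (sin_nonneg_and_iff hα
        (ψ := ψ) ⟨by linarith [hψ'.1], by linarith [hψ'.2, hα.2]⟩).2 hψ'
      exact ⟨mul_nonneg sp this.1, mul_nonneg sp this.2⟩
    obtain ⟨a, ha⟩ := hf.exists_eq hmem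
    refine ⟨a, ?_, ?_⟩
    · simp only [ha]
      rw [hρ _ hs, e1]
    · simp only [ha, e2]
  · intro a hne ha
    have hs := near _ ha
    have ma := memIcc a ha
    rw [hρ _ hs] at ha
    rw [hf.boundary, hbd _ hs, i1, i2, ← sin_eq_zero_or_iff hα ma]
    have hz : polarDist b (f a) ≠ 0 := fun hz => by
      apply hne
      apply hf.inj
      rw [← hpole]
      exact (eq_of_sphDist_eq_zero hz).symm
    have sp := spos _ hz (ha.trans_le (min_le_right _ _))
    simp [sp.ne']

end IsRegionChart

/-- Near `p`, the region is the half-sphere with inward normal `N`. -/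
structure IsEdgeAt (u : Sphere2) (τ : ℝ) (p : Sphere2) (N : E3) : Prop where
  norm_eq : ‖N‖ = 1
  inner_eq : inner ℝ N (p : E3) = 0
  eventually : ∀ᶠ w in 𝓝 p, (w ∈ region u τ ↔ 0 ≤ inner ℝ N (w : E3)) ∧
    (IsRegionBoundary u τ w ↔ inner ℝ N (w : E3) = 0)

section

variable {u p : Sphere2} {τ σ : ℝ}

theorem continuous_sphere_inner (N : E3) : Continuous fun w : Sphere2 => inner ℝ N (w : E3) := by
  fun_prop

theorem continuous_sphere_horiz : Continuous fun w : Sphere2 => horiz stdFrame (w : E3) := by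
  fun_prop

theorem eventually_inner_pos {N : E3} (h : 0 < inner ℝ N (p : E3)) :
    ∀ᶠ w : Sphere2 in 𝓝 p, 0 < inner ℝ N (w : E3) :=
  (continuous_sphere_inner N).continuousAt.eventually (lt_mem_nhds h)

theorem eventually_sector_lt
    (h : ‖horiz stdFrame (p : E3)‖ * Real.cos τ < (horiz stdFrame (p : E3)).re) :
    ∀ᶠ w : Sphere2 in 𝓝 p,
      ‖horiz stdFrame (w : E3)‖ * Real.cos τ < (horiz stdFrame (w : E3)).re := by
  have h1 : Continuous fun w : Sphere2 => ‖horiz stdFrame (w : E3)‖ * Real.cos τ :=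
    (continuous_sphere_horiz.norm).mul continuous_const
  have h2 : Continuous fun w : Sphere2 => (horiz stdFrame (w : E3)).re :=
    Complex.continuous_re.comp continuous_sphere_horiz
  exact h1.continuousAt.eventually_lt h2.continuousAt h

theorem eventually_im_pos (h : 0 < σ * (horiz stdFrame (p : E3)).im) :
    ∀ᶠ w : Sphere2 in 𝓝 p, 0 < σ * (horiz stdFrame (w : E3)).im := by
  have h2 : Continuous fun w : Sphere2 => σ * (horiz stdFrame (w : E3)).im :=
    continuous_const.mul (Complex.continuous_im.comp continuous_sphere_horiz)
  exact h2.continuousAt.eventually (lt_mem_nhds h)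

theorem isEdgeAt_base (h : inner ℝ (u : E3) (p : E3) = 0)
    (h1 : ‖horiz stdFrame (p : E3)‖ * Real.cos τ < (horiz stdFrame (p : E3)).re) :
    IsEdgeAt u τ p u where
  norm_eq := u.norm_coe
  inner_eq := h
  eventually := by
    filter_upwards [eventually_sector_lt h1] with w hw
    exact ⟨⟨fun h => h.1, fun h => ⟨h, hw.le⟩⟩,
      ⟨fun h => h.resolve_right hw.ne', fun h => Or.inl h⟩⟩

theorem isEdgeAt_side (h0 : 0 < τ) (hπ : τ < Real.pi) (hσ : σ ^ 2 = 1)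
    (h : 0 < inner ℝ (u : E3) (p : E3))
    (h1 : (horiz stdFrame (p : E3)).re = ‖horiz stdFrame (p : E3)‖ * Real.cos τ)
    (h2 : 0 < σ * (horiz stdFrame (p : E3)).im) :
    IsEdgeAt u τ p (edgeNormal τ σ) where
  norm_eq := norm_edgeNormal τ hσ
  inner_eq := by
    rw [inner_edgeNormal]
    exact (sector_halfplane h0 hπ hσ h2).2.1 h1
  eventually := by
    filter_upwards [eventually_inner_pos h, eventually_im_pos h2] with w hw1 hw2
    have := sector_halfplane h0 hπ hσ hw2
    rw [inner_edgeNormal, ← this.1, ← this.2]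
    exact ⟨⟨fun h => h.2, fun h => ⟨hw1.le, h⟩⟩,
      ⟨fun h => h.resolve_left hw1.ne', fun h => Or.inr h⟩⟩

theorem eventually_corner (h0 : 0 < τ) (hπ : τ < Real.pi) (hσ : σ ^ 2 = 1)
    (h2 : 0 < σ * (horiz stdFrame (p : E3)).im) :
    ∀ᶠ w in 𝓝 p, (w ∈ region u τ ↔ 0 ≤ inner ℝ (u : E3) (w : E3) ∧
        0 ≤ inner ℝ (edgeNormal τ σ) (w : E3)) ∧
      (IsRegionBoundary u τ w ↔ inner ℝ (u : E3) (w : E3) = 0 ∨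
        inner ℝ (edgeNormal τ σ) (w : E3) = 0) := by
  filter_upwards [eventually_im_pos h2] with w hw2
  have := sector_halfplane h0 hπ hσ hw2
  rw [inner_edgeNormal, ← this.1, ← this.2]
  exact ⟨Iff.rfl, Iff.rfl⟩

theorem cos_norm_coe (x : ℝ) : Real.cos ‖(x : AddCircle (2 * Real.pi))‖ = Real.cos x := by
  rw [AddCircle.norm_eq, Real.cos_abs, Real.cos_sub_int_mul_two_pi]

end

/-! ### Sides, corners, apex and interior of a region -/

namespace IsRegionChart

variable {f : Disc → Sphere2} {x : Fin 3 → Disc} {u : Sphere2} {τ : ℝ} (hf : IsRegionChart f x u τ)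
  (hu : 0 < inner ℝ (u : E3) (stdPole : E3)) (h0 : 0 < τ) (hπ : τ < Real.pi)

include hf

include hu h0 hπ in
/-- A point on a side of the region has a half-disc chart. -/
theorem exists_edge_chart {a₀ : Disc} {N : E3} (hne : f a₀ ≠ stdPole)
    (hN : IsEdgeAt u τ (f a₀) N) :
    ∃ (b : OrthonormalBasis (Fin 3) ℝ E3) (r : ℝ), b 0 = f a₀ ∧ b 2 = N ∧
      IsSectorChart discBoundary (fun a b => coneDist (f a) (f b)) a₀ Real.pi r
        (fun a => (horiz b (f a)).arg) := by
  obtain ⟨b, hb0, hb2⟩ := exists_frame_two (f a₀).norm_coe hN.norm_eq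
    ((real_inner_comm _ _).trans hN.inner_eq)
  obtain ⟨r1, hr1, H1⟩ := exists_sphDist_ball_subset hN.eventually
  obtain ⟨r2, hr2, H2⟩ := exists_coneDist_eq_sphDist hu h0 hπ (hf.mem_region a₀) hne
  refine ⟨b, _, hb0, hb2, hf.isSectorChart_of_wedge (n := N) (r := min r1 r2) hb0
    ⟨Real.pi_pos, le_rfl⟩ (by simp [hb2]) (by positivity) ?_ ?_ ?_⟩
  · intro v w hv hw
    exact H2 v w (hv.trans_le (min_le_right _ _)) (hw.trans_le (min_le_right _ _))
  · intro w hw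
    rw [(H1 w (hw.trans_le (min_le_left _ _))).1, hb2, and_self]
  · intro w hw
    rw [(H1 w (hw.trans_le (min_le_left _ _))).2, hb2, or_self]

include hu h0 hπ in
-- Near a base corner the region is the wedge with inward normals u and `edgeNormal τ σ`, and unit
-- inward normals of a wedge of angle α have inner product -cos α.
theorem isSectorPoint_corner {a₀ : Disc} {σ α : ℝ} (hσ : σ ^ 2 = 1) (hα : α ∈ Ioo 0 Real.pi)
    (h1 : inner ℝ (u : E3) (f a₀ : E3) = 0)
    (h2 : (horiz stdFrame (f a₀ : E3)).re = ‖horiz stdFrame (f a₀ : E3)‖ * Real.cos τ)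
    (h3 : 0 < σ * (horiz stdFrame (f a₀ : E3)).im)
    (h4 : inner ℝ (u : E3) (edgeNormal τ σ) = -Real.cos α) :
    IsSectorPoint discBoundary (fun a b => coneDist (f a) (f b)) a₀ α := by
  have hne : f a₀ ≠ stdPole := by
    intro h
    rw [h, horiz_stdPole] at h3
    simp at h3
  have hs : 0 < Real.sin α := Real.sin_pos_of_pos_of_lt_pi hα.1 hα.2
  set n := edgeNormal τ σ with hn
  have nn : inner ℝ n n = 1 := by
    rw [real_inner_self_eq_norm_sq, hn, norm_edgeNormal τ hσ, one_pow]
  have np : inner ℝ n (f a₀ : E3) = 0 := by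
    rw [hn, inner_edgeNormal]
    exact (sector_halfplane h0 hπ hσ h3).2.1 h2
  -- e is the unit vector for which n = sin α · e - cos α · u. It points along the base, so the
  -- frame (vertex, e, u) is adapted to the wedge.
  set e : E3 := (Real.sin α)⁻¹ • (n + Real.cos α • (u : E3)) with he
  have e1 : inner ℝ e (u : E3) = 0 := by
    rw [he, inner_smul_left, inner_add_left, inner_smul_left, Sphere2.inner_self,
      real_inner_comm, h4]
    simp
  have e2 : inner ℝ (f a₀ : E3) e = 0 := by
    rw [he, inner_smul_right, inner_add_right, inner_smul_right, real_inner_comm, np,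
      real_inner_comm, h1]
    simp
  have e3 : ‖e‖ = 1 := by
    rw [← sq_eq_sq₀ (norm_nonneg _) zero_le_one, ← real_inner_self_eq_norm_sq]
    nth_rw 2 [he]
    rw [inner_smul_right, inner_add_right, inner_smul_right, e1, he, inner_smul_left,
      inner_add_left, inner_smul_left, nn, h4]
    simp only [conj_trivial]
    field_simp
    nlinarith [Real.sin_sq_add_cos_sq α]
  obtain ⟨b, hb0, hb1, hb2⟩ := exists_frame_three (f a₀).norm_coe e3 u.norm_coe e2
    ((real_inner_comm _ _).trans h1) e1
  obtain ⟨r1, hr1, H1⟩ := exists_sphDist_ball_subset (eventually_corner (u := u) h0 hπ hσ h3)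
  obtain ⟨r2, hr2, H2⟩ := exists_coneDist_eq_sphDist hu h0 hπ (hf.mem_region a₀) hne
  refine (hf.isSectorChart_of_wedge (n := n) (r := min r1 r2) (α := α) hb0
    ⟨hα.1, hα.2.le⟩ ?_ (by positivity) ?_ ?_ ?_).isSectorPoint hα.1 ((hf.boundary a₀).2 (Or.inl h1))
  · rw [hb1, hb2, he, smul_smul, mul_inv_cancel₀ hs.ne', one_smul, add_sub_cancel_right]
  · intro v w hv hw
    exact H2 v w (hv.trans_le (min_le_right _ _)) (hw.trans_le (min_le_right _ _))
  · intro w hw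
    rw [(H1 w (hw.trans_le (min_le_left _ _))).1, hb2]
  · intro w hw
    rw [(H1 w (hw.trans_le (min_le_left _ _))).2, hb2]

include hu h0 hπ in
-- In polar coordinates at the apex `coneDist` is literally the cone distance, which allows angles
-- 2τ > π. Within a small radius only the sector condition is active, and shifting the argument by τ
-- gives the range [0, 2τ].
theorem isSectorPoint_apex :
    IsSectorPoint discBoundary (fun a b => coneDist (f a) (f b)) (x 0) (2 * τ) := by
  have hπ0 := Real.pi_pos
  obtain ⟨r, hr, H⟩ := exists_sphDist_ball_subset (eventually_inner_pos hu)
  have hd : ∀ a, coneDist (f (x 0)) (f a) = polarDist stdFrame (f a) := fun a => by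
    rw [hf.apex, coneDist_stdPole h0 hπ (hf.mem_region a)]
  have harg := fun a => abs_le.1 (abs_arg_le_of_mem h0 (hf.mem_region a).2)
  refine ⟨by positivity, (hf.boundary _).2 (Or.inr ?_), min r (Real.pi / 2), by positivity,
    min_le_right _ _, fun a => (horiz stdFrame (f a)).arg + τ, ?_, ?_, ?_, ?_⟩
  · rw [hf.apex, horiz_stdPole]
    simp
  · intro a _
    have := harg a
    constructor <;> linarith [this.1, this.2]
  · intro a b _ _
    simp only [hd, add_sub_add_right_eq_sub]
    rw [coneDist, sphConeDist, sphDist_arg stdFrame, Real.cos_abs]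
  · intro ρ hρ ψ hψ
    have hρI : ρ ∈ Ioo 0 Real.pi := ⟨hρ.1, by linarith [hρ.2.trans_le (min_le_right _ _)]⟩
    have e1 := polarDist_polarPoint stdFrame (ψ - τ) ⟨hρI.1.le, hρI.2.le⟩
    have e2 := arg_horiz_polarPoint stdFrame hρI (φ := ψ - τ)
      ⟨by linarith [hψ.1], by linarith [hψ.2]⟩
    have hmem : polarPoint stdFrame ρ (ψ - τ) ∈ region u τ := by
      refine ⟨(H _ ?_).le, norm_mul_cos_le_re hπ ?_⟩
      · change polarDist stdFrame _ < r
        rw [e1]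
        exact hρ.2.trans_le (min_le_left _ _)
      · rw [e2, abs_le]
        constructor <;> linarith [hψ.1, hψ.2]
    obtain ⟨a, ha⟩ := hf.exists_eq hmem
    refine ⟨a, ?_, ?_⟩
    · beta_reduce
      rw [hd, ha, e1]
    · simp only [ha, e2, sub_add_cancel]
  · intro a hne hlt
    beta_reduce at hlt ⊢
    rw [hd] at hlt
    have hpos : 0 < inner ℝ (u : E3) (f a : E3) := H _ (hlt.trans_le (min_le_left _ _))
    have hz : horiz stdFrame (f a) ≠ 0 := fun h =>
      hne (hf.eq_apex (eq_stdPole_of_horiz_eq_zero hu (hf.mem_region a).1 h))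
    have hzn := norm_pos_iff.2 hz
    have : IsRegionBoundary u τ (f a) ↔ |(horiz stdFrame (f a)).arg| = τ := by
      rw [IsRegionBoundary, or_iff_right hpos.ne', ← Complex.norm_mul_cos_arg,
        mul_right_inj' hzn.ne', ← Real.cos_abs]
      exact ⟨fun h => Real.injOn_cos ⟨abs_nonneg _, Complex.abs_arg_le_pi _⟩ ⟨h0.le, hπ.le⟩ h,
        fun h => by rw [h]⟩
    rw [hf.boundary, this, abs_eq h0.le]
    constructor
    · rintro (h | h)
      · right; linarith
      · left; linarith
    · rintro (h | h)
      · right; linarith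
      · left; linarith

include hu h0 hπ in
theorem isConePoint_interior {a₀ : Disc} (ha : a₀ ∉ discBoundary) :
    IsConePoint (fun a b => coneDist (f a) (f b)) a₀ (2 * Real.pi) := by
  have hπ0 := Real.pi_pos
  rw [hf.boundary, IsRegionBoundary] at ha
  push Not at ha
  have hm := hf.mem_region a₀
  have p1 : 0 < inner ℝ (u : E3) (f a₀ : E3) := lt_of_le_of_ne hm.1 (Ne.symm ha.1)
  have p2 := lt_of_le_of_ne hm.2 (Ne.symm ha.2)
  have hne : f a₀ ≠ stdPole := by
    intro h
    rw [h, horiz_stdPole] at p2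
    simp at p2
  obtain ⟨b, hb⟩ := exists_frame_one (f a₀)
  have hpole : framePole b = f a₀ := Subtype.ext hb
  obtain ⟨r1, hr1, H1⟩ := exists_sphDist_ball_subset
    ((eventually_inner_pos p1).and (eventually_sector_lt p2))
  obtain ⟨r2, hr2, H2⟩ := exists_coneDist_eq_sphDist hu h0 hπ hm hne
  have hself : sphDist (f a₀) (f a₀) < r2 := by rw [sphDist_self]; exact hr2
  set r := min (min r1 r2) (Real.pi / 2) with hr
  have rr1 : r ≤ r1 := (min_le_left _ _).trans (min_le_left _ _)
  have rr2 : r ≤ r2 := (min_le_left _ _).trans (min_le_right _ _)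
  have rr3 : r ≤ Real.pi / 2 := min_le_right _ _
  have near : ∀ w, coneDist (f a₀) w < r → sphDist (f a₀) w < r2 := fun w hw =>
    lt_of_le_of_lt (sphDist_le_coneDist _ _) (hw.trans_le rr2)
  have hρ : ∀ w, sphDist (f a₀) w < r2 → coneDist (f a₀) w = polarDist b w := fun w hw => by
    rw [H2 _ _ hself hw, polarDist, hpole]
  refine ⟨by positivity, r, by positivity, rr3,
    fun a => ((horiz b (f a)).arg : AddCircle (2 * Real.pi)), ?_, ?_⟩
  · intro a c hac hcc
    have hs := near _ hac
    have ht := near _ hcc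
    beta_reduce at hac hcc ⊢
    rw [hρ _ hs] at hac ⊢
    rw [hρ _ ht] at hcc ⊢
    have nl : ‖((horiz b (f a)).arg : AddCircle (2 * Real.pi)) - ((horiz b (f c)).arg : ℝ)‖
        ≤ Real.pi := by
      refine (AddCircle.norm_le_half_period _ (by positivity)).trans ?_
      rw [abs_of_pos (by positivity)]
      linarith
    rw [H2 _ _ hs ht, sphDist_arg b, sphConeDist_of_le_pi (polarDist_nonneg _ _)
      (polarDist_nonneg _ _) (by linarith) nl, ← AddCircle.coe_sub, cos_norm_coe]
  · intro ρ hρ' ψ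
    have : Fact (0 < 2 * Real.pi) := ⟨by positivity⟩
    obtain ⟨y, hy, rfl⟩ : ∃ y : ℝ, y ∈ Ioc (-Real.pi) (-Real.pi + 2 * Real.pi) ∧
        (y : AddCircle (2 * Real.pi)) = ψ := by
      have := AddCircle.coe_image_Ioc_eq (2 * Real.pi) (-Real.pi)
      have h2 : ψ ∈ (univ : Set (AddCircle (2 * Real.pi))) := trivial
      rw [← this] at h2
      exact h2
    have hρI : ρ ∈ Ioo 0 Real.pi := ⟨hρ'.1, by linarith [hρ'.2.trans_le rr3]⟩
    have e1 := polarDist_polarPoint b y ⟨hρI.1.le, hρI.2.le⟩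
    have e2 := arg_horiz_polarPoint b hρI (φ := y) ⟨hy.1, by linarith [hy.2]⟩
    have hs : sphDist (f a₀) (polarPoint b ρ y) < r := by
      rw [← hpole]
      change polarDist b _ < r
      rw [e1]
      exact hρ'.2
    have hin := H1 _ (hs.trans_le rr1)
    obtain ⟨a, ha⟩ := hf.exists_eq (w := polarPoint b ρ y) ⟨hin.1.le, hin.2.le⟩
    refine ⟨a, ?_, ?_⟩
    · beta_reduce
      rw [ha, hρ _ (hs.trans_le rr2), e1]
    · beta_reduce
      rw [ha, e2]

include hu h0 hπ in
theorem isLocalIsometryAt {a₀ : Disc} (ha : a₀ ≠ x 0) :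
    IsLocalIsometryAt (fun a b => coneDist (f a) (f b)) f a₀ := by
  obtain ⟨r, hr, H⟩ := exists_coneDist_eq_sphDist hu h0 hπ (hf.mem_region a₀)
    (fun h => ha (hf.eq_apex h))
  exact ⟨r, hr, fun a b h1 h2 => (H _ _ (lt_of_le_of_lt (sphDist_le_coneDist _ _) h1)
    (lt_of_le_of_lt (sphDist_le_coneDist _ _) h2)).symm⟩

include hu h0 hπ in
theorem isGeodesicMetric : IsGeodesicMetric fun a b => coneDist (f a) (f b) := by
  have tri : ∀ a b c, coneDist (f a) (f c) ≤ coneDist (f a) (f b) + coneDist (f b) (f c) :=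
    fun a b c => coneDist_triangle hu (hf.mem_region a).1 (hf.mem_region b).1 (hf.mem_region c).1
  have eqz : ∀ a b, coneDist (f a) (f b) = 0 → a = b := fun a b h =>
    hf.inj (eq_of_coneDist_eq_zero h)
  refine ⟨fun a => coneDist_self _, fun a b => coneDist_comm _ _, tri, eqz,
    isOpen_iff_of_compact (fun a => coneDist_self _) (fun a b => coneDist_comm _ _) tri eqz ?_, ?_⟩
  · intro a
    have hc : ContinuousAt (fun b => sphDist (f a) (f b)) a :=
      (continuous_sphDist.comp (continuous_const.prodMk hf.cont)).continuousAt
    refine hc.congr ?_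
    by_cases ha : f a = stdPole
    · refine Eventually.of_forall fun b => ?_
      rw [ha]
      exact (coneDist_stdPole h0 hπ (hf.mem_region b)).symm
    · obtain ⟨r, hr, H⟩ := exists_coneDist_eq_sphDist hu h0 hπ (hf.mem_region a) ha
      have hself : sphDist (f a) (f a) < r := by rw [sphDist_self]; exact hr
      filter_upwards [hc.eventually (eventually_lt_nhds hself)] with b hb
      exact (H _ _ hself hb).symm
  · intro a b
    obtain ⟨γ, g0, g1, g2⟩ := hasGeodesic_regionDist hu h0 hπ ⟨f a, hf.mem_region a⟩
      ⟨f b, hf.mem_region b⟩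
    choose g hg using fun w : region u τ => hf.exists_eq w.2
    refine ⟨fun s => g (γ s), hf.inj ?_, hf.inj ?_, ?_⟩
    · rw [hg, g0]
    · exact (hg _).trans (congrArg Subtype.val g1)
    · intro s hs t ht
      simp only [hg]
      exact g2 s hs t ht

include hu h0 hπ in
/-- A region with suitable angles is a spherical triangle. -/
theorem isSphericalTriangle {ϑ : Fin 3 → ℝ} (hτ : 2 * τ = Real.pi * ϑ 0)
    (h1 : ϑ 1 ∈ Ioo (0 : ℝ) 1) (h2 : ϑ 2 ∈ Ioo (0 : ℝ) 1)
    (a1 : inner ℝ (u : E3) (edgeNormal τ (-1)) = -Real.cos (Real.pi * ϑ 1))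
    (a2 : inner ℝ (u : E3) (edgeNormal τ 1) = -Real.cos (Real.pi * ϑ 2)) :
    IsSphericalTriangle x ϑ fun a b => coneDist (f a) (f b) := by
  have hπ0 := Real.pi_pos
  have i0 : (horiz stdFrame (f (x 0))).im = 0 := by rw [hf.apex, horiz_stdPole]; rfl
  have i1 := hf.im_neg
  have i2 := hf.im_pos
  refine ⟨hf.isGeodesicMetric hu h0 hπ, ?_, fun p hp => hf.isConePoint_interior hu h0 hπ hp, ?_, ?_⟩
  · intro i j hij
    -- The three vertices are told apart by the sign of the second horizontal coordinate.
    have := congrArg (fun a => (horiz stdFrame (f a)).im) hij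
    fin_cases i <;> fin_cases j <;> simp_all <;> linarith
  · intro p hp hv
    have hp0 : f p ≠ stdPole := fun h => hv ⟨0, (hf.eq_apex h).symm⟩
    have hm := hf.mem_region p
    have hcor : ¬ (inner ℝ (u : E3) (f p : E3) = 0 ∧
        (horiz stdFrame (f p)).re = ‖horiz stdFrame (f p)‖ * Real.cos τ) := by
      rw [hf.corner]
      rintro (h | h)
      · exact hv ⟨1, h.symm⟩
      · exact hv ⟨2, h.symm⟩
    have hE : ∃ N, IsEdgeAt u τ (f p) N := by
      rcases (hf.boundary p).1 hp with h | h
      · have hs := lt_of_le_of_ne hm.2 (fun h' => hcor ⟨h, h'.symm⟩)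
        exact ⟨u, isEdgeAt_base h hs⟩
      · have hpos := lt_of_le_of_ne hm.1 (fun h' => hcor ⟨h'.symm, h⟩)
        -- Away from the apex, a point on the boundary of the sector and on its axis would force
        -- |cos τ| = 1. Hence the point belongs to exactly one of the two sides.
        have him : (horiz stdFrame (f p)).im ≠ 0 := by
          intro him
          have hz : horiz stdFrame (f p) ≠ 0 := fun hz =>
            hp0 (eq_stdPole_of_horiz_eq_zero hu hm.1 hz)
          have habs : |(horiz stdFrame (f p)).re| = ‖horiz stdFrame (f p)‖ := by
            rw [← Complex.abs_re_eq_norm] at him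
            exact him
          have hn := norm_pos_iff.2 hz
          rw [h, abs_mul, abs_of_pos hn] at habs
          have hc : |Real.cos τ| = 1 := by
            have := mul_left_cancel₀ hn.ne' (habs.trans (mul_one _).symm)
            exact this
          have hs := Real.sin_pos_of_pos_of_lt_pi h0 hπ
          have := Real.sin_sq_add_cos_sq τ
          rw [← sq_abs (Real.cos τ), hc] at this
          nlinarith
        rcases lt_or_gt_of_ne him with hi | hi
        · exact ⟨_, isEdgeAt_side (σ := -1) h0 hπ (by norm_num) hpos h (by linarith)⟩
        · exact ⟨_, isEdgeAt_side (σ := 1) h0 hπ (by norm_num) hpos h (by linarith)⟩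
    obtain ⟨N, hN⟩ := hE
    obtain ⟨b, r, -, -, hc⟩ := hf.exists_edge_chart hu h0 hπ hp0 hN
    exact hc.isSectorPoint hπ0 hp
  · have v0 := hf.isSectorPoint_apex hu h0 hπ
    rw [hτ] at v0
    have c1 := (hf.corner (x 1)).2 (Or.inl rfl)
    have v1 := hf.isSectorPoint_corner hu h0 hπ (σ := -1) (by norm_num)
      ⟨mul_pos hπ0 h1.1, by nlinarith [h1.2]⟩ c1.1 c1.2 (by linarith) a1
    have c2 := (hf.corner (x 2)).2 (Or.inr rfl)
    have v2 := hf.isSectorPoint_corner hu h0 hπ (σ := 1) (by norm_num)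
      ⟨mul_pos hπ0 h2.1, by nlinarith [h2.2]⟩ c2.1 c2.2 (by linarith) a2
    intro i
    match i with
    | 0 => exact v0
    | 1 => exact v1
    | 2 => exact v2

end IsRegionChart

/-! ### A planar model of the triangle -/

/-- A triangle in the plane. -/
def modelTriangle : Set ℂ := {z | |z.re| ≤ z.im ∧ z.im ≤ 1}

/-- A homeomorphism of the disc onto the model triangle, with vertices `x`. -/
structure IsModelChart (g : Disc → ℂ) (x : Fin 3 → Disc) : Prop where
  cont : Continuous g
  inj : Function.Injective g
  range_eq : range g = modelTriangle
  boundary : ∀ a, a ∈ discBoundary ↔ |(g a).re| = (g a).im ∨ (g a).im = 1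
  vertex_zero : g (x 0) = 0
  vertex_one : g (x 1) = ⟨-1, 1⟩
  vertex_two : g (x 2) = ⟨1, 1⟩

theorem convex_modelTriangle : Convex ℝ modelTriangle := by
  intro z hz w hw a b ha hb hab
  refine ⟨?_, ?_⟩
  · simp only [Complex.add_re, Complex.add_im, Complex.real_smul, Complex.re_ofReal_mul,
      Complex.im_ofReal_mul]
    calc |a * z.re + b * w.re| ≤ a * |z.re| + b * |w.re| := by
          refine (abs_add_le _ _).trans (le_of_eq ?_)
          rw [abs_mul, abs_mul, abs_of_nonneg ha, abs_of_nonneg hb]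
      _ ≤ a * z.im + b * w.im := by
          have := mul_le_mul_of_nonneg_left hz.1 ha
          have := mul_le_mul_of_nonneg_left hw.1 hb
          linarith
  · simp only [Complex.add_im, Complex.real_smul, Complex.im_ofReal_mul]
    have := mul_le_mul_of_nonneg_left hz.2 ha
    have := mul_le_mul_of_nonneg_left hw.2 hb
    linarith

theorem isClosed_modelTriangle : IsClosed modelTriangle :=
  (isClosed_le (Complex.continuous_re.abs) Complex.continuous_im).inter
    (isClosed_le Complex.continuous_im continuous_const)

theorem interior_modelTriangle :
    interior modelTriangle = {z | |z.re| < z.im ∧ z.im < 1} := by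
  apply Subset.antisymm
  · intro z hz
    rw [mem_interior_iff_mem_nhds, Metric.mem_nhds_iff] at hz
    obtain ⟨ε, hε, h⟩ := hz
    -- Moving up by ε/2 makes the bound on the height strict, and moving down makes the bound by the
    -- two sides strict.
    have h1 : z + ((ε / 2 : ℝ) : ℂ) * Complex.I ∈ modelTriangle := h (by
      rw [Metric.mem_ball, dist_eq_norm, add_sub_cancel_left, norm_mul, Complex.norm_real,
        Complex.norm_I, mul_one, Real.norm_eq_abs, abs_of_pos (by positivity)]
      linarith)
    have h2 : z - ((ε / 2 : ℝ) : ℂ) * Complex.I ∈ modelTriangle := h (by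
      rw [Metric.mem_ball, dist_eq_norm, sub_sub_cancel_left, norm_neg, norm_mul, Complex.norm_real,
        Complex.norm_I, mul_one, Real.norm_eq_abs, abs_of_pos (by positivity)]
      linarith)
    have e1 := h1.2
    have e2 := h2.1
    simp only [Complex.add_im, Complex.sub_im, Complex.sub_re, Complex.im_ofReal_mul,
      Complex.re_ofReal_mul, Complex.I_re, Complex.I_im] at e1 e2
    rw [mul_zero, sub_zero] at e2
    exact ⟨by linarith, by linarith⟩
  · refine interior_maximal (fun z hz => ⟨hz.1.le, hz.2.le⟩) ?_
    exact (isOpen_lt (Complex.continuous_re.abs) Complex.continuous_im).inter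
      (isOpen_lt Complex.continuous_im continuous_const)

/-- A bounded convex set with interior is carried to the unit ball by a homeomorphism of the plane
that respects interiors, hence boundaries. One such chart is fixed and used for all angles. -/
theorem exists_isModelChart : ∃ g x, IsModelChart g x := by
  have hb : Bornology.IsBounded modelTriangle := by
    refine (Metric.isBounded_closedBall (x := (0 : ℂ)) (r := 2)).subset fun z hz => ?_
    rw [mem_closedBall_zero_iff]
    have := Complex.norm_le_abs_re_add_abs_im z
    have h1 := hz.1
    have h2 := hz.2
    have h3 : 0 ≤ z.im := (abs_nonneg _).trans h1
    rw [abs_of_nonneg h3] at this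
    linarith
  have hne : (interior modelTriangle).Nonempty := by
    rw [interior_modelTriangle]
    refine ⟨⟨0, 1 / 2⟩, ?_, ?_⟩ <;> norm_num
  obtain ⟨e, h1, h2, h3⟩ :=
    exists_homeomorph_image_interior_closure_frontier_eq_unitBall convex_modelTriangle hne hb
  rw [isClosed_modelTriangle.closure_eq] at h2
  set g : Disc → ℂ := fun a => e.symm a with hg
  have hr : range g = modelTriangle := by
    rw [show g = e.symm ∘ Subtype.val from rfl, range_comp, Subtype.range_coe]
    rw [← h2, ← image_comp]
    simp
  have hs : ∀ z ∈ modelTriangle, ∃ a, g a = z := fun z hz => by rwa [← hr] at hz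
  obtain ⟨x0, e0⟩ := hs 0 ⟨by simp, by simp⟩
  obtain ⟨x1, e1⟩ := hs ⟨-1, 1⟩ ⟨by simp, by simp⟩
  obtain ⟨x2, e2⟩ := hs ⟨1, 1⟩ ⟨by simp, by simp⟩
  refine ⟨g, ![x0, x1, x2], ?_, ?_, hr, ?_, e0, e1, e2⟩
  · exact e.symm.continuous.comp continuous_subtype_val
  · exact e.symm.injective.comp Subtype.val_injective
  · intro a
    have hmem : g a ∈ modelTriangle := hr ▸ mem_range_self a
    have : a ∈ discBoundary ↔ g a ∉ interior modelTriangle := by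
      have hi : g a ∈ interior modelTriangle ↔ (a : ℂ) ∈ Metric.ball (0 : ℂ) 1 := by
        rw [← h1]
        constructor
        · intro h
          exact ⟨_, h, by simp [hg]⟩
        · rintro ⟨z, hz, hza⟩
          simpa [hg, ← hza] using hz
      rw [hi, mem_ball_zero_iff, not_lt]
      have := a.2
      rw [mem_closedBall_zero_iff] at this
      exact ⟨fun h => (le_of_eq h.symm), fun h => le_antisymm this h⟩
    rw [this, interior_modelTriangle]
    have m1 := hmem.1
    have m2 := hmem.2
    constructor
    · intro h
      by_contra hcon
      push Not at hcon
      exact h ⟨lt_of_le_of_ne m1 hcon.1, lt_of_le_of_ne m2 hcon.2⟩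
    · rintro (h | h) ⟨h1, h2⟩ <;> linarith

/-! ### The developing map -/

/-- The point of the sphere in the direction of a vector. -/
def sphereDir (v : E3) : Sphere2 := open Classical in if h : v = 0 then stdPole else toSphere v h

theorem sphereDir_of_ne {v : E3} (h : v ≠ 0) : sphereDir v = toSphere v h := dif_neg h

theorem norm_smul_sphereDir {v : E3} (h : v ≠ 0) : ‖v‖ • (sphereDir v : E3) = v := by
  rw [sphereDir_of_ne h, norm_smul_toSphere]

theorem coe_sphereDir {v : E3} (h : v ≠ 0) : (sphereDir v : E3) = ‖v‖⁻¹ • v := by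
  rw [sphereDir_of_ne h]
  rfl

theorem sphereDir_smul {c : ℝ} (hc : 0 < c) (w : Sphere2) : sphereDir (c • (w : E3)) = w := by
  apply Subtype.ext
  rw [coe_sphereDir (smul_ne_zero hc.ne' w.ne_zero), norm_smul, w.norm_coe, mul_one,
    Real.norm_of_nonneg hc.le, smul_smul, inv_mul_cancel₀ hc.ne', one_smul]

/-- The horizontal part of the developing map. -/
def devHoriz (τ : ℝ) (z : ℂ) : ℂ := ⟨z.im - |z.re| * (1 - Real.cos τ), z.re * Real.sin τ⟩

/-- The developing map, before normalization: it is linear in `(1 - q, p, q)` on each of the two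
halves of the model triangle. -/
def devVec (u : E3) (τ : ℝ) (z : ℂ) : E3 :=
  !₂[1 - z.im - (u 1 * (devHoriz τ z).re + u 2 * (devHoriz τ z).im) / u 0,
    (devHoriz τ z).re, (devHoriz τ z).im]

/-- The developing map of the model triangle. -/
def dev (u : Sphere2) (τ : ℝ) (z : ℂ) : Sphere2 := sphereDir (devVec u τ z)

theorem horiz_stdFrame (w : E3) : horiz stdFrame w = ⟨w 1, w 2⟩ := by
  apply Complex.ext <;> simp [horiz, EuclideanSpace.inner_single_left]

theorem horiz_devVec (u : E3) (τ : ℝ) (z : ℂ) : horiz stdFrame (devVec u τ z) = devHoriz τ z := by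
  rw [horiz_stdFrame]
  rfl

theorem inner_stdPole (u : E3) : inner ℝ u (stdPole : E3) = u 0 := by
  simp [framePole, EuclideanSpace.inner_single_right]

theorem inner_E3 (u w : E3) : inner ℝ u w = u 0 * w 0 + u 1 * w 1 + u 2 * w 2 := by
  simp only [PiLp.inner_apply, Fin.sum_univ_three, Real.inner_apply]

/-- The vertical coordinate of `devVec` is chosen to make this true: the edge of height 1 of the
model goes to the great circle with pole u. -/
theorem inner_devVec {u : E3} (hu : 0 < u 0) (τ : ℝ) (z : ℂ) :
    inner ℝ u (devVec u τ z) = u 0 * (1 - z.im) := by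
  rw [inner_E3]
  simp only [devVec, PiLp.toLp_apply, Matrix.cons_val]
  field_simp
  ring

section

variable {τ : ℝ} (h0 : 0 < τ) (hπ : τ < Real.pi)
include h0 hπ

/-- On each half, the linear form of the corresponding side evaluates to sin τ (im z - |re z|). The
middle line re z = 0 goes to the axis of the sector. Two linear pieces are used because 2τ may
exceed π while τ does not. -/
theorem devHoriz_sector {z : ℂ} (hz : z ∈ modelTriangle) :
    ‖devHoriz τ z‖ * Real.cos τ ≤ (devHoriz τ z).re ∧
    ((devHoriz τ z).re = ‖devHoriz τ z‖ * Real.cos τ ↔ |z.re| = z.im) := by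
  have hs := Real.sin_pos_of_pos_of_lt_pi h0 hπ
  have hc : Real.cos τ < 1 := by
    rw [← Real.cos_zero]
    exact Real.cos_lt_cos_of_nonneg_of_le_pi le_rfl hπ.le h0
  have main : ∀ σ : ℝ, σ ^ 2 = 1 → σ * z.re = |z.re| → z.re ≠ 0 →
      ‖devHoriz τ z‖ * Real.cos τ ≤ (devHoriz τ z).re ∧
      ((devHoriz τ z).re = ‖devHoriz τ z‖ * Real.cos τ ↔ |z.re| = z.im) := by
    intro σ hσ h1 h2
    have hp : 0 < |z.re| := abs_pos.2 h2
    have hq : σ * (devHoriz τ z).im = |z.re| * Real.sin τ := by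
      simp only [devHoriz]
      rw [← h1]
      ring
    have hl := sector_halfplane h0 hπ hσ (z := devHoriz τ z) (by rw [hq]; positivity)
    have e : Real.sin τ * (devHoriz τ z).re - σ * Real.cos τ * (devHoriz τ z).im =
        Real.sin τ * (z.im - |z.re|) := by
      rw [mul_right_comm, hq]
      simp only [devHoriz]
      ring
    rw [e] at hl
    rw [hl.1, hl.2]
    refine ⟨mul_nonneg hs.le (by linarith [hz.1]), ?_⟩
    rw [mul_eq_zero, or_iff_right hs.ne', sub_eq_zero, eq_comm]
  rcases lt_trichotomy z.re 0 with h | h | h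
  · exact main (-1) (by norm_num) (by rw [abs_of_neg h]; ring) h.ne
  · have e : devHoriz τ z = ((z.im : ℝ) : ℂ) := by
      apply Complex.ext <;> simp [devHoriz, h]
    have him : 0 ≤ z.im := (abs_nonneg _).trans hz.1
    rw [e, Complex.norm_real, Real.norm_of_nonneg him, Complex.ofReal_re, h, abs_zero]
    refine ⟨by nlinarith, ?_⟩
    constructor
    · intro h1
      have : z.im * (1 - Real.cos τ) = 0 := by linarith
      exact ((mul_eq_zero.1 this).resolve_right (by linarith)).symm
    · intro h1
      rw [← h1]
      ring
  · exact main 1 (by norm_num) (by rw [abs_of_pos h]; ring) h.ne'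

/-- The quantities re, im and 1 - im are recovered homogeneously from the vector. The last two add
up to 1, so the scale c must be 1. -/
theorem devVec_injOn {u : E3} (hu : 0 < u 0) {z w : ℂ} {c : ℝ} (hc : 0 < c)
    (h : devVec u τ z = c • devVec u τ w) : z = w := by
  have hs := Real.sin_pos_of_pos_of_lt_pi h0 hπ
  have h1 : devHoriz τ z = c * devHoriz τ w := by
    rw [← horiz_devVec u, h, horiz_smul, horiz_devVec]
  have him := congrArg Complex.im h1
  have hre := congrArg Complex.re h1
  rw [Complex.im_ofReal_mul] at him
  rw [Complex.re_ofReal_mul] at hre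
  simp only [devHoriz] at him hre
  have e1 : z.re = c * w.re := by
    apply mul_right_cancel₀ hs.ne'
    rw [him]
    ring
  have e2 : |z.re| = c * |w.re| := by rw [e1, abs_mul, abs_of_pos hc]
  have e3 : z.im = c * w.im := by
    rw [e2] at hre
    linarith
  have e4 := congrArg (inner ℝ u) h
  rw [inner_smul_right, inner_devVec hu, inner_devVec hu] at e4
  have e5 : 1 - z.im = c * (1 - w.im) := by
    apply mul_left_cancel₀ hu.ne'
    rw [e4]
    ring
  have : c = 1 := by linarith
  subst this
  apply Complex.ext <;> linarith

theorem devVec_ne_zero {u : E3} (hu : 0 < u 0) (z : ℂ) : devVec u τ z ≠ 0 := by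
  intro h
  have hs := Real.sin_pos_of_pos_of_lt_pi h0 hπ
  have e1 : devHoriz τ z = 0 := by
    rw [← horiz_devVec u, h, horiz_stdFrame]
    rfl
  have him := congrArg Complex.im e1
  have hre := congrArg Complex.re e1
  simp only [devHoriz, Complex.zero_im, Complex.zero_re] at him hre
  have hz : z.re = 0 := (mul_eq_zero.1 him).resolve_right hs.ne'
  rw [hz, abs_zero, zero_mul, sub_zero] at hre
  have := inner_devVec hu τ z
  rw [h, inner_zero_right, hre] at this
  linarith

theorem continuous_dev {u : Sphere2} (hu : 0 < (u : E3) 0) : Continuous (dev u τ) := by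
  rw [continuous_induced_rng]
  have e : (Subtype.val ∘ dev u τ) = fun z => ‖devVec u τ z‖⁻¹ • devVec u τ z := by
    funext z
    exact coe_sphereDir (devVec_ne_zero h0 hπ hu z)
  rw [e]
  have hc : Continuous fun z => devVec u τ z := by
    unfold devVec devHoriz
    refine (PiLp.continuous_toLp 2 _).comp (continuous_pi fun i => ?_)
    fin_cases i <;> simp <;> fun_prop
  exact (hc.norm.inv₀ fun z => norm_ne_zero_iff.2 (devVec_ne_zero h0 hπ hu z)).smul hc

/-- Solving the defining equations gives homogeneous coordinates p, q and η of w, standing for re,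
im and 1 - im. Membership in the region says |p| ≤ q and η ≥ 0, and scaling to η + q = 1 gives a
point of the model triangle. -/
theorem exists_devVec_eq {u w : Sphere2} (hu : 0 < (u : E3) 0) (hw : w ∈ region u τ) :
    ∃ z ∈ modelTriangle, ∃ c : ℝ, 0 < c ∧ devVec u τ z = c • (w : E3) := by
  have hs := Real.sin_pos_of_pos_of_lt_pi h0 hπ
  have hc : Real.cos τ < 1 := by
    rw [← Real.cos_zero]
    exact Real.cos_lt_cos_of_nonneg_of_le_pi le_rfl hπ.le h0
  obtain ⟨hw1, hw2⟩ := hw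
  set h := horiz stdFrame (w : E3) with hh
  set p := h.im / Real.sin τ with hp
  have hps : p * Real.sin τ = h.im := div_mul_cancel₀ _ hs.ne'
  have hβ : |p| * Real.cos τ ≤ h.re := by
    have main : ∀ σ : ℝ, σ ^ 2 = 1 → 0 < σ * h.im → |p| * Real.cos τ ≤ h.re := by
      intro σ hσ h1
      have h2 := ((sector_halfplane h0 hπ hσ h1).1).1 hw2
      have h3 : |p| * Real.sin τ = σ * h.im := by
        have : σ * p = |p| := by
          have h4 : 0 < σ * p := by rw [hp, mul_div_assoc']; positivity
          rw [← abs_of_pos h4, abs_mul]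
          have : |σ| = 1 :=
            (pow_eq_one_iff_of_nonneg (abs_nonneg σ) two_ne_zero).1 (by rw [sq_abs, hσ])
          rw [this, one_mul]
        rw [← this, mul_assoc, hps]
      have h5 : 0 ≤ Real.sin τ * (h.re - |p| * Real.cos τ) := by
        calc 0 ≤ _ := h2
          _ = Real.sin τ * h.re - Real.cos τ * (σ * h.im) := by ring
          _ = _ := by rw [← h3]; ring
      linarith [nonneg_of_mul_nonneg_right h5 hs]
    rcases lt_trichotomy h.im 0 with h1 | h1 | h1
    · exact main (-1) (by norm_num) (by linarith)
    · have hp0 : p = 0 := by rw [hp, h1, zero_div]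
      rw [hp0, abs_zero, zero_mul]
      have : ‖h‖ = |h.re| := (Complex.abs_re_eq_norm.2 h1).symm
      rw [this] at hw2
      by_contra hneg
      push Not at hneg
      rw [abs_of_neg hneg] at hw2
      have : -1 < Real.cos τ := by
        rw [← Real.cos_pi]
        exact Real.cos_lt_cos_of_nonneg_of_le_pi h0.le le_rfl hπ
      nlinarith
    · exact main 1 (by norm_num) (by linarith)
  set q := h.re + |p| * (1 - Real.cos τ) with hq
  have hpq : |p| ≤ q := by rw [hq]; linarith
  set η := inner ℝ (u : E3) (w : E3) / (u : E3) 0 with hη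
  have hη0 : 0 ≤ η := div_nonneg hw1 hu.le
  have hq0 : 0 ≤ q := (abs_nonneg _).trans hpq
  -- If both vanished, w would have no horizontal part, so w would be the apex, where η = 1.
  have hT : 0 < η + q := by
    rcases (add_nonneg hη0 hq0).eq_or_lt with h1 | h1
    · exfalso
      have z1 : η = 0 := by linarith
      have z2 : q = 0 := by linarith
      have z3 : p = 0 := by
        rw [z2] at hpq
        exact abs_nonpos_iff.1 hpq
      have z4 : h.im = 0 := by rw [← hps, z3, zero_mul]
      have z5 : h.re = 0 := by rw [hq, z3] at z2; simpa using z2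
      have := eq_stdPole_of_horiz_eq_zero (u := u) (by rw [inner_stdPole]; exact hu) hw1
        (Complex.ext z5 z4)
      rw [hη, this, inner_stdPole, div_self hu.ne'] at z1
      exact one_ne_zero z1
    · exact h1
  obtain ⟨k, hk, hk1⟩ : ∃ k : ℝ, 0 < k ∧ k * (η + q) = 1 :=
    ⟨(η + q)⁻¹, inv_pos.2 hT, inv_mul_cancel₀ hT.ne'⟩
  have key : devHoriz τ ⟨k * p, k * q⟩ = k * h := by
    apply Complex.ext
    · rw [Complex.re_ofReal_mul]
      simp only [devHoriz, abs_mul, abs_of_pos hk]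
      rw [hq]
      ring
    · rw [Complex.im_ofReal_mul, ← hps]
      simp only [devHoriz]
      ring
  refine ⟨⟨k * p, k * q⟩, ⟨?_, ?_⟩, k, hk, ?_⟩
  · simp only [abs_mul, abs_of_pos hk]
    exact mul_le_mul_of_nonneg_left hpq hk.le
  · have := mul_nonneg hk.le hη0
    simp only
    linarith
  · have hh' : h = ⟨(w : E3) 1, (w : E3) 2⟩ := horiz_stdFrame _
    have hin : (u : E3) 0 * η = (u : E3) 0 * (w : E3) 0 + (u : E3) 1 * h.re + (u : E3) 2 * h.im := by
      rw [hη, mul_div_cancel₀ _ hu.ne', inner_E3, hh']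
    have hη' : (w : E3) 0 = η - ((u : E3) 1 * h.re + (u : E3) 2 * h.im) / (u : E3) 0 := by
      field_simp
      linarith
    simp only [devVec, key, Complex.re_ofReal_mul, Complex.im_ofReal_mul]
    have h1 : (1 : ℝ) - k * q = k * η := by linarith
    ext i
    fin_cases i
    · simp only [Fin.zero_eta, Matrix.cons_val, PiLp.smul_apply, smul_eq_mul]
      rw [hη', h1]
      ring
    · simp [hh']
    · simp [hh']

end

/-- The developing map parametrizes the region. -/
theorem IsModelChart.isRegionChart {g : Disc → ℂ} {x : Fin 3 → Disc} (hg : IsModelChart g x)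
    {u : Sphere2} {τ : ℝ} (hu : 0 < (u : E3) 0) (h0 : 0 < τ) (hπ : τ < Real.pi) :
    IsRegionChart (fun a => dev u τ (g a)) x u τ := by
  have hs := Real.sin_pos_of_pos_of_lt_pi h0 hπ
  have hne : ∀ z, devVec u τ z ≠ 0 := devVec_ne_zero h0 hπ hu
  have hK : ∀ a, g a ∈ modelTriangle := fun a => hg.range_eq ▸ mem_range_self a
  have hdev : ∀ z, devVec u τ z = ‖devVec u τ z‖ • (dev u τ z : E3) := fun z =>
    (norm_smul_sphereDir (hne z)).symm
  have hpos : ∀ z, 0 < ‖devVec u τ z‖ := fun z => norm_pos_iff.2 (hne z)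
  have hin : ∀ z, ‖devVec u τ z‖ * inner ℝ (u : E3) (dev u τ z : E3) = (u : E3) 0 * (1 - z.im) := by
    intro z
    rw [← inner_smul_right, ← hdev, inner_devVec hu]
  have hho : ∀ z, ((‖devVec u τ z‖ : ℝ) : ℂ) * horiz stdFrame (dev u τ z : E3) = devHoriz τ z := by
    intro z
    rw [← horiz_smul, ← hdev, horiz_devVec]
  have in0 : ∀ z, inner ℝ (u : E3) (dev u τ z : E3) = 0 ↔ z.im = 1 := by
    intro z
    have := hin z
    constructor
    · intro h
      rw [h, mul_zero, eq_comm, mul_eq_zero, or_iff_right hu.ne'] at this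
      linarith
    · intro h
      rw [h, sub_self, mul_zero, mul_eq_zero, or_iff_right (hpos z).ne'] at this
      exact this
  have sec : ∀ z, (horiz stdFrame (dev u τ z : E3)).re =
      ‖horiz stdFrame (dev u τ z : E3)‖ * Real.cos τ ↔
      (devHoriz τ z).re = ‖devHoriz τ z‖ * Real.cos τ := by
    intro z
    rw [← hho z, Complex.re_ofReal_mul, norm_mul, Complex.norm_real,
      Real.norm_of_nonneg (hpos z).le, mul_assoc, mul_right_inj' (hpos z).ne']
  have secle : ∀ z, ‖horiz stdFrame (dev u τ z : E3)‖ * Real.cos τ ≤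
      (horiz stdFrame (dev u τ z : E3)).re ↔ ‖devHoriz τ z‖ * Real.cos τ ≤ (devHoriz τ z).re := by
    intro z
    rw [← hho z, Complex.re_ofReal_mul, norm_mul, Complex.norm_real,
      Real.norm_of_nonneg (hpos z).le, mul_assoc, mul_le_mul_iff_right₀ (hpos z)]
  have him : ∀ z, ‖devVec u τ z‖ * (horiz stdFrame (dev u τ z : E3)).im = z.re * Real.sin τ := by
    intro z
    rw [← Complex.im_ofReal_mul, hho]
    rfl
  have bd : ∀ a, (horiz stdFrame (dev u τ (g a) : E3)).re =
      ‖horiz stdFrame (dev u τ (g a) : E3)‖ * Real.cos τ ↔ |(g a).re| = (g a).im := fun a => by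
    rw [sec, (devHoriz_sector h0 hπ (hK a)).2]
  refine ⟨?_, ?_, ?_, ?_, ?_, ?_, ?_, ?_⟩
  · exact (continuous_dev h0 hπ hu).comp hg.cont
  · intro a b hab
    apply hg.inj
    have hab' : dev u τ (g a) = dev u τ (g b) := hab
    refine devVec_injOn h0 hπ hu (c := ‖devVec u τ (g a)‖ * ‖devVec u τ (g b)‖⁻¹) ?_ ?_
    · have := hpos (g a)
      have := hpos (g b)
      positivity
    · rw [mul_smul, ← coe_sphereDir (hne (g b))]
      change _ = _ • (dev u τ (g b) : E3)
      rw [← hab']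
      exact hdev _
  · apply Subset.antisymm
    · rintro _ ⟨a, rfl⟩
      refine ⟨?_, (secle _).2 (devHoriz_sector h0 hπ (hK a)).1⟩
      have h1 := hin (g a)
      have h2 : 0 ≤ (u : E3) 0 * (1 - (g a).im) := mul_nonneg hu.le (by linarith [(hK a).2])
      rw [← h1] at h2
      exact nonneg_of_mul_nonneg_right h2 (hpos _)
    · intro w hw
      obtain ⟨z, hz, c, hc, e⟩ := exists_devVec_eq h0 hπ hu hw
      rw [← hg.range_eq] at hz
      obtain ⟨a, rfl⟩ := hz
      refine ⟨a, ?_⟩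
      simp only [dev]
      rw [e, sphereDir_smul hc]
  · intro a
    rw [IsRegionBoundary, in0, bd, hg.boundary, or_comm]
  · simp only [hg.vertex_zero]
    have e : devVec u τ 0 = (1 : ℝ) • (stdPole : E3) := by
      ext i
      fin_cases i <;> simp [devVec, devHoriz, framePole]
    rw [dev, e, sphereDir_smul one_pos]
  · intro a
    rw [in0, bd]
    constructor
    · rintro ⟨h1, h2⟩
      rw [h1] at h2
      rcases (abs_eq zero_le_one).1 h2 with h3 | h3
      · right
        exact hg.inj ((Complex.ext h3 h1).trans hg.vertex_two.symm)
      · left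
        exact hg.inj ((Complex.ext h3 h1).trans hg.vertex_one.symm)
    · rintro (rfl | rfl)
      · rw [hg.vertex_one]; simp
      · rw [hg.vertex_two]; simp
  · have := him (g (x 1))
    simp only [hg.vertex_one] at this ⊢
    by_contra hcon
    push Not at hcon
    have := mul_nonneg (hpos ⟨-1, 1⟩).le hcon
    linarith
  · have := him (g (x 2))
    simp only [hg.vertex_two] at this ⊢
    by_contra hcon
    push Not at hcon
    have := mul_nonpos_of_nonneg_of_nonpos (hpos ⟨1, 1⟩).le hcon
    linarith

/-! ### Angles under nearly isometric linear maps -/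

open InnerProductGeometry in
-- By the law of cosines the two sides differ by (‖a‖ - ‖b‖)².
theorem norm_mul_norm_mul_sin_sq_le (a b : E3) :
    ‖a‖ * ‖b‖ * (2 * Real.sin (angle a b / 2)) ^ 2 ≤ ‖a - b‖ ^ 2 := by
  have h1 : ‖a - b‖ ^ 2 = ‖a‖ ^ 2 - 2 * inner ℝ a b + ‖b‖ ^ 2 := norm_sub_sq_real a b
  have h2 : inner ℝ a b = ‖a‖ * ‖b‖ * Real.cos (angle a b) := by
    rw [mul_comm, cos_angle_mul_norm_mul_norm]
  have h3 : Real.cos (angle a b) = 1 - 2 * Real.sin (angle a b / 2) ^ 2 := by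
    have : angle a b = 2 * (angle a b / 2) := by ring
    rw [this, Real.cos_two_mul, Real.cos_sq']
    ring_nf
  rw [h1, h2, h3]
  nlinarith [sq_nonneg (‖a‖ - ‖b‖)]

theorem le_mul_sin {t ε : ℝ} (h0 : 0 ≤ t) (hε1 : ε ≤ 1) (ht : t ^ 2 ≤ ε) :
    t ≤ (1 + ε) * Real.sin t := by
  rcases h0.eq_or_lt with h | h
  · simp [← h]
  · have hs := Real.sin_gt_sub_cube h
    have hε : 0 ≤ ε := (sq_nonneg t).trans ht
    have h2 : t - t * ε / 4 ≤ Real.sin t := by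
      have h4 : t ^ 3 ≤ t * ε := by nlinarith
      have h5 : 0 ≤ t * ε := by positivity
      linarith
    have h3 : t ≤ (1 + ε) * (t - t * ε / 4) := by
      have : 0 ≤ t * ε * (3 - ε) := by
        have : 0 ≤ 3 - ε := by linarith
        positivity
      nlinarith
    exact h3.trans (mul_le_mul_of_nonneg_left h2 (by linarith))

section Angle

open InnerProductGeometry

variable {A A' : E3 →ₗ[ℝ] E3} {δ ε : ℝ}

/-- For A v and A w of norm 1, angles are compared through chords: the chord of the A-images is at
most their angle, A' stretches it by at most 1 + δ, and the A'-images have norm at least 1 - δ. -/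
theorem two_mul_sin_half_angle_le (hδ0 : 0 ≤ δ) (hδ1 : δ < 1)
    (hA : ∀ v, v ≠ 0 → A v ≠ 0) (h : ∀ v, ‖A' v - A v‖ ≤ δ * ‖A v‖) {v w : E3} (hv : v ≠ 0)
    (hw : w ≠ 0) :
    (1 - δ) * (2 * Real.sin (angle (A' v) (A' w) / 2)) ≤ (1 + δ) * angle (A v) (A w) := by
  wlog hn : ‖A v‖ = 1 ∧ ‖A w‖ = 1 generalizing v w
  · have pv : 0 < ‖A v‖⁻¹ := inv_pos.2 (norm_pos_iff.2 (hA v hv))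
    have pw : 0 < ‖A w‖⁻¹ := inv_pos.2 (norm_pos_iff.2 (hA w hw))
    have := this (smul_ne_zero pv.ne' hv) (smul_ne_zero pw.ne' hw)
      ⟨by rw [map_smul, norm_smul, norm_inv, norm_norm, inv_mul_cancel₀ (norm_ne_zero_iff.2 (hA v hv))],
        by rw [map_smul, norm_smul, norm_inv, norm_norm,
          inv_mul_cancel₀ (norm_ne_zero_iff.2 (hA w hw))]⟩
    simpa only [map_smul, angle_smul_left_of_pos _ _ pv, angle_smul_right_of_pos _ _ pw] using this
  obtain ⟨hn1, hn2⟩ := hn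
  have low : ∀ v, ‖A v‖ = 1 → 1 - δ ≤ ‖A' v‖ := by
    intro v hv
    have h1 := h v
    have h2 := norm_sub_norm_le (A v) (A' v)
    rw [norm_sub_rev] at h2
    rw [hv] at h1 h2
    linarith
  have up : ‖A' v - A' w‖ ≤ (1 + δ) * ‖A v - A w‖ := by
    have h1 := h (v - w)
    rw [map_sub, map_sub] at h1
    have h2 := norm_add_le (A' v - A' w - (A v - A w)) (A v - A w)
    rw [sub_add_cancel] at h2
    linarith
  have chord : ‖A v - A w‖ ≤ angle (A v) (A w) := by
    have h1 : ‖A v - A w‖ ^ 2 ≤ angle (A v) (A w) ^ 2 := by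
      have e : ‖A v - A w‖ ^ 2 = ‖A v‖ ^ 2 - 2 * inner ℝ (A v) (A w) + ‖A w‖ ^ 2 :=
        norm_sub_sq_real _ _
      have h2 : inner ℝ (A v) (A w) = Real.cos (angle (A v) (A w)) := by
        rw [← cos_angle_mul_norm_mul_norm, hn1, hn2]
        ring
      rw [e, hn1, hn2, h2]
      have := Real.one_sub_sq_div_two_le_cos (x := angle (A v) (A w))
      linarith
    exact (sq_le_sq₀ (norm_nonneg _) (angle_nonneg _ _)).1 h1
  have hs : 0 ≤ Real.sin (angle (A' v) (A' w) / 2) :=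
    Real.sin_nonneg_of_nonneg_of_le_pi (by linarith [angle_nonneg (A' v) (A' w)])
      (by linarith [angle_le_pi (A' v) (A' w), Real.pi_pos])
  have main := norm_mul_norm_mul_sin_sq_le (A' v) (A' w)
  have l1 := low v hn1
  have l2 := low w hn2
  have d0 : 0 ≤ 1 - δ := by linarith
  have h3 : ((1 - δ) * (2 * Real.sin (angle (A' v) (A' w) / 2))) ^ 2 ≤ ‖A' v - A' w‖ ^ 2 := by
    refine le_trans ?_ main
    rw [mul_pow, sq (1 - δ)]
    gcongr
  have h4 := (sq_le_sq₀ (by positivity) (norm_nonneg _)).1 h3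
  calc _ ≤ _ := h4
    _ ≤ _ := up
    _ ≤ _ := mul_le_mul_of_nonneg_left chord (by linarith)

/-- A Lipschitz bound for small angles propagates to all angles. After normalizing the A-images, A
(v + w) bisects their angle, and the bounds on the two halves add up; a straight angle is bounded
trivially since M ≥ 1. -/
theorem angle_halving {M r : ℝ} (hM : 1 ≤ M) (hA : ∀ v, v ≠ 0 → A v ≠ 0)
    (h : ∀ v w, v ≠ 0 → w ≠ 0 → angle (A v) (A w) ≤ r →
      angle (A' v) (A' w) ≤ M * angle (A v) (A w)) (n : ℕ) :
    ∀ v w, v ≠ 0 → w ≠ 0 → angle (A v) (A w) ≤ 2 ^ n * r →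
      angle (A' v) (A' w) ≤ M * angle (A v) (A w) := by
  induction n with
  | zero => simpa using h
  | succ n ih =>
    intro v w hv hw hle
    by_cases hπ : angle (A v) (A w) = Real.pi
    · rw [hπ]
      exact (angle_le_pi _ _).trans (by nlinarith [Real.pi_pos])
    wlog hn : ‖A v‖ = 1 ∧ ‖A w‖ = 1 generalizing v w
    · have pv : 0 < ‖A v‖⁻¹ := inv_pos.2 (norm_pos_iff.2 (hA v hv))
      have pw : 0 < ‖A w‖⁻¹ := inv_pos.2 (norm_pos_iff.2 (hA w hw))
      have := this (‖A v‖⁻¹ • v) (‖A w‖⁻¹ • w) (smul_ne_zero pv.ne' hv) (smul_ne_zero pw.ne' hw)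
        (by simpa only [map_smul, angle_smul_left_of_pos _ _ pv, angle_smul_right_of_pos _ _ pw]
          using hle)
        (by simpa only [map_smul, angle_smul_left_of_pos _ _ pv, angle_smul_right_of_pos _ _ pw]
          using hπ)
        ⟨by rw [map_smul, norm_smul, norm_inv, norm_norm,
            inv_mul_cancel₀ (norm_ne_zero_iff.2 (hA v hv))],
          by rw [map_smul, norm_smul, norm_inv, norm_norm,
            inv_mul_cancel₀ (norm_ne_zero_iff.2 (hA w hw))]⟩
      simpa only [map_smul, angle_smul_left_of_pos _ _ pv, angle_smul_right_of_pos _ _ pw] using this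
    obtain ⟨hn1, hn2⟩ := hn
    have hm : v + w ≠ 0 := by
      intro h0
      apply hπ
      have : w = -v := (neg_eq_of_add_eq_zero_right h0).symm
      rw [this, map_neg]
      exact angle_self_neg_of_nonzero (hA v hv)
    have hsum : angle (A v) (A w) = angle (A v) (A (v + w)) + angle (A (v + w)) (A w) := by
      refine angle_eq_angle_add_add_angle_add_of_mem_span (hA _ hm) ?_
      rw [map_add]
      exact add_mem (Submodule.subset_span (by simp)) (Submodule.subset_span (by simp))
    have heq : angle (A v) (A (v + w)) = angle (A (v + w)) (A w) := by
      rw [angle_comm (A (v + w))]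
      simp only [angle, map_add, inner_add_right, real_inner_self_eq_norm_sq, hn1, hn2,
        real_inner_comm (A v) (A w)]
      ring_nf
    have b1 : angle (A v) (A (v + w)) ≤ 2 ^ n * r := by
      rw [pow_succ] at hle
      linarith
    have t := angle_le_angle_add_angle (A' v) (A' (v + w)) (A' w)
    have i1 := ih v (v + w) hv hm b1
    have i2 := ih (v + w) w hm hw (heq ▸ b1)
    rw [hsum, mul_add]
    linarith

/-- A linear map that is close to another one relative to its size changes angles by a factor
close to one. -/
theorem angle_le_of_near (hε : 0 < ε) (hε1 : ε ≤ 1) (hA : ∀ v, v ≠ 0 → A v ≠ 0)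
    (h : ∀ v, ‖A' v - A v‖ ≤ ε / 8 * ‖A v‖) {v w : E3} (hv : v ≠ 0) (hw : w ≠ 0) :
    angle (A' v) (A' w) ≤ (1 + ε) * angle (A v) (A w) := by
  have hπ := Real.pi_pos
  -- The chord estimate with the bound ω'/4 ≤ sin (ω'/2) gives ω' ≤ 8ω. For ω ≤ ε/16 the half-angle
  -- ω'/2 is thus at most ε/4, small enough to replace its sine by itself up to the factor 1 + ε/4.
  set r := ε / 16 with hr
  have small : ∀ v w, v ≠ 0 → w ≠ 0 → angle (A v) (A w) ≤ r →
      angle (A' v) (A' w) ≤ (1 + ε) * angle (A v) (A w) := by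
    intro v w hv hw hle
    have key := two_mul_sin_half_angle_le (δ := ε / 8) (by positivity) (by linarith) hA h hv hw
    set ω := angle (A v) (A w)
    set ω' := angle (A' v) (A' w)
    have w0 : 0 ≤ ω := angle_nonneg _ _
    have w0' : 0 ≤ ω' := angle_nonneg _ _
    have w1' : ω' ≤ Real.pi := angle_le_pi _ _
    have hj := Real.mul_le_sin (x := ω' / 2) (by linarith) (by linarith)
    have e : 2 / Real.pi * (ω' / 2) = ω' / Real.pi := by field_simp
    rw [e] at hj
    have hj2 : ω' / 4 ≤ Real.sin (ω' / 2) :=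
      le_trans (div_le_div_of_nonneg_left w0' hπ Real.pi_le_four) hj
    have hs0 : 0 ≤ Real.sin (ω' / 2) := le_trans (by positivity) hj2
    have k1 : Real.sin (ω' / 2) ≤ 2 * ω := by nlinarith
    have k2 : ω' / 2 ≤ ε / 4 := by linarith
    have k3 := le_mul_sin (t := ω' / 2) (ε := ε / 4) (by linarith) (by linarith)
      (by nlinarith)
    have pos : 0 < 1 - ε / 8 := by linarith
    have c1 : (1 - ε / 8) * ω' ≤ (1 + ε / 4) * ((1 - ε / 8) * (2 * Real.sin (ω' / 2))) := by
      nlinarith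
    have c2 : (1 + ε / 4) * ((1 - ε / 8) * (2 * Real.sin (ω' / 2))) ≤
        (1 + ε / 4) * ((1 + ε / 8) * ω) := mul_le_mul_of_nonneg_left key (by linarith)
    have c3 : (1 + ε / 4) * ((1 + ε / 8) * ω) ≤ (1 - ε / 8) * ((1 + ε) * ω) := by
      have : 0 ≤ ε * ω * (16 - 5 * ε) := by
        have : 0 ≤ 16 - 5 * ε := by linarith
        positivity
      nlinarith
    exact le_of_mul_le_mul_left (c1.trans (c2.trans c3)) pos
  obtain ⟨n, hn⟩ := pow_unbounded_of_one_lt (Real.pi / r) one_lt_two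
  refine angle_halving (by linarith) hA small n v w hv hw ?_
  refine (angle_le_pi _ _).trans ?_
  rw [div_lt_iff₀ (by positivity)] at hn
  exact hn.le

end Angle

/-! ### Continuity of the family of developing maps -/

/-- The linear map underlying the developing map on the half of the model triangle where the first
coordinate has the sign `e`. -/
def devLin (P : ℝ × ℝ × ℝ × ℝ) (e : ℝ) : E3 →ₗ[ℝ] E3 where
  toFun v := !₂[v 0 - (P.1 * (v 2 - e * v 1 * (1 - P.2.2.1)) + P.2.1 * (v 1 * P.2.2.2)),
    v 2 - e * v 1 * (1 - P.2.2.1), v 1 * P.2.2.2]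
  map_add' v w := by
    ext i
    fin_cases i <;> simp <;> ring
  map_smul' c v := by
    ext i
    fin_cases i <;> simp <;> ring

/-- The coefficients of the developing map. -/
def devParam (u : E3) (τ : ℝ) : ℝ × ℝ × ℝ × ℝ :=
  (u 1 / u 0, u 2 / u 0, Real.cos τ, Real.sin τ)

/-- Barycentric coordinates on the model triangle. -/
def modelCoord (z : ℂ) : E3 := !₂[1 - z.im, z.re, z.im]

theorem modelCoord_ne_zero (z : ℂ) : modelCoord z ≠ 0 := by
  intro h
  have h0 := congrArg (fun v : E3 => v 0) h
  have h2 := congrArg (fun v : E3 => v 2) h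
  simp [modelCoord] at h0 h2
  linarith

theorem devVec_eq_devLin (u : E3) (τ : ℝ) {z : ℂ} {e : ℝ} (he : e * z.re = |z.re|) :
    devVec u τ z = devLin (devParam u τ) e (modelCoord z) := by
  ext i
  fin_cases i <;> simp [devVec, devHoriz, devLin, devParam, modelCoord, he] <;> ring

theorem devLin_ne_zero {P : ℝ × ℝ × ℝ × ℝ} (hP : P.2.2.2 ≠ 0) (e : ℝ) {v : E3} (hv : v ≠ 0) :
    devLin P e v ≠ 0 := by
  intro h
  apply hv
  have h0 := congrArg (fun v : E3 => v 0) h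
  have h1 := congrArg (fun v : E3 => v 1) h
  have h2 := congrArg (fun v : E3 => v 2) h
  simp [devLin, hP] at h0 h1 h2
  rw [h2] at h0 h1
  simp at h0 h1
  rw [h1] at h0
  simp at h0
  ext i
  fin_cases i <;> simp [h0, h1, h2]

/-- For sin τ ≠ 0 the linear map is injective, hence bounded below, so closeness in operator norm
becomes closeness relative to the size of the image. -/
theorem eventually_devLin_near {P : ℝ × ℝ × ℝ × ℝ} (hP : P.2.2.2 ≠ 0) (e : ℝ) {δ : ℝ}
    (hδ : 0 < δ) :
    ∀ᶠ Q in 𝓝 P, ∀ v, ‖devLin Q e v - devLin P e v‖ ≤ δ * ‖devLin P e v‖ ∧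
      ‖devLin P e v - devLin Q e v‖ ≤ δ * ‖devLin Q e v‖ := by
  obtain ⟨K, hK, hanti⟩ := (devLin P e).exists_antilipschitzWith (by
    rw [LinearMap.ker_eq_bot']
    intro v hv
    by_contra hne
    exact devLin_ne_zero hP e hne hv)
  have hK' : ∀ v, ‖v‖ ≤ K * ‖devLin P e v‖ := fun v => by
    simpa [dist_eq_norm] using hanti.le_mul_dist v 0
  have hc : Continuous fun Q => LinearMap.toContinuousLinearMap (devLin Q e) := by
    rw [continuous_clm_apply]
    intro v
    simp only [LinearMap.coe_toContinuousLinearMap', devLin, LinearMap.coe_mk, AddHom.coe_mk]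
    refine (PiLp.continuous_toLp 2 _).comp (continuous_pi fun i => ?_)
    fin_cases i <;> simp <;> fun_prop
  have hKp : (0 : ℝ) < K := by exact_mod_cast hK
  -- The bound 1/2 makes the images under P at most twice those under Q, and the bound δ/2 absorbs
  -- this factor in the reversed inequality.
  set η := min (δ / 2) (1 / 2) / K with hη
  have hη0 : 0 < η := by positivity
  filter_upwards [Metric.tendsto_nhds.1 hc.continuousAt η hη0] with Q hQ v
  have h1 : ‖devLin Q e v - devLin P e v‖ ≤ η * ‖v‖ := by
    have := (LinearMap.toContinuousLinearMap (devLin Q e) -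
      LinearMap.toContinuousLinearMap (devLin P e)).le_opNorm v
    rw [dist_eq_norm] at hQ
    refine this.trans ?_
    gcongr
  have h2 : η * ‖v‖ ≤ min (δ / 2) (1 / 2) * ‖devLin P e v‖ := by
    calc η * ‖v‖ ≤ η * (K * ‖devLin P e v‖) := mul_le_mul_of_nonneg_left (hK' v) hη0.le
      _ = _ := by rw [hη]; field_simp
  have h3 := h1.trans h2
  have n0 := norm_nonneg (devLin P e v)
  have m1 : min (δ / 2) (1 / 2) * ‖devLin P e v‖ ≤ δ / 2 * ‖devLin P e v‖ :=
    mul_le_mul_of_nonneg_right (min_le_left _ _) n0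
  have m2 : min (δ / 2) (1 / 2) * ‖devLin P e v‖ ≤ 1 / 2 * ‖devLin P e v‖ :=
    mul_le_mul_of_nonneg_right (min_le_right _ _) n0
  have h4 := norm_sub_norm_le (devLin P e v) (devLin Q e v)
  rw [norm_sub_rev] at h4
  refine ⟨h3.trans (m1.trans (by nlinarith)), ?_⟩
  rw [norm_sub_rev]
  have h5 : ‖devLin P e v‖ ≤ 2 * ‖devLin Q e v‖ := by linarith
  calc _ ≤ δ / 2 * ‖devLin P e v‖ := h3.trans m1
    _ ≤ δ / 2 * (2 * ‖devLin Q e v‖) := mul_le_mul_of_nonneg_left h5 (by positivity)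
    _ = _ := by ring

/-! ### Comparison of two triangles -/

section Compare

variable {g : Disc → ℂ} {x : Fin 3 → Disc} (hg : IsModelChart g x) {u : Sphere2} {τ : ℝ}
  (hu : 0 < (u : E3) 0) (h0 : 0 < τ) (hπ : τ < Real.pi)

theorem IsModelChart.mem (hg : IsModelChart g x) (a : Disc) : g a ∈ modelTriangle :=
  hg.range_eq ▸ mem_range_self a

include hu h0 hπ

theorem horiz_dev (z : ℂ) :
    horiz stdFrame (dev u τ z : E3) = ((‖devVec u τ z‖⁻¹ : ℝ) : ℂ) * devHoriz τ z := by
  rw [dev, coe_sphereDir (devVec_ne_zero h0 hπ hu z), horiz_smul, horiz_devVec]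

theorem arg_horiz_dev (z : ℂ) : (horiz stdFrame (dev u τ z : E3)).arg = (devHoriz τ z).arg := by
  rw [horiz_dev hu h0 hπ, Complex.arg_real_mul]
  exact inv_pos.2 (norm_pos_iff.2 (devVec_ne_zero h0 hπ hu z))

omit hu in
theorem arg_devHoriz_nonneg {z : ℂ} (h : 0 ≤ z.re) : 0 ≤ (devHoriz τ z).arg := by
  rw [Complex.arg_nonneg_iff]
  exact mul_nonneg h (Real.sin_pos_of_pos_of_lt_pi h0 hπ).le

omit hu in
theorem arg_devHoriz_nonpos {z : ℂ} (hz : z ∈ modelTriangle) (h : z.re ≤ 0) :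
    (devHoriz τ z).arg ≤ 0 := by
  have hs := Real.sin_pos_of_pos_of_lt_pi h0 hπ
  rcases h.eq_or_lt with h1 | h1
  · have e : devHoriz τ z = ((z.im : ℝ) : ℂ) := by
      apply Complex.ext <;> simp [devHoriz, h1]
    rw [e, Complex.arg_ofReal_of_nonneg ((abs_nonneg _).trans hz.1)]
  · exact (Complex.arg_neg_iff.2 (mul_neg_of_neg_of_pos h1 hs)).le

omit hu in
theorem abs_arg_devHoriz_le {z : ℂ} (hz : z ∈ modelTriangle) : |(devHoriz τ z).arg| ≤ τ :=
  abs_arg_le_of_mem h0 (devHoriz_sector h0 hπ hz).1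

/-- On each half of the triangle the distance is the angle of the linear model. -/
theorem coneDist_dev_of_same_half {z w : ℂ} (hz : z ∈ modelTriangle) (hw : w ∈ modelTriangle)
    {e : ℝ} (he : e = 1 ∨ e = -1) (h1 : e * z.re = |z.re|) (h2 : e * w.re = |w.re|) :
    coneDist (dev u τ z) (dev u τ w) =
      InnerProductGeometry.angle (devLin (devParam u τ) e (modelCoord z))
        (devLin (devParam u τ) e (modelCoord w)) := by
  rw [← devVec_eq_devLin _ _ h1, ← devVec_eq_devLin _ _ h2, coneDist, if_pos]
  · rw [dev, dev, sphereDir_of_ne (devVec_ne_zero h0 hπ hu z),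
      sphereDir_of_ne (devVec_ne_zero h0 hπ hu w), sphDist_toSphere]
  · rw [arg_horiz_dev hu h0 hπ, arg_horiz_dev hu h0 hπ]
    have az := abs_le.1 (abs_arg_devHoriz_le h0 hπ hz)
    have aw := abs_le.1 (abs_arg_devHoriz_le h0 hπ hw)
    rw [abs_lt]
    rcases he with rfl | rfl
    · have p1 := arg_devHoriz_nonneg h0 hπ (z := z) (by linarith [abs_nonneg z.re])
      have p2 := arg_devHoriz_nonneg h0 hπ (z := w) (by linarith [abs_nonneg w.re])
      constructor <;> linarith
    · have p1 := arg_devHoriz_nonpos h0 hπ hz (by linarith [abs_nonneg z.re])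
      have p2 := arg_devHoriz_nonpos h0 hπ hw (by linarith [abs_nonneg w.re])
      constructor <;> linarith

include hg in
/-- A shortest path between the two halves of the triangle crosses the middle ray. -/
theorem exists_coneDist_split {a b : Disc} (ha : (g a).re ≤ 0) (hb : 0 ≤ (g b).re) :
    ∃ c, (g c).re = 0 ∧ coneDist (dev u τ (g a)) (dev u τ (g b)) =
      coneDist (dev u τ (g a)) (dev u τ (g c)) + coneDist (dev u τ (g c)) (dev u τ (g b)) := by
  have hf := hg.isRegionChart hu h0 hπ
  have hs := Real.sin_pos_of_pos_of_lt_pi h0 hπ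
  have pa := arg_devHoriz_nonpos h0 hπ (hg.mem a) ha
  have pb := arg_devHoriz_nonneg h0 hπ hb
  have la := abs_le.1 (abs_arg_devHoriz_le h0 hπ (hg.mem a))
  have lb := abs_le.1 (abs_arg_devHoriz_le h0 hπ (hg.mem b))
  have ea := arg_horiz_dev hu h0 hπ (g a)
  have eb := arg_horiz_dev hu h0 hπ (g b)
  by_cases hlt : |(horiz stdFrame (dev u τ (g a) : E3)).arg -
      (horiz stdFrame (dev u τ (g b) : E3)).arg| < Real.pi
  · have hlt' := hlt
    rw [ea, eb, abs_lt] at hlt'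
    obtain ⟨z, ⟨c, l, k, hc, hl, hk, hz⟩, s, hs0, hzs⟩ := exists_arc_crosses_ray stdFrame (ψ := 0)
      (Real.sin_nonneg_of_nonneg_of_le_pi (polarDist_nonneg stdFrame _) (polarDist_le_pi _ _))
      (Real.sin_nonneg_of_nonneg_of_le_pi (polarDist_nonneg stdFrame _) (polarDist_le_pi _ _))
      (horiz_eq_exp_arg stdFrame (dev u τ (g a))) (horiz_eq_exp_arg stdFrame (dev u τ (g b)))
      (by rw [ea]; exact pa) (by rw [eb]; exact pb) (by rw [ea, eb]; linarith)
    have hmem := mem_region_of_combination h0 hπ (hf.mem_region a) (hf.mem_region b) hlt hc hl hk hz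
    obtain ⟨y, hy⟩ := hf.exists_eq hmem
    have hz0 : horiz stdFrame (z : E3) = (s : ℂ) := by rw [hzs]; simp
    have argz : (horiz stdFrame (z : E3)).arg = 0 := by
      rw [hz0, Complex.arg_ofReal_of_nonneg hs0]
    refine ⟨y, ?_, ?_⟩
    · rw [← hy, horiz_dev hu h0 hπ] at hz0
      have him := congrArg Complex.im hz0
      rw [Complex.im_ofReal_mul, Complex.ofReal_im] at him
      have hn : ‖devVec (u : E3) τ (g y)‖⁻¹ ≠ 0 :=
        inv_ne_zero (norm_ne_zero_iff.2 (devVec_ne_zero h0 hπ hu _))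
      have := (mul_eq_zero.1 him).resolve_left hn
      exact (mul_eq_zero.1 this).resolve_right hs.ne'
    · rw [hy]
      have e1 : coneDist (dev u τ (g a)) z = sphDist (dev u τ (g a)) z := if_pos (by
        rw [argz, ea, abs_lt]
        constructor <;> linarith)
      have e2 : coneDist z (dev u τ (g b)) = sphDist z (dev u τ (g b)) := if_pos (by
        rw [argz, eb, abs_lt]
        constructor <;> linarith)
      have e3 : coneDist (dev u τ (g a)) (dev u τ (g b)) =
          sphDist (dev u τ (g a)) (dev u τ (g b)) := if_pos hlt
      rw [e1, e2, e3]
      exact sphDist_eq_add_of_combination hc hl hk hz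
  -- For directions differing by at least π the path runs through the apex, which lies on the middle
  -- line.
  · have hap : dev u τ (g (x 0)) = stdPole := hf.apex
    refine ⟨x 0, by rw [hg.vertex_zero]; rfl, ?_⟩
    have e3 : coneDist (dev u τ (g a)) (dev u τ (g b)) =
      polarDist stdFrame (dev u τ (g a)) + polarDist stdFrame (dev u τ (g b)) := if_neg hlt
    rw [hap, e3, coneDist_comm _ stdPole, coneDist_stdPole h0 hπ (hf.mem_region a),
      coneDist_stdPole h0 hπ (hf.mem_region b)]

include hg in
-- Within a half this is the angle estimate for nearby linear maps. Across the halves, a geodesic of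
-- the first metric is cut at the middle line and the triangle inequality is used for the second.
theorem coneDist_dev_le {u' : Sphere2} {τ' : ℝ} (hu' : 0 < (u' : E3) 0) (h0' : 0 < τ')
    (hπ' : τ' < Real.pi) {ε : ℝ} (hε : 0 < ε) (hε1 : ε ≤ 1)
    (h : ∀ e : ℝ, e = 1 ∨ e = -1 → ∀ v, ‖devLin (devParam u' τ') e v - devLin (devParam u τ) e v‖
      ≤ ε / 8 * ‖devLin (devParam u τ) e v‖) (a b : Disc) :
    coneDist (dev u' τ' (g a)) (dev u' τ' (g b)) ≤
      (1 + ε) * coneDist (dev u τ (g a)) (dev u τ (g b)) := by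
  have hs := Real.sin_pos_of_pos_of_lt_pi h0 hπ
  have same : ∀ a b : Disc, ∀ e : ℝ, (e = 1 ∨ e = -1) → e * (g a).re = |(g a).re| →
      e * (g b).re = |(g b).re| → coneDist (dev u' τ' (g a)) (dev u' τ' (g b)) ≤
        (1 + ε) * coneDist (dev u τ (g a)) (dev u τ (g b)) := by
    intro a b e he h1 h2
    rw [coneDist_dev_of_same_half hu h0 hπ (hg.mem a) (hg.mem b) he h1 h2,
      coneDist_dev_of_same_half hu' h0' hπ' (hg.mem a) (hg.mem b) he h1 h2]
    exact angle_le_of_near hε hε1 (fun v hv => devLin_ne_zero hs.ne' e hv) (h e he)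
      (modelCoord_ne_zero _) (modelCoord_ne_zero _)
  have opp : ∀ a b : Disc, (g a).re ≤ 0 → 0 ≤ (g b).re →
      coneDist (dev u' τ' (g a)) (dev u' τ' (g b)) ≤
        (1 + ε) * coneDist (dev u τ (g a)) (dev u τ (g b)) := by
    intro a b ha hb
    obtain ⟨c, hc, e⟩ := exists_coneDist_split hg hu h0 hπ ha hb
    have s1 := same a c (-1) (Or.inr rfl) (by rw [abs_of_nonpos ha]; ring) (by rw [hc]; simp)
    have s2 := same c b 1 (Or.inl rfl) (by rw [hc]; simp) (by rw [abs_of_nonneg hb]; ring)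
    have t := ((hg.isRegionChart hu' h0' hπ').isGeodesicMetric (by rw [inner_stdPole]; exact hu')
      h0' hπ').triangle a c b
    rw [e, mul_add]
    linarith
  rcases le_total (g a).re 0 with ha | ha <;> rcases le_total (g b).re 0 with hb | hb
  · exact same a b (-1) (Or.inr rfl) (by rw [abs_of_nonpos ha]; ring)
      (by rw [abs_of_nonpos hb]; ring)
  · exact opp a b ha hb
  · rw [coneDist_comm, coneDist_comm (dev u τ (g a))]
    exact opp b a hb ha
  · exact same a b 1 (Or.inl rfl) (by rw [abs_of_nonneg ha]; ring)
      (by rw [abs_of_nonneg hb]; ring)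

end Compare

/-- Developing maps that depend continuously on parameters give a continuous family of metrics. -/
theorem IsModelChart.isContinuousMetricFamily {g : Disc → ℂ} {x : Fin 3 → Disc}
    (hg : IsModelChart g x) {N : Set (Fin 3 → ℝ)} {u : (Fin 3 → ℝ) → Sphere2}
    {τ : (Fin 3 → ℝ) → ℝ} (hu : ∀ ν ∈ N, 0 < (u ν : E3) 0) (h0 : ∀ ν ∈ N, 0 < τ ν)
    (hπ : ∀ ν ∈ N, τ ν < Real.pi)
    (hc : ∀ ν ∈ N, ContinuousAt (fun μ => devParam (u μ) (τ μ)) ν) :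
    IsContinuousMetricFamily N
      fun ν a b => coneDist (dev (u ν) (τ ν) (g a)) (dev (u ν) (τ ν) (g b)) := by
  intro ν hν ε hε
  set ε' := min ε 1 with hε'
  have e0 : 0 < ε' := by positivity
  have e1 : ε' ≤ 1 := min_le_right _ _
  have hs := Real.sin_pos_of_pos_of_lt_pi (h0 ν hν) (hπ ν hν)
  have near : ∀ e : ℝ, ∀ᶠ μ in 𝓝[N] ν, _ := fun e =>
    ((hc ν hν).mono_left nhdsWithin_le_nhds).eventually
      (eventually_devLin_near (P := devParam (u ν) (τ ν)) hs.ne' e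
        (by positivity : 0 < ε' / 8))
  filter_upwards [near 1, near (-1), self_mem_nhdsWithin] with μ h1 h2 hμ a b
  have hnn : ∀ κ ∈ N, 0 ≤ coneDist (dev (u κ) (τ κ) (g a)) (dev (u κ) (τ κ) (g b)) :=
    fun κ _ => (sphDist_nonneg _ _).trans (sphDist_le_coneDist _ _)
  have le : ∀ t : ℝ, 0 ≤ t → (1 + ε') * t ≤ (1 + ε) * t := fun t ht =>
    mul_le_mul_of_nonneg_right (by linarith [min_le_left ε 1]) ht
  constructor
  · refine (coneDist_dev_le hg (hu ν hν) (h0 ν hν) (hπ ν hν) (hu μ hμ) (h0 μ hμ) (hπ μ hμ) e0 e1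
      ?_ a b).trans (le _ (hnn ν hν))
    rintro e (rfl | rfl) v
    · exact (h1 v).1
    · exact (h2 v).1
  · refine (coneDist_dev_le hg (hu μ hμ) (h0 μ hμ) (hπ μ hμ) (hu ν hν) (h0 ν hν) (hπ ν hν) e0 e1
      ?_ a b).trans (le _ (hnn μ hμ))
    rintro e (rfl | rfl) v
    · exact (h1 v).2
    · exact (h2 v).2

/-! ### Reflections and the holonomy of the double -/

/-- The reflection of the sphere in the great circle with pole `n`. -/
def reflect (n w : Sphere2) : Sphere2 :=
  ⟨(w : E3) - (2 * inner ℝ (n : E3) (w : E3)) • (n : E3), by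
    rw [mem_sphere_zero_iff_norm, ← sq_eq_sq₀ (norm_nonneg _) zero_le_one,
      ← real_inner_self_eq_norm_sq]
    simp only [inner_sub_left, inner_sub_right, real_inner_smul_left, real_inner_smul_right,
      n.inner_self, w.inner_self, real_inner_comm (n : E3) (w : E3)]
    ring⟩

theorem coe_reflect (n w : Sphere2) :
    (reflect n w : E3) = (w : E3) - (2 * inner ℝ (n : E3) (w : E3)) • (n : E3) := rfl

theorem inner_reflect_reflect (n v w : Sphere2) :
    inner ℝ (reflect n v : E3) (reflect n w : E3) = inner ℝ (v : E3) (w : E3) := by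
  simp only [coe_reflect, inner_sub_left, inner_sub_right, real_inner_smul_left,
    real_inner_smul_right, n.inner_self, real_inner_comm (n : E3) (v : E3)]
  ring

theorem sphDist_reflect (n v w : Sphere2) : sphDist (reflect n v) (reflect n w) = sphDist v w := by
  rw [sphDist_eq_arccos, sphDist_eq_arccos, inner_reflect_reflect]

theorem reflect_reflect (n w : Sphere2) : reflect n (reflect n w) = w := by
  apply Subtype.ext
  rw [coe_reflect, coe_reflect, inner_sub_right, real_inner_smul_right, n.inner_self, sub_sub,
    ← add_smul, sub_eq_self]
  ring_nf
  exact zero_smul _ _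

theorem continuous_reflect (n : Sphere2) : Continuous (reflect n) := by
  apply Continuous.subtype_mk
  fun_prop

theorem inner_reflect_orthogonal {n : Sphere2} {v : E3} (h : inner ℝ v (n : E3) = 0) (w : Sphere2) :
    inner ℝ v (reflect n w : E3) = inner ℝ v (w : E3) := by
  rw [coe_reflect, inner_sub_right, real_inner_smul_right, h, mul_zero, sub_zero]

theorem inner_self_reflect (n w : Sphere2) :
    inner ℝ (n : E3) (reflect n w : E3) = -inner ℝ (n : E3) (w : E3) := by
  rw [coe_reflect, inner_sub_right, real_inner_smul_right, n.inner_self]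
  ring

/-- The matrix of a reflection. -/
def reflectMatrix (n : Sphere2) : Matrix (Fin 3) (Fin 3) ℝ :=
  1 - (2 : ℝ) • Matrix.vecMulVec (WithLp.ofLp (n : E3)) (WithLp.ofLp (n : E3))

theorem matAct_reflectMatrix (n : Sphere2) (v : E3) :
    matAct (reflectMatrix n) v = v - (2 * inner ℝ (n : E3) v) • (n : E3) := by
  ext i
  simp only [matAct, reflectMatrix, Matrix.sub_mulVec, Matrix.one_mulVec, Matrix.smul_mulVec,
    Matrix.vecMulVec_mulVec, inner_E3]
  simp [dotProduct, Fin.sum_univ_three]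
  ring

theorem matAct_mul (A B : Matrix (Fin 3) (Fin 3) ℝ) (v : E3) :
    matAct (A * B) v = matAct A (matAct B v) := by
  simp [matAct, Matrix.mulVec_mulVec]

theorem Sphere2.sum_sq (n : Sphere2) : (n : E3) 0 ^ 2 + (n : E3) 1 ^ 2 + (n : E3) 2 ^ 2 = 1 := by
  have := n.inner_self
  rw [inner_E3] at this
  linarith

theorem reflectMatrix_mul_self (n : Sphere2) : reflectMatrix n * reflectMatrix n = 1 := by
  have h := n.sum_sq
  have e : (WithLp.ofLp (n : E3)) ⬝ᵥ (WithLp.ofLp (n : E3)) = 1 := by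
    simp only [dotProduct, Fin.sum_univ_three]
    linarith
  rw [reflectMatrix, sub_mul, mul_sub, mul_sub, one_mul, mul_one, smul_mul_smul_comm,
    Matrix.vecMulVec_mul_vecMulVec, e, one_smul]
  rw [one_mul, sub_sub, ← sub_sub, sub_sub, sub_eq_self]
  module

theorem reflectMatrix_transpose (n : Sphere2) : (reflectMatrix n).transpose = reflectMatrix n := by
  simp [reflectMatrix, Matrix.transpose_vecMulVec]

theorem det_reflectMatrix (n : Sphere2) : (reflectMatrix n).det = -1 := by
  have h := n.sum_sq
  rw [Matrix.det_fin_three]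
  simp only [reflectMatrix, Matrix.sub_apply, Matrix.smul_apply, Matrix.vecMulVec_apply,
    Matrix.one_apply, smul_eq_mul]
  simp
  linear_combination (-2) * h

/-- The product of two reflections. -/
def reflectProd (m n : Sphere2) : Matrix.specialOrthogonalGroup (Fin 3) ℝ :=
  ⟨reflectMatrix m * reflectMatrix n, by
    rw [Matrix.mem_specialOrthogonalGroup_iff, Matrix.mem_orthogonalGroup_iff, Matrix.det_mul,
      det_reflectMatrix, det_reflectMatrix]
    refine ⟨?_, by norm_num⟩
    rw [Matrix.transpose_mul, reflectMatrix_transpose, reflectMatrix_transpose, mul_assoc,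
      ← mul_assoc (reflectMatrix n), reflectMatrix_mul_self, one_mul, reflectMatrix_mul_self]⟩

theorem matAct_reflectProd (m n w : Sphere2) :
    matAct (reflectProd m n).1 (w : E3) = reflect m (reflect n w) := by
  rw [reflectProd, matAct_mul, matAct_reflectMatrix, matAct_reflectMatrix, coe_reflect, coe_reflect]

/-- A vector fixed by the product of two reflections in different planes lies in both planes. -/
theorem inner_eq_zero_of_matAct_reflectProd {m n : Sphere2} {v : E3}
    (hmn : LinearIndependent ℝ ![(m : E3), (n : E3)])
    (h : matAct (reflectProd m n).1 v = v) : inner ℝ (m : E3) v = 0 ∧ inner ℝ (n : E3) v = 0 := by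
  -- Reflections are involutions, so both move v by the same vector, which is a multiple of m as
  -- well as of n.
  have h2 : matAct (reflectMatrix n) v = matAct (reflectMatrix m) v := by
    have h3 := congrArg (matAct (reflectMatrix m)) h
    rw [reflectProd, matAct_mul, ← matAct_mul, reflectMatrix_mul_self] at h3
    simpa [matAct] using h3
  rw [matAct_reflectMatrix, matAct_reflectMatrix] at h2
  have h4 := LinearIndependent.pair_iff.1 hmn (2 * inner ℝ (m : E3) v) (-(2 * inner ℝ (n : E3) v))
    (by rw [neg_smul, ← sub_eq_add_neg]; rw [sub_right_inj] at h2; rw [h2, sub_self])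
  exact ⟨by linarith [h4.1], by linarith [h4.2]⟩

/-! ### Continuation across a side by reflection -/

section Unfold

open Classical in
/-- The map on the double given by `f` on the first sheet and its reflection on the second. -/
def unfold (f : Disc → Sphere2) (n : Sphere2) (q : DoubleDisc) : Sphere2 :=
  if q ∈ range (toDouble false) then f (foldDouble q) else reflect n (f (foldDouble q))

theorem unfold_false (f : Disc → Sphere2) (n : Sphere2) (a : Disc) :
    unfold f n (toDouble false a) = f a := by
  rw [unfold, if_pos (mem_range_self _), foldDouble_toDouble]

theorem unfold_true (f : Disc → Sphere2) (n : Sphere2) {a : Disc} (ha : a ∉ discBoundary) :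
    unfold f n (toDouble true a) = reflect n (f a) := by
  rw [unfold, if_neg, foldDouble_toDouble]
  rw [toDouble_mem_range]
  simp [ha]

variable {d : Disc → Disc → ℝ} (hd : IsGeodesicMetric d) {f : Disc → Sphere2}

include hd

theorem eventually_sheet {p : Disc} (hp : p ∉ discBoundary) (s : Bool) :
    ∀ᶠ q in 𝓝 (toDouble s p), ∃ b, b ∉ discBoundary ∧ q = toDouble s b := by
  obtain ⟨ε, hε, h⟩ := doubleDist_lt_mem_range hd hp s
  filter_upwards [(isGeodesicMetric_doubleDist hd).eventually_lt (toDouble s p) hε] with q hq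
  exact h q hq

theorem isLocalIsometryAt_of_sheet {p : Disc} (hp : p ∉ discBoundary) (s : Bool)
    (hf : IsLocalIsometryAt d f p) {G : DoubleDisc → Sphere2}
    (hG : ∀ a b, a ∉ discBoundary → b ∉ discBoundary →
      sphDist (G (toDouble s a)) (G (toDouble s b)) = sphDist (f a) (f b)) :
    IsLocalIsometryAt (doubleDist d) G (toDouble s p) := by
  obtain ⟨ε, hε, h⟩ := doubleDist_lt_mem_range hd hp s
  obtain ⟨r, hr, H⟩ := hf
  refine ⟨min ε r, by positivity, fun x y hx hy => ?_⟩
  obtain ⟨a, ha, rfl⟩ := h x (hx.trans_le (min_le_left _ _))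
  obtain ⟨b, hb, rfl⟩ := h y (hy.trans_le (min_le_left _ _))
  rw [doubleDist_same] at hx hy ⊢
  rw [hG a b ha hb, H a b (hx.trans_le (min_le_right _ _)) (hy.trans_le (min_le_right _ _))]

theorem isLocalIsometryAt_unfold {p : Disc} (hp : p ∉ discBoundary) (s : Bool)
    (hf : IsLocalIsometryAt d f p) (n : Sphere2) :
    IsLocalIsometryAt (doubleDist d) (unfold f n) (toDouble s p) := by
  refine isLocalIsometryAt_of_sheet hd hp s hf fun a b ha hb => ?_
  cases s
  · rw [unfold_false, unfold_false]
  · rw [unfold_true f n ha, unfold_true f n hb, sphDist_reflect]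

/-- In a half-disc chart, reflection in the side keeps the radius and negates the angle, just as the
angular coordinate of the double changes sign on the second sheet. The unfolded map thus carries
doubled polar coordinates to polar coordinates of the sphere. -/
theorem isLocalIsometryAt_unfold_edge {e : Disc} (he : e ∈ discBoundary)
    (hf : IsLocalIsometryAt d f e) {n : Sphere2} {b : OrthonormalBasis (Fin 3) ℝ E3} {r : ℝ}
    (hb0 : b 0 = f e) (hb2 : b 2 = n)
    (hc : IsSectorChart discBoundary d e Real.pi r (fun a => (horiz b (f a)).arg)) (s : Bool) :
    IsLocalIsometryAt (doubleDist d) (unfold f n) (toDouble s e) := by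
  obtain ⟨r', hr', H⟩ := hf
  have hr := hc.radius_pos
  have hpole : framePole b = f e := Subtype.ext hb0
  have hrefl : ∀ w, horiz b (reflect n w : E3) = (starRingEnd ℂ) (horiz b (w : E3)) := by
    intro w
    apply Complex.ext
    · simp only [horiz, Complex.conj_re]
      exact inner_reflect_orthogonal (by rw [← hb2, inner_frame]; simp) w
    · simp only [horiz, Complex.conj_im]
      rw [hb2, inner_self_reflect]
  have hpol : ∀ w, polarDist b (reflect n w) = polarDist b w := by
    intro w
    rw [polarDist, sphDist_eq_arccos, polarDist, sphDist_eq_arccos]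
    congr 1
    exact inner_reflect_orthogonal (v := b 0) (by rw [← hb2, inner_frame]; simp) w
  have key : ∀ q, d e (foldDouble q) < min (r / 3) r' →
      polarDist b (unfold f n q) = d e (foldDouble q) ∧ ∃ ψ : ℝ,
        doubleAngle Real.pi (fun a => (horiz b (f a)).arg) q = (ψ : AddCircle (2 * Real.pi)) ∧
        horiz b (unfold f n q) =
          Real.sin (polarDist b (unfold f n q)) * Complex.exp (ψ * Complex.I) := by
    intro q hq
    have h1 : polarDist b (f (foldDouble q)) = d e (foldDouble q) := by
      rw [polarDist, hpole]
      exact H e _ (by rw [hd.self]; exact hr') (hq.trans_le (min_le_right _ _))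
    by_cases hm : q ∈ range (toDouble false)
    · rw [unfold, if_pos hm]
      refine ⟨h1, _, by rw [doubleAngle, if_pos hm], horiz_eq_exp_arg _ _⟩
    · rw [unfold, if_neg hm]
      refine ⟨(hpol _).trans h1, -(horiz b (f (foldDouble q))).arg, ?_, ?_⟩
      · rw [doubleAngle, if_neg hm, AddCircle.coe_neg]
      · rw [hrefl, hpol]
        conv_lhs => rw [horiz_eq_exp_arg b (f (foldDouble q))]
        rw [map_mul, Complex.conj_ofReal, ← Complex.exp_conj, map_mul, Complex.conj_I,
          Complex.conj_ofReal]
        push_cast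
        ring_nf
  refine ⟨min (r / 3) r', by positivity, fun x y hx hy => ?_⟩
  rw [doubleDist_toDouble_left he] at hx hy
  obtain ⟨px, ψ, ax, hx1⟩ := key x hx
  obtain ⟨py, χ, ay, hy1⟩ := key y hy
  have hπ : ‖((ψ - χ : ℝ) : AddCircle (2 * Real.pi))‖ ≤ Real.pi := by
    have := AddCircle.norm_le_half_period (2 * Real.pi) (x := ((ψ - χ : ℝ) : AddCircle (2 * Real.pi)))
      (by positivity)
    rwa [abs_of_pos (by positivity), mul_div_cancel_left₀ _ two_ne_zero] at this
  have hsum : d e (foldDouble x) + d e (foldDouble y) ≤ Real.pi := by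
    linarith [hc.radius_le, hx.trans_le (min_le_left _ _), hy.trans_le (min_le_left _ _)]
  rw [sphDist_polar b hx1 hy1, doubleDist_eq_sphConeDist hd Real.pi_pos he hc
    (hx.trans_le (min_le_left _ _)) (hy.trans_le (min_le_left _ _)), ax, ay, ← AddCircle.coe_sub,
    sphConeDist_of_le_pi (hd.nonneg _ _) (hd.nonneg _ _) hsum hπ, cos_norm_coe, px, py]

end Unfold

/-- The path in the double that crosses the boundary circle at `e`. -/
theorem exists_crossing_path {e : Disc} (he : e ∈ discBoundary) :
    ∃ σ : Path (toDouble false 0) (toDouble true 0),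
      ∀ t, foldDouble (σ t) ∉ discBoundary ∨ foldDouble (σ t) = e := by
  let ρ : Path (0 : Disc) e :=
    { toFun := fun t => ⟨((t : ℝ) : ℂ) * (e : ℂ), by
        have h1 := t.2.1
        have h2 := t.2.2
        have h3 : ‖(e : ℂ)‖ = 1 := he
        simp only [mem_closedBall_zero_iff, norm_mul, h3, mul_one, Complex.norm_real,
          Real.norm_of_nonneg h1]
        exact h2⟩
      continuous_toFun := by
        apply Continuous.subtype_mk
        fun_prop
      source' := by
        apply Subtype.ext
        simp
      target' := by
        apply Subtype.ext
        simp }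
  have hρ : ∀ t, ρ t ∉ discBoundary ∨ ρ t = e := by
    intro t
    by_cases ht : t = 1
    · right
      rw [ht, ρ.target]
    · left
      intro h
      have h3 : ‖(e : ℂ)‖ = 1 := he
      have h4 : ‖((t : ℝ) : ℂ) * (e : ℂ)‖ = 1 := h
      rw [norm_mul, h3, mul_one, Complex.norm_real, Real.norm_of_nonneg t.2.1] at h4
      exact ht (Subtype.ext h4)
  refine ⟨(ρ.map (continuous_toDouble false)).trans
    ((ρ.symm.map (continuous_toDouble true)).cast (toDouble_of_mem he false true) rfl), ?_⟩
  intro t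
  rw [Path.trans_apply]
  split_ifs with h
  · exact hρ _
  · exact hρ _

theorem zero_notMem_discBoundary : (0 : Disc) ∉ discBoundary := by
  simp [discBoundary]

/-- Crossing two sides gives the product of the reflections in them. -/
theorem reflectProd_mem_holonomyImage {d : Disc → Disc → ℝ} (hd : IsGeodesicMetric d)
    {f : Disc → Sphere2} {x : Fin 3 → Disc} (hx : ∀ i, x i ∈ discBoundary)
    (hint : ∀ a, a ∉ discBoundary → IsLocalIsometryAt d f a) {e e' : Disc}
    (he : e ∈ discBoundary) (he' : e' ∈ discBoundary) (hex : e ∉ range x) (hex' : e' ∉ range x)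
    {m n : Sphere2} (hm : IsLocalIsometryAt (doubleDist d) (unfold f m) (toDouble false e))
    (hn : IsLocalIsometryAt (doubleDist d) (unfold f n) (toDouble false e')) :
    reflectProd m n ∈ holonomyImage (doubleVertex x) (doubleDist d) (toDouble false 0)
      (fun q => f (foldDouble q)) := by
  have h0 := zero_notMem_discBoundary
  have hiso : ∀ {c : Disc} {k : Sphere2}, c ∈ discBoundary →
      IsLocalIsometryAt (doubleDist d) (unfold f k) (toDouble false c) → ∀ q,
      foldDouble q ∉ discBoundary ∨ foldDouble q = c →
      IsLocalIsometryAt (doubleDist d) (unfold f k) q := by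
    intro c k hc hk q hq
    obtain ⟨s, a, rfl⟩ := exists_toDouble q
    rw [foldDouble_toDouble] at hq
    rcases hq with hq | rfl
    · exact isLocalIsometryAt_unfold hd hq s (hint a hq) k
    · rwa [toDouble_of_mem hc s false]
  have hvert : ∀ {c : Disc}, c ∉ range x → ∀ q,
      foldDouble q ∉ discBoundary ∨ foldDouble q = c → q ∉ range (doubleVertex x) := by
    rintro c hc _ hq ⟨i, rfl⟩
    rw [doubleVertex, foldDouble_toDouble] at hq
    rcases hq with hq | hq
    · exact hq (hx i)
    · exact hc ⟨i, hq⟩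
  obtain ⟨σ, hσ⟩ := exists_crossing_path he
  obtain ⟨σ', hσ'⟩ := exists_crossing_path he'
  set γ := σ.trans σ'.symm with hγ
  have hle : ∀ t : unitInterval, (t : ℝ) ≤ 1 / 2 →
      foldDouble (γ t) ∉ discBoundary ∨ foldDouble (γ t) = e := by
    intro t ht
    rw [hγ, Path.trans_apply, dif_pos ht]
    exact hσ _
  have hge : ∀ t : unitInterval, ¬ (t : ℝ) ≤ 1 / 2 →
      foldDouble (γ t) ∉ discBoundary ∨ foldDouble (γ t) = e' := by
    intro t ht
    rw [hγ, Path.trans_apply, dif_neg ht]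
    exact hσ' _
  -- The first half of the loop crosses at e with `unfold f m`. For the return through e', the germ
  -- `unfold f n` is corrected by a fixed isometry so that it continues the first germ on the second
  -- sheet.
  set G : DoubleDisc → Sphere2 := fun q => reflect m (reflect n (unfold f n q)) with hG
  have hGiso : ∀ q, IsLocalIsometryAt (doubleDist d) (unfold f n) q →
      IsLocalIsometryAt (doubleDist d) G q := by
    rintro q ⟨r, hr, H⟩
    refine ⟨r, hr, fun a b ha hb => ?_⟩
    rw [hG, sphDist_reflect, sphDist_reflect, H a b ha hb]
  set F : unitInterval → DoubleDisc → Sphere2 := fun t => if (t : ℝ) ≤ 1 / 2 then unfold f m else G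
    with hF
  have hFle : ∀ t : unitInterval, (t : ℝ) ≤ 1 / 2 → F t = unfold f m := fun t ht => if_pos ht
  have hFge : ∀ t : unitInterval, ¬ (t : ℝ) ≤ 1 / 2 → F t = G := fun t ht => if_neg ht
  refine ⟨γ, F, ?_, ?_, ?_, ?_, ?_⟩
  · intro t
    by_cases ht : (t : ℝ) ≤ 1 / 2
    · exact hvert hex _ (hle t ht)
    · exact hvert hex' _ (hge t ht)
  · intro t
    by_cases ht : (t : ℝ) ≤ 1 / 2
    · rw [hFle t ht]
      exact hiso he hm _ (hle t ht)
    · rw [hFge t ht]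
      exact hGiso _ (hiso he' hn _ (hge t ht))
  · intro t
    rcases lt_trichotomy (t : ℝ) (1 / 2) with ht | ht | ht
    · filter_upwards [continuous_subtype_val.continuousAt.eventually (gt_mem_nhds ht)] with s hs
      rw [hFle t ht.le, hFle s hs.le]
    -- At the switch the loop is in the open second sheet. There the first germ is f followed by the
    -- reflection m, and in G the two reflections n cancel.
    · have hmid : γ t = toDouble true 0 := by
        rw [hγ, Path.trans_apply, dif_pos ht.le]
        have : (⟨2 * (t : ℝ), (unitInterval.mul_pos_mem_iff zero_lt_two).2 ⟨t.2.1, ht.le⟩⟩ :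
          unitInterval) = 1 := Subtype.ext (by simp [ht])
        rw [this, σ.target]
      have hsheet := (eventually_sheet hd h0 true).eventually_nhds
      rw [← hmid] at hsheet
      filter_upwards [γ.continuous.continuousAt.eventually hsheet] with s hs
      rw [hFle t ht.le]
      by_cases hs2 : (s : ℝ) ≤ 1 / 2
      · rw [hFle s hs2]
      · rw [hFge s hs2]
        filter_upwards [hs] with q hq
        obtain ⟨b, hb, rfl⟩ := hq
        rw [hG]
        simp only
        rw [unfold_true f n hb, unfold_true f m hb, reflect_reflect]
    · filter_upwards [continuous_subtype_val.continuousAt.eventually (lt_mem_nhds ht)] with s hs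
      rw [hFge t ht.not_ge, hFge s (not_le.2 hs)]
  · rw [hFle 0 (by norm_num)]
    filter_upwards [eventually_sheet hd h0 false] with q hq
    obtain ⟨b, hb, rfl⟩ := hq
    rw [unfold_false, foldDouble_toDouble]
  · rw [hFge 1 (by norm_num)]
    filter_upwards [eventually_sheet hd h0 false] with q hq
    obtain ⟨b, hb, rfl⟩ := hq
    rw [hG, matAct_reflectProd]
    simp only
    rw [unfold_false, foldDouble_toDouble]

/-- The pole of the great circle through a side of the region. -/
def sideNormal (τ : ℝ) {σ : ℝ} (hσ : σ ^ 2 = 1) : Sphere2 :=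
  ⟨edgeNormal τ σ, by rw [mem_sphere_zero_iff_norm, norm_edgeNormal τ hσ]⟩

theorem inner_dev {u : Sphere2} {τ : ℝ} (hu : 0 < (u : E3) 0) (h0 : 0 < τ) (hπ : τ < Real.pi)
    (z : ℂ) : inner ℝ (u : E3) (dev u τ z : E3) =
      ‖devVec (u : E3) τ z‖⁻¹ * ((u : E3) 0 * (1 - z.im)) := by
  rw [dev, coe_sphereDir (devVec_ne_zero h0 hπ hu z), inner_smul_right, inner_devVec hu]

theorem IsRegionChart.isLocalIsometryAt_unfold {f : Disc → Sphere2} {x : Fin 3 → Disc} {u : Sphere2}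
    {τ : ℝ} (hf : IsRegionChart f x u τ) (hu : 0 < inner ℝ (u : E3) (stdPole : E3)) (h0 : 0 < τ)
    (hπ : τ < Real.pi) {e : Disc} (he : e ∈ discBoundary) (hex : e ∉ range x) {n : Sphere2}
    (hn : IsEdgeAt u τ (f e) n) :
    IsLocalIsometryAt (doubleDist fun a b => coneDist (f a) (f b)) (unfold f n)
      (toDouble false e) := by
  have hne : e ≠ x 0 := fun h => hex ⟨0, h.symm⟩
  obtain ⟨b, r, hb0, hb2, hc⟩ := hf.exists_edge_chart hu h0 hπ (fun h => hne (hf.eq_apex h)) hn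
  exact isLocalIsometryAt_unfold_edge (hf.isGeodesicMetric hu h0 hπ) he
    (hf.isLocalIsometryAt hu h0 hπ hne) hb0 hb2 hc false

/-- The holonomy of the double of a triangle whose first angle is not `π` is non-coaxial. -/
theorem IsModelChart.hasNonCoaxialHolonomy {g : Disc → ℂ} {x : Fin 3 → Disc} (hg : IsModelChart g x)
    {u : Sphere2} {τ : ℝ} (hu : 0 < (u : E3) 0) (h0 : 0 < τ) (hπ : τ < Real.pi)
    (hτ : Real.cos τ ≠ 0) :
    HasNonCoaxialHolonomy (doubleVertex x)
      (doubleDist fun a b => coneDist (dev u τ (g a)) (dev u τ (g b))) := by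
  have hf := hg.isRegionChart hu h0 hπ
  have hup : 0 < inner ℝ (u : E3) (stdPole : E3) := by rwa [inner_stdPole]
  have hd := hf.isGeodesicMetric hup h0 hπ
  have hs := Real.sin_pos_of_pos_of_lt_pi h0 hπ
  have hpos : ∀ z, 0 < ‖devVec (u : E3) τ z‖⁻¹ := fun z =>
    inv_pos.2 (norm_pos_iff.2 (devVec_ne_zero h0 hπ hu z))
  have hxv : ∀ i, g (x i) = 0 ∨ g (x i) = ⟨-1, 1⟩ ∨ g (x i) = ⟨1, 1⟩ := by
    intro i
    fin_cases i
    · exact Or.inl hg.vertex_zero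
    · exact Or.inr (Or.inl hg.vertex_one)
    · exact Or.inr (Or.inr hg.vertex_two)
  have hxb : ∀ i, x i ∈ discBoundary := by
    intro i
    rw [hg.boundary]
    rcases hxv i with h | h | h <;> simp [h]
  have hint : ∀ a, a ∉ discBoundary → IsLocalIsometryAt
      (fun a b => coneDist (dev u τ (g a)) (dev u τ (g b))) (fun a => dev u τ (g a)) a :=
    fun a ha => hf.isLocalIsometryAt hup h0 hπ (fun h => ha (h ▸ hxb 0))
  have side : ∀ {σ : ℝ} (hσ : σ ^ 2 = 1), ∃ e, e ∈ discBoundary ∧ e ∉ range x ∧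
      IsEdgeAt u τ (dev u τ (g e)) (sideNormal τ hσ) := by
    intro σ hσ
    have habs : |σ| = 1 :=
      (pow_eq_one_iff_of_nonneg (abs_nonneg σ) two_ne_zero).1 (by rw [sq_abs, hσ])
    have hhalf : |σ / 2| = 1 / 2 := by rw [abs_div, habs, abs_two]
    -- The midpoint of a side of the model triangle is a convenient crossing point away from the
    -- vertices.
    obtain ⟨e, he⟩ : (⟨σ / 2, 1 / 2⟩ : ℂ) ∈ range g := by
      rw [hg.range_eq]
      exact ⟨hhalf.le, by norm_num⟩
    have heb : e ∈ discBoundary := by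
      rw [hg.boundary, he]
      exact Or.inl hhalf
    have hin : 0 < inner ℝ (u : E3) (dev u τ (g e) : E3) := by
      rw [inner_dev hu h0 hπ, he]
      exact mul_pos (hpos _) (mul_pos hu (by norm_num))
    refine ⟨e, heb, ?_, isEdgeAt_side h0 hπ hσ hin ?_ ?_⟩
    · rintro ⟨i, rfl⟩
      have him := congrArg Complex.im he
      rcases hxv i with h | h | h <;> rw [h] at him <;> norm_num at him
    · exact ((hf.boundary e).1 heb).resolve_left hin.ne'
    · rw [horiz_dev hu h0 hπ, Complex.im_ofReal_mul, he]
      have : σ * (‖devVec (u : E3) τ ⟨σ / 2, 1 / 2⟩‖⁻¹ * (devHoriz τ ⟨σ / 2, 1 / 2⟩).im) =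
          ‖devVec (u : E3) τ ⟨σ / 2, 1 / 2⟩‖⁻¹ * (σ ^ 2 * Real.sin τ / 2) := by
        simp only [devHoriz]
        ring
      rw [this, hσ]
      exact mul_pos (hpos _) (by positivity)
  have base : ∃ e, e ∈ discBoundary ∧ e ∉ range x ∧ IsEdgeAt u τ (dev u τ (g e)) u := by
    obtain ⟨e, he⟩ : (⟨0, 1⟩ : ℂ) ∈ range g := by
      rw [hg.range_eq]
      simp [modelTriangle]
    have heb : e ∈ discBoundary := by
      rw [hg.boundary, he]
      exact Or.inr rfl
    have hex : e ∉ range x := by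
      rintro ⟨i, rfl⟩
      rcases hxv i with h | h | h <;> rw [h] at he <;> simp [Complex.ext_iff] at he
    have hin : inner ℝ (u : E3) (dev u τ (g e) : E3) = 0 := by
      rw [inner_dev hu h0 hπ, he]
      simp
    refine ⟨e, heb, hex, isEdgeAt_base hin (lt_of_le_of_ne (hf.mem_region e).2 ?_)⟩
    intro h
    rcases (hf.corner e).1 ⟨hin, h.symm⟩ with h | h
    · exact hex ⟨1, h.symm⟩
    · exact hex ⟨2, h.symm⟩
  have hneg : (-1 : ℝ) ^ 2 = 1 := by norm_num
  have hone : (1 : ℝ) ^ 2 = 1 := by norm_num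
  obtain ⟨e₁, b₁, v₁, hE₁⟩ := side hneg
  obtain ⟨e₂, b₂, v₂, hE₂⟩ := side hone
  obtain ⟨e₃, b₃, v₃, hE₃⟩ := base
  have U₁ := hf.isLocalIsometryAt_unfold hup h0 hπ b₁ v₁ hE₁
  have U₂ := hf.isLocalIsometryAt_unfold hup h0 hπ b₂ v₂ hE₂
  have U₃ := hf.isLocalIsometryAt_unfold hup h0 hπ b₃ v₃ hE₃
  refine ⟨toDouble false 0, ?_, fun q => dev u τ (g (foldDouble q)), ?_, ?_⟩
  · rintro ⟨i, hi⟩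
    have := congrArg foldDouble hi
    rw [doubleVertex, foldDouble_toDouble, foldDouble_toDouble] at this
    exact zero_notMem_discBoundary (this ▸ hxb i)
  · exact isLocalIsometryAt_of_sheet hd zero_notMem_discBoundary false
      (hint _ zero_notMem_discBoundary) fun a b _ _ => rfl
  · rintro ⟨v, hv, hfix⟩
    -- The two meridian sides lie on different great circles exactly because cos τ ≠ 0; the base
    -- differs from them because its pole has positive height.
    have l₁ : LinearIndependent ℝ
        ![(sideNormal τ hneg : E3), (sideNormal τ hone : E3)] := by
      rw [LinearIndependent.pair_iff]
      intro s t hst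
      have c1 := congrArg (fun w : E3 => w 1) hst
      have c2 := congrArg (fun w : E3 => w 2) hst
      simp [sideNormal, edgeNormal] at c1 c2
      have e1 : (s + t) * Real.sin τ = 0 := by linarith
      have e2 : (s - t) * Real.cos τ = 0 := by linarith
      have e3 := (mul_eq_zero.1 e1).resolve_right hs.ne'
      have e4 := (mul_eq_zero.1 e2).resolve_right hτ
      constructor <;> linarith
    have l₂ : LinearIndependent ℝ ![(sideNormal τ hneg : E3), (u : E3)] := by
      rw [LinearIndependent.pair_iff]
      intro s t hst
      have c0 := congrArg (fun w : E3 => w 0) hst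
      have c1 := congrArg (fun w : E3 => w 1) hst
      simp [sideNormal, edgeNormal] at c0 c1
      have ht : t = 0 := c0.resolve_right hu.ne'
      rw [ht] at c1
      simp [hs.ne'] at c1
      exact ⟨c1, ht⟩
    obtain ⟨k₁, k₂⟩ := inner_eq_zero_of_matAct_reflectProd l₁
      (hfix _ (reflectProd_mem_holonomyImage hd hxb hint b₁ b₂ v₁ v₂ U₁ U₂))
    obtain ⟨-, k₃⟩ := inner_eq_zero_of_matAct_reflectProd l₂
      (hfix _ (reflectProd_mem_holonomyImage hd hxb hint b₁ b₃ v₁ v₃ U₁ U₃))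
    rw [inner_E3] at k₁ k₂ k₃
    simp [sideNormal, edgeNormal] at k₁ k₂
    have w1 : Real.sin τ * v 1 = 0 := by linarith
    have w2 : Real.cos τ * v 2 = 0 := by linarith
    have z1 := (mul_eq_zero.1 w1).resolve_left hs.ne'
    have z2 := (mul_eq_zero.1 w2).resolve_left hτ
    rw [z1, z2, mul_zero, mul_zero, add_zero, add_zero] at k₃
    have z0 := (mul_eq_zero.1 k₃).resolve_left hu.ne'
    apply hv
    ext i
    fin_cases i
    · exact z0
    · exact z1
    · exact z2

/-! ### The complement of a triangle in a hemisphere -/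

theorem reflect_sphereDir (n : Sphere2) {v : E3} (hv : v ≠ 0) :
    reflect n (sphereDir v) = sphereDir (v - (2 * inner ℝ (n : E3) v) • (n : E3)) := by
  have h : v - (2 * inner ℝ (n : E3) v) • (n : E3) = ‖v‖ • (reflect n (sphereDir v) : E3) := by
    conv_lhs => rw [← norm_smul_sphereDir hv]
    rw [coe_reflect, real_inner_smul_right, smul_sub, smul_smul]
    congr 2
    ring
  rw [h, sphereDir_smul (norm_pos_iff.2 hv)]

/-- The horizontal axis bisecting the regions. -/
def stdAxis : Sphere2 := ⟨stdFrame 1, by simp⟩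

theorem inner_stdAxis (w : E3) : inner ℝ (stdAxis : E3) w = w 1 := by
  simp [stdAxis, EuclideanSpace.inner_single_left]

theorem reflect_stdAxis_apply (w : Sphere2) :
    (reflect stdAxis w : E3) = !₂[(w : E3) 0, -(w : E3) 1, (w : E3) 2] := by
  rw [coe_reflect, inner_stdAxis]
  ext i
  fin_cases i <;> simp [stdAxis]
  ring

theorem horiz_reflect_stdAxis (w : Sphere2) : horiz stdFrame (reflect stdAxis w : E3) =
    ⟨-(horiz stdFrame (w : E3)).re, (horiz stdFrame (w : E3)).im⟩ := by
  rw [horiz_stdFrame, horiz_stdFrame, reflect_stdAxis_apply]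
  simp

theorem norm_horiz_reflect_stdAxis (w : Sphere2) :
    ‖horiz stdFrame (reflect stdAxis w : E3)‖ = ‖horiz stdFrame (w : E3)‖ := by
  rw [horiz_reflect_stdAxis, Complex.norm_def, Complex.norm_def, Complex.normSq_apply,
    Complex.normSq_apply]
  simp

/-- The reflection reverses the axis of the sector, so a sector of half-angle π - τ becomes the
closed complement of the one of half-angle τ. -/
theorem reflect_stdAxis_mem_region {u w : Sphere2} {τ : ℝ} :
    reflect stdAxis w ∈ region (reflect stdAxis u) (Real.pi - τ) ↔ 0 ≤ inner ℝ (u : E3) (w : E3) ∧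
      (horiz stdFrame (w : E3)).re ≤ ‖horiz stdFrame (w : E3)‖ * Real.cos τ := by
  rw [region, mem_ofPred_eq, inner_reflect_reflect, norm_horiz_reflect_stdAxis,
    horiz_reflect_stdAxis, Real.cos_pi_sub]
  refine and_congr_right fun _ => ?_
  simp only
  rw [mul_neg, neg_le_neg_iff]

/-- The change of sign means that the base angles of the complementary triangle are supplementary.
-/
theorem inner_reflect_stdAxis_edgeNormal (u : Sphere2) (τ σ : ℝ) :
    inner ℝ (reflect stdAxis u : E3) (edgeNormal (Real.pi - τ) σ) =
      -inner ℝ (u : E3) (edgeNormal τ σ) := by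
  rw [reflect_stdAxis_apply, inner_E3, inner_E3]
  simp [edgeNormal]
  ring

/-- The complementary triangle has the same corners. -/
theorem reflect_stdAxis_dev {u : Sphere2} (hu : 0 < (u : E3) 0) {τ : ℝ} (h0 : 0 < τ)
    (hπ : τ < Real.pi) {z : ℂ} (hz : |z.re| = z.im) :
    reflect stdAxis (dev (reflect stdAxis u) (Real.pi - τ) z) = dev u τ z := by
  have hu' : 0 < (reflect stdAxis u : E3) 0 := by rwa [reflect_stdAxis_apply]
  rw [dev, reflect_sphereDir _ (devVec_ne_zero (by linarith) (by linarith) hu' z), dev]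
  congr 1
  rw [inner_stdAxis, reflect_stdAxis_apply]
  ext i
  fin_cases i <;> simp [devVec, devHoriz, stdAxis, hz] <;> ring

/-- Removing the closed triangle also removes the two meridian sides. The closure restores them, as
each point of the region is a limit of points in the open sector. -/
theorem closure_hemisphere_diff {u : Sphere2} (hu : 0 < (u : E3) 0) {τ : ℝ} (h0 : 0 < τ)
    (hπ : τ < Real.pi) {g : Disc → ℂ} {x : Fin 3 → Disc} (hg : IsModelChart g x) :
    closure {w : Sphere2 | 0 ≤ inner ℝ (u : E3) (w : E3) ∧
      ‖horiz stdFrame (w : E3)‖ * Real.cos τ < (horiz stdFrame (w : E3)).re} = region u τ := by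
  have hf := hg.isRegionChart hu h0 hπ
  have hs := Real.sin_pos_of_pos_of_lt_pi h0 hπ
  apply Subset.antisymm
  · refine closure_minimal (fun w hw => ⟨hw.1, hw.2.le⟩) ?_
    rw [← hf.range_eq]
    exact (isCompact_range hf.cont).isClosed
  · intro w hw
    obtain ⟨a, rfl⟩ := hf.exists_eq hw
    have hK : g a ∈ modelTriangle := hg.range_eq ▸ mem_range_self a
    -- The approximating points move towards i, the midpoint of the base of the model triangle,
    -- where |re| < im holds strictly.
    have hlim : Tendsto (fun t : ℝ => dev u τ ((1 - t : ℝ) * g a + (t : ℝ) * Complex.I)) (𝓝[>] 0)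
        (𝓝 (dev u τ (g a))) := by
      have hc : Continuous fun t : ℝ => dev u τ ((1 - t : ℝ) * g a + (t : ℝ) * Complex.I) :=
        (continuous_dev h0 hπ hu).comp (by fun_prop)
      have := hc.tendsto 0
      simp only [sub_zero, Complex.ofReal_one, one_mul, Complex.ofReal_zero, zero_mul,
        add_zero] at this
      exact this.mono_left nhdsWithin_le_nhds
    refine mem_closure_of_tendsto hlim ?_
    filter_upwards [Ioo_mem_nhdsGT (zero_lt_one' ℝ)] with t ht
    set z : ℂ := (1 - t : ℝ) * g a + (t : ℝ) * Complex.I with hz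
    have hre : z.re = (1 - t) * (g a).re := by
      rw [hz, Complex.add_re, Complex.re_ofReal_mul, Complex.re_ofReal_mul, Complex.I_re]
      ring
    have him : z.im = (1 - t) * (g a).im + t := by
      rw [hz, Complex.add_im, Complex.im_ofReal_mul, Complex.im_ofReal_mul, Complex.I_im]
      ring
    have h1t : 0 < 1 - t := by linarith [ht.2]
    have hlt : |z.re| < z.im := by
      rw [hre, him, abs_mul, abs_of_pos h1t]
      nlinarith [hK.1, ht.1]
    have hle : z.im ≤ 1 := by
      rw [him]
      nlinarith [hK.2]
    have hzK : z ∈ modelTriangle := ⟨hlt.le, hle⟩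
    obtain ⟨b, hb⟩ : z ∈ range g := by rwa [hg.range_eq]
    have hm := hf.mem_region b
    simp only [hb] at hm
    refine ⟨hm.1, lt_of_le_of_ne hm.2 fun h => hlt.ne ?_⟩
    rw [← (devHoriz_sector h0 hπ hzK).2]
    rw [horiz_dev hu h0 hπ, norm_mul, Complex.norm_real, Real.norm_of_nonneg (by positivity),
      Complex.re_ofReal_mul, mul_assoc,
      mul_right_inj' (inv_pos.2 (norm_pos_iff.2 (devVec_ne_zero h0 hπ hu z))).ne'] at h
    exact h.symm

/-- The convex triangle is the mirror image of the region for the reflected pole and the half-angle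
π - τ, parametrized by the same model chart. Its first angle is below π because ϑ 0 > 1. -/
theorem IsModelChart.isComplementInHemisphere {g : Disc → ℂ} {x : Fin 3 → Disc}
    (hg : IsModelChart g x) {u : Sphere2} {τ : ℝ} (hu : 0 < (u : E3) 0) (h0 : 0 < τ)
    (hπ : τ < Real.pi) {ϑ : Fin 3 → ℝ} (hτ : 2 * τ = Real.pi * ϑ 0) (h1 : ϑ 1 ∈ Ioo (0 : ℝ) 1)
    (h2 : ϑ 2 ∈ Ioo (0 : ℝ) 1)
    (a1 : inner ℝ (u : E3) (edgeNormal τ (-1)) = -Real.cos (Real.pi * ϑ 1))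
    (a2 : inner ℝ (u : E3) (edgeNormal τ 1) = -Real.cos (Real.pi * ϑ 2)) (hϑ : 1 < ϑ 0) :
    IsComplementInHemisphere x ϑ fun a b => coneDist (dev u τ (g a)) (dev u τ (g b)) := by
  have hf := hg.isRegionChart hu h0 hπ
  set u' := reflect stdAxis u with hu'
  set τ' := Real.pi - τ with hτ'
  have hu0' : 0 < (u' : E3) 0 := by
    rw [hu', reflect_stdAxis_apply]
    exact hu
  have h0' : 0 < τ' := by rw [hτ']; linarith
  have hπ' : τ' < Real.pi := by rw [hτ']; linarith
  have hf' := hg.isRegionChart hu0' h0' hπ'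
  have hup : 0 < inner ℝ (u : E3) (stdPole : E3) := by rwa [inner_stdPole]
  have hup' : 0 < inner ℝ (u' : E3) (stdPole : E3) := by rwa [inner_stdPole]
  have hmem : ∀ w, w ∈ range (fun a => reflect stdAxis (dev u' τ' (g a))) ↔
      0 ≤ inner ℝ (u : E3) (w : E3) ∧
      (horiz stdFrame (w : E3)).re ≤ ‖horiz stdFrame (w : E3)‖ * Real.cos τ := by
    intro w
    rw [← reflect_stdAxis_mem_region, ← hu', ← hτ', ← hf'.range_eq]
    constructor
    · rintro ⟨a, rfl⟩
      exact ⟨a, (reflect_reflect _ _).symm⟩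
    · rintro ⟨a, ha⟩
      exact ⟨a, by simp only at ha ⊢; rw [ha, reflect_reflect]⟩
  have hvert : ∀ i, dev u τ (g (x i)) = reflect stdAxis (dev u' τ' (g (x i))) := by
    intro i
    refine (reflect_stdAxis_dev hu h0 hπ ?_).symm
    fin_cases i
    · simp [hg.vertex_zero]
    · simp [hg.vertex_one]
    · simp [hg.vertex_two]
  refine ⟨u, x, fun a b => coneDist (dev u' τ' (g a)) (dev u' τ' (g b)),
    fun a => reflect stdAxis (dev u' τ' (g a)), fun a => dev u τ (g a), _, ⟨?_, ?_⟩,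
    ⟨(continuous_reflect _).comp hf'.cont, ?_, rfl, ?_⟩, fun w hw => ((hmem w).1 hw).1, ?_, ?_,
    ⟨hf.cont, hf.inj, ?_, ?_⟩, hvert⟩
  · refine hf'.isSphericalTriangle hup' h0' hπ' ?_ ?_ ?_ ?_ ?_
    · simp only [Matrix.cons_val_zero, hτ']
      linarith
    · simp only [Matrix.cons_val_one, Matrix.cons_val_zero]
      exact ⟨by linarith [h1.2], by linarith [h1.1]⟩
    · simp only [Matrix.cons_val]
      exact ⟨by linarith [h2.2], by linarith [h2.1]⟩
    · rw [hu', hτ', inner_reflect_stdAxis_edgeNormal, a1]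
      simp [mul_sub, Real.cos_pi_sub]
    · rw [hu', hτ', inner_reflect_stdAxis_edgeNormal, a2]
      simp [mul_sub, Real.cos_pi_sub]
  · intro i
    fin_cases i
    · simp; linarith
    · simp; linarith [h1.1]
    · simp; linarith [h2.1]
  · intro a b hab
    apply hf'.inj
    have := congrArg (reflect stdAxis) hab
    simpa only [reflect_reflect] using this
  · intro p hp
    obtain ⟨r, hr, H⟩ := hf'.isLocalIsometryAt hup' h0' hπ' (a₀ := p) fun h => hp ⟨0, h.symm⟩
    exact ⟨r, hr, fun a b ha hb => by rw [sphDist_reflect, H a b ha hb]⟩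
  · simp only
    rw [← hvert, greatCircle, mem_ofPred_eq, inner_dev hu h0 hπ, hg.vertex_one]
    simp
  · simp only
    rw [← hvert, greatCircle, mem_ofPred_eq, inner_dev hu h0 hπ, hg.vertex_two]
    simp
  · rw [hf.range_eq, ← closure_hemisphere_diff hu h0 hπ hg]
    congr 1
    ext w
    rw [mem_ofPred_eq, Set.mem_sdiff, hmem, hemisphere, mem_ofPred_eq, not_and, not_le]
    exact ⟨fun h => ⟨h.1, fun _ => h.2⟩, fun h => ⟨h.1, h.2 h.1⟩⟩
  · intro p hp
    exact hf.isLocalIsometryAt hup h0 hπ fun h => hp ⟨0, h.symm⟩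

/-! ### Existence of the triangle with prescribed angles -/

/-- The first horizontal coordinate of the pole of the third side. -/
def poleFst (ν : Fin 3 → ℝ) : ℝ :=
  -(Real.cos (Real.pi * ν 1) + Real.cos (Real.pi * ν 2)) / (2 * Real.sin (Real.pi * ν 0 / 2))

/-- The second horizontal coordinate of the pole of the third side. -/
def poleSnd (ν : Fin 3 → ℝ) : ℝ :=
  (Real.cos (Real.pi * ν 2) - Real.cos (Real.pi * ν 1)) / (2 * Real.cos (Real.pi * ν 0 / 2))

/-- The height of the pole of the third side. -/
def poleHeight (ν : Fin 3 → ℝ) : ℝ := √(1 - poleFst ν ^ 2 - poleSnd ν ^ 2)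

/-- The pole of the third side of the triangle with angles `π ν`. -/
def basePole (ν : Fin 3 → ℝ) : Sphere2 := sphereDir !₂[poleHeight ν, poleFst ν, poleSnd ν]

/-- The angles for which the triangle is constructed. -/
def triangleAngles : Set (Fin 3 → ℝ) :=
  {ν | 0 < ν 0 ∧ ν 0 < 2 ∧ Real.cos (Real.pi * ν 0 / 2) ≠ 0 ∧ (0 < ν 1 ∧ ν 1 < 1) ∧
    (0 < ν 2 ∧ ν 2 < 1) ∧ poleFst ν ^ 2 + poleSnd ν ^ 2 < 1}

section

variable {ν : Fin 3 → ℝ} (hν : ν ∈ triangleAngles)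
include hν

theorem half_angle_pos : 0 < Real.pi * ν 0 / 2 := by
  have := hν.1
  positivity

theorem half_angle_lt_pi : Real.pi * ν 0 / 2 < Real.pi := by
  nlinarith [hν.2.1, Real.pi_pos]

theorem sin_half_angle_pos : 0 < Real.sin (Real.pi * ν 0 / 2) :=
  Real.sin_pos_of_pos_of_lt_pi (half_angle_pos hν) (half_angle_lt_pi hν)

theorem poleHeight_pos : 0 < poleHeight ν := Real.sqrt_pos.2 (by linarith [hν.2.2.2.2.2])

theorem coe_basePole : (basePole ν : E3) = !₂[poleHeight ν, poleFst ν, poleSnd ν] := by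
  have h1 : ‖(!₂[poleHeight ν, poleFst ν, poleSnd ν] : E3)‖ = 1 := by
    rw [← sq_eq_sq₀ (norm_nonneg _) zero_le_one, ← real_inner_self_eq_norm_sq, inner_E3]
    have : poleHeight ν ^ 2 = 1 - poleFst ν ^ 2 - poleSnd ν ^ 2 :=
      Real.sq_sqrt (by linarith [hν.2.2.2.2.2])
    simp
    linarith
  rw [basePole, coe_sphereDir (norm_ne_zero_iff.1 (by rw [h1]; exact one_ne_zero)), h1, inv_one,
    one_smul]

theorem basePole_zero_pos : 0 < (basePole ν : E3) 0 := by
  rw [coe_basePole hν]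
  exact poleHeight_pos hν

/-- `poleFst` and `poleSnd` solve this linear system: σ = -1 yields -cos (π ν 1) and σ = 1 yields
-cos (π ν 2), the conditions for the base angles. -/
theorem inner_basePole_edgeNormal (σ : ℝ) :
    inner ℝ (basePole ν : E3) (edgeNormal (Real.pi * ν 0 / 2) σ) =
      -(Real.cos (Real.pi * ν 1) + Real.cos (Real.pi * ν 2)) / 2 -
        σ * ((Real.cos (Real.pi * ν 2) - Real.cos (Real.pi * ν 1)) / 2) := by
  have hs := (sin_half_angle_pos hν).ne'
  have hc := hν.2.2.1
  rw [coe_basePole hν, inner_E3]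
  simp only [edgeNormal, poleFst, poleSnd, PiLp.toLp_apply, Matrix.cons_val]
  field_simp
  ring

theorem continuousAt_poleFst : ContinuousAt poleFst ν := by
  have hs := (sin_half_angle_pos hν).ne'
  unfold poleFst
  refine ContinuousAt.div (Continuous.continuousAt (by fun_prop))
    (Continuous.continuousAt (by fun_prop)) ?_
  positivity

theorem continuousAt_poleSnd : ContinuousAt poleSnd ν := by
  have hc := hν.2.2.1
  unfold poleSnd
  refine ContinuousAt.div (Continuous.continuousAt (by fun_prop))
    (Continuous.continuousAt (by fun_prop)) ?_
  positivity

/-- All conditions are strict inequalities or non-vanishing conditions on functions continuous at ν.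
This openness makes all three angles independently deformable. -/
theorem triangleAngles_mem_nhds : triangleAngles ∈ 𝓝 ν := by
  have hc := hν
  obtain ⟨h1, h2, h3, h4, h5, h6⟩ := hν
  have c : ∀ i, ContinuousAt (fun μ : Fin 3 → ℝ => μ i) ν :=
    fun i => (continuous_apply i).continuousAt
  have c3 : ContinuousAt (fun μ : Fin 3 → ℝ => Real.cos (Real.pi * μ 0 / 2)) ν :=
    Continuous.continuousAt (by fun_prop)
  have c6 : ContinuousAt (fun μ => poleFst μ ^ 2 + poleSnd μ ^ 2) ν :=
    ((continuousAt_poleFst hc).pow 2).add ((continuousAt_poleSnd hc).pow 2)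
  filter_upwards [(c 0).eventually (lt_mem_nhds h1), (c 0).eventually (gt_mem_nhds h2),
    c3.eventually_ne h3, (c 1).eventually (lt_mem_nhds h4.1), (c 1).eventually (gt_mem_nhds h4.2),
    (c 2).eventually (lt_mem_nhds h5.1), (c 2).eventually (gt_mem_nhds h5.2),
    c6.eventually (gt_mem_nhds h6)] with μ k1 k2 k3 k4 k5 k6 k7 k8
  exact ⟨k1, k2, k3, ⟨k4, k5⟩, ⟨k6, k7⟩, k8⟩

theorem continuousAt_devParam :
    ContinuousAt (fun μ => devParam (basePole μ) (Real.pi * μ 0 / 2)) ν := by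
  have hF := continuousAt_poleFst hν
  have hS := continuousAt_poleSnd hν
  have hH : ContinuousAt poleHeight ν :=
    ((continuousAt_const.sub (hF.pow 2)).sub (hS.pow 2)).sqrt
  have hne := (poleHeight_pos hν).ne'
  have : ContinuousAt (fun μ : Fin 3 → ℝ => (poleFst μ / poleHeight μ, poleSnd μ / poleHeight μ,
      Real.cos (Real.pi * μ 0 / 2), Real.sin (Real.pi * μ 0 / 2))) ν :=
    (hF.div hH hne).prodMk ((hS.div hH hne).prodMk
      (Continuous.continuousAt (by fun_prop)))
  refine this.congr ?_
  filter_upwards [triangleAngles_mem_nhds hν] with μ hμ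
  rw [devParam, coe_basePole hμ]
  rfl

theorem IsModelChart.isSphericalTriangle {g : Disc → ℂ} {x : Fin 3 → Disc} (hg : IsModelChart g x) :
    IsSphericalTriangle x ν fun a b => coneDist (dev (basePole ν) (Real.pi * ν 0 / 2) (g a))
      (dev (basePole ν) (Real.pi * ν 0 / 2) (g b)) := by
  refine (hg.isRegionChart (basePole_zero_pos hν) (half_angle_pos hν)
    (half_angle_lt_pi hν)).isSphericalTriangle ?_ (half_angle_pos hν) (half_angle_lt_pi hν)
    (by ring) hν.2.2.2.1 hν.2.2.2.2.1 ?_ ?_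
  · rw [inner_stdPole]
    exact basePole_zero_pos hν
  · rw [inner_basePole_edgeNormal hν]
    ring
  · rw [inner_basePole_edgeNormal hν]
    ring

end

/-- The pole exists iff the first angle lies between bounds given by the other two. -/
theorem pole_sq_lt_one {s c A B : ℝ} (hs : 0 < s) (hc : c ≠ 0) (hsc : s ^ 2 + c ^ 2 = 1)
    (h : (s ^ 2 - Real.cos (A + B) ^ 2) * (s ^ 2 - Real.cos (A - B) ^ 2) < 0) :
    (-(Real.cos (2 * A) + Real.cos (2 * B)) / (2 * s)) ^ 2 +
      ((Real.cos (2 * B) - Real.cos (2 * A)) / (2 * c)) ^ 2 < 1 := by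
  have e1 : Real.cos (2 * A) + Real.cos (2 * B) = 2 * (Real.cos (A + B) * Real.cos (A - B)) := by
    rw [Real.cos_add_cos]
    ring_nf
  have e2 : Real.cos (2 * B) - Real.cos (2 * A) = 2 * (Real.sin (A + B) * Real.sin (A - B)) := by
    rw [Real.cos_sub_cos, show (2 * B - 2 * A) / 2 = -(A - B) by ring, Real.sin_neg]
    ring_nf
  have p1 := Real.sin_sq_add_cos_sq (A + B)
  have p2 := Real.sin_sq_add_cos_sq (A - B)
  rw [e1, e2]
  have hs2 : 0 < s ^ 2 := by positivity
  have hc2 : 0 < c ^ 2 := by positivity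
  have key : (-(2 * (Real.cos (A + B) * Real.cos (A - B))) / (2 * s)) ^ 2 +
      (2 * (Real.sin (A + B) * Real.sin (A - B)) / (2 * c)) ^ 2 =
      (Real.cos (A + B) ^ 2 * Real.cos (A - B) ^ 2 * c ^ 2 +
        Real.sin (A + B) ^ 2 * Real.sin (A - B) ^ 2 * s ^ 2) / (s ^ 2 * c ^ 2) := by
    field_simp
  rw [key, div_lt_one (by positivity)]
  have q1 : Real.sin (A + B) ^ 2 = 1 - Real.cos (A + B) ^ 2 := by linarith
  have q2 : Real.sin (A - B) ^ 2 = 1 - Real.cos (A - B) ^ 2 := by linarith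
  have q3 : c ^ 2 = 1 - s ^ 2 := by linarith
  rw [q1, q2, q3]
  -- After clearing denominators, the right side minus the left side is minus the product in the
  -- hypothesis.
  nlinarith

theorem cos_pi_mul_lt {a b : ℝ} (ha : 0 ≤ a) (hb : b ≤ 1) (hab : a < b) :
    Real.cos (Real.pi * b) < Real.cos (Real.pi * a) :=
  Real.cos_lt_cos_of_nonneg_of_le_pi (mul_nonneg Real.pi_pos.le ha)
    (mul_le_of_le_one_right Real.pi_pos.le hb) (mul_lt_mul_of_pos_left hab Real.pi_pos)

/-! ### From the holonomy inequalities to the existence of the pole -/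

section Holonomy

variable {ϑ : Fin 3 → ℝ} (hol : StrictHolonomyInequalities ϑ)
include hol

theorem StrictHolonomyInequalities.one_lt (a b c : ℤ) (h : Odd (a + b + c)) :
    1 < |ϑ 0 - 1 - a| + |ϑ 1 - 1 - b| + |ϑ 2 - 1 - c| := by
  have := hol ![a, b, c] (by simpa [Fin.sum_univ_three] using h)
  simpa [Fin.sum_univ_three] using this

/-- On the box, six odd vectors m already give |ϑ 1 - ϑ 2| < k < min (ϑ 1 + ϑ 2) (2 - ϑ 1 - ϑ 2) for
k = |ϑ 0 - 1|. The cosine is decreasing on [0, π], so this brackets cos πk and gives the sign needed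
in `pole_sq_lt_one`. -/
theorem StrictHolonomyInequalities.mem_triangleAngles (h0 : ϑ 0 ∈ Icc (0 : ℝ) 2)
    (h1 : ϑ 1 ∈ Icc (0 : ℝ) 1) (h2 : ϑ 2 ∈ Icc (0 : ℝ) 1) : ϑ ∈ triangleAngles := by
  obtain ⟨l0, u0⟩ := h0
  obtain ⟨l1, u1⟩ := h1
  obtain ⟨l2, u2⟩ := h2
  have a0 : |ϑ 0 - 1 - (-1 : ℤ)| = ϑ 0 := by push_cast; rw [abs_of_nonneg] <;> linarith
  have b0 : |ϑ 0 - 1 - (1 : ℤ)| = 2 - ϑ 0 := by push_cast; rw [abs_of_nonpos] <;> linarith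
  have c0 : |ϑ 0 - 1 - (0 : ℤ)| = |ϑ 0 - 1| := by simp
  have a1 : |ϑ 1 - 1 - (-1 : ℤ)| = ϑ 1 := by push_cast; rw [abs_of_nonneg] <;> linarith
  have c1 : |ϑ 1 - 1 - (0 : ℤ)| = 1 - ϑ 1 := by push_cast; rw [abs_of_nonpos] <;> linarith
  have a2 : |ϑ 2 - 1 - (-1 : ℤ)| = ϑ 2 := by push_cast; rw [abs_of_nonneg] <;> linarith
  have c2 : |ϑ 2 - 1 - (0 : ℤ)| = 1 - ϑ 2 := by push_cast; rw [abs_of_nonpos] <;> linarith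
  have i1 := hol.one_lt (-1) (-1) (-1) (by decide)
  have i2 := hol.one_lt (-1) 0 0 (by decide)
  have i3 := hol.one_lt 0 (-1) 0 (by decide)
  have i4 := hol.one_lt 0 0 (-1) (by decide)
  have i5 := hol.one_lt 1 0 0 (by decide)
  have i6 := hol.one_lt 1 (-1) (-1) (by decide)
  rw [a0, a1, a2] at i1
  rw [a0, c1, c2] at i2
  rw [c0, a1, c2] at i3
  rw [c0, c1, a2] at i4
  rw [b0, c1, c2] at i5
  rw [b0, a1, a2] at i6
  set k := |ϑ 0 - 1| with hk
  have hk1 : k ≤ 1 := abs_le.2 ⟨by linarith, by linarith⟩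
  have hk0 : 0 ≤ k := abs_nonneg _
  have hkc : k = ϑ 0 - 1 ∨ k = 1 - ϑ 0 := by
    rcases abs_choice (ϑ 0 - 1) with h | h
    · exact Or.inl h
    · exact Or.inr (by rw [hk, h]; ring)
  have hsum1 : k < ϑ 1 + ϑ 2 := by rcases hkc with h | h <;> linarith
  have hsum2 : ϑ 1 + ϑ 2 < 2 - k := by rcases hkc with h | h <;> linarith
  have hdiff : |ϑ 1 - ϑ 2| < k := abs_lt.2 ⟨by linarith, by linarith⟩
  have hkpos : 0 < k := (abs_nonneg _).trans_lt hdiff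
  have hd := abs_lt.1 hdiff
  have hk2 : k < 1 := by linarith
  have hk3 := abs_lt.1 hk2
  have hπ := Real.pi_pos
  have hcos : Real.cos (Real.pi * k) = -Real.cos (Real.pi * ϑ 0) := by
    rw [← Real.cos_pi_sub]
    rcases hkc with h | h
    · rw [← Real.cos_neg, h]
      ring_nf
    · rw [h]
      ring_nf
  -- A zero would mean cos πk = 1, contrary to 0 < k ≤ 1.
  have hc : Real.cos (Real.pi * ϑ 0 / 2) ≠ 0 := by
    intro h
    have h2 := Real.cos_two_mul (Real.pi * ϑ 0 / 2)
    rw [h, mul_div_cancel₀ _ two_ne_zero] at h2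
    have h3 := cos_pi_mul_lt le_rfl hk1 hkpos
    rw [hcos, h2, mul_zero, Real.cos_zero] at h3
    norm_num at h3
  refine ⟨by linarith, by linarith, hc, ⟨by linarith, by linarith⟩, ⟨by linarith, by linarith⟩, ?_⟩
  have hlt1 : Real.cos (Real.pi * (ϑ 1 + ϑ 2)) < Real.cos (Real.pi * k) := by
    rcases le_total (ϑ 1 + ϑ 2) 1 with h | h
    · exact cos_pi_mul_lt hk0 h hsum1
    -- For a sum above 1 the angle is reflected into [0, π], where the bound 2 - k takes over.
    · rw [← Real.cos_two_pi_sub (Real.pi * (ϑ 1 + ϑ 2)),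
        show 2 * Real.pi - Real.pi * (ϑ 1 + ϑ 2) = Real.pi * (2 - (ϑ 1 + ϑ 2)) by ring]
      exact cos_pi_mul_lt hk0 (by linarith) (by linarith)
  have hlt2 : Real.cos (Real.pi * k) < Real.cos (Real.pi * (ϑ 1 - ϑ 2)) := by
    rw [← Real.cos_abs (Real.pi * (ϑ 1 - ϑ 2)), abs_mul, abs_of_pos hπ]
    exact cos_pi_mul_lt (abs_nonneg _) hk1 hdiff
  have hsin : 0 < Real.sin (Real.pi * ϑ 0 / 2) :=
    Real.sin_pos_of_pos_of_lt_pi (half_pos (mul_pos hπ (by linarith)))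
      (by rw [div_lt_iff₀ two_pos]; exact mul_lt_mul_of_pos_left (by linarith) hπ)
  have e0 : Real.sin (Real.pi * ϑ 0 / 2) ^ 2 = (1 + Real.cos (Real.pi * k)) / 2 := by
    rw [hcos, Real.sin_sq_eq_half_sub, mul_div_cancel₀ _ two_ne_zero]
    ring
  have e1 : Real.cos (Real.pi * ϑ 1 / 2 + Real.pi * ϑ 2 / 2) ^ 2 =
      (1 + Real.cos (Real.pi * (ϑ 1 + ϑ 2))) / 2 := by
    rw [Real.cos_sq]
    ring_nf
  have e2 : Real.cos (Real.pi * ϑ 1 / 2 - Real.pi * ϑ 2 / 2) ^ 2 =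
      (1 + Real.cos (Real.pi * (ϑ 1 - ϑ 2))) / 2 := by
    rw [Real.cos_sq]
    ring_nf
  have := pole_sq_lt_one hsin hc (Real.sin_sq_add_cos_sq _)
    (A := Real.pi * ϑ 1 / 2) (B := Real.pi * ϑ 2 / 2)
    (by rw [e0, e1, e2]; exact mul_neg_of_pos_of_neg (by linarith) (by linarith))
  rw [mul_div_cancel₀ _ two_ne_zero, mul_div_cancel₀ _ two_ne_zero] at this
  exact this

end Holonomy
end

theorem mainTheorem8 (ϑ : Fin 3 → ℝ)
    (h0 : ϑ 0 ∈ Set.Icc (0 : ℝ) 2) (h1 : ϑ 1 ∈ Set.Icc (0 : ℝ) 1) (h2 : ϑ 2 ∈ Set.Icc (0 : ℝ) 1)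
    (hol : StrictHolonomyInequalities ϑ) :
    ∃ (x : Fin 3 → Disc) (d : Disc → Disc → ℝ),
      IsSphericalTriangle x ϑ d ∧
      IsAngleDeformableTriangle x ϑ d ∧
      IsAngleDeformableSurface (doubleVertex x) ϑ (doubleDist d) ∧
      HasNonCoaxialHolonomy (doubleVertex x) (doubleDist d) ∧
      (1 < ϑ 0 → ϑ 0 < 2 → IsComplementInHemisphere x ϑ d) := by
  obtain ⟨g, x, hg⟩ := exists_isModelChart
  have hϑ := hol.mem_triangleAngles h0 h1 h2
  have hdef : IsAngleDeformableTriangle x ϑ fun a b =>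
      coneDist (dev (basePole ϑ) (Real.pi * ϑ 0 / 2) (g a))
        (dev (basePole ϑ) (Real.pi * ϑ 0 / 2) (g b)) :=
    -- The disc, its vertices and the model chart stay fixed; only the developing map varies with ν,
    -- and at ν = ϑ it gives the chosen metric by definition.
    ⟨triangleAngles, triangleAngles_mem_nhds hϑ, _,
      hg.isContinuousMetricFamily (fun _ hν => basePole_zero_pos hν) (fun _ hν => half_angle_pos hν)
        (fun _ hν => half_angle_lt_pi hν) (fun _ hν => continuousAt_devParam hν),
      fun _ hν => IsModelChart.isSphericalTriangle hν hg, rfl⟩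
  refine ⟨x, _, IsModelChart.isSphericalTriangle hϑ hg, hdef, hdef.double,
    hg.hasNonCoaxialHolonomy (basePole_zero_pos hϑ) (half_angle_pos hϑ) (half_angle_lt_pi hϑ)
      hϑ.2.2.1, fun h _ => ?_⟩
  refine hg.isComplementInHemisphere (basePole_zero_pos hϑ) (half_angle_pos hϑ)
    (half_angle_lt_pi hϑ) (by ring) hϑ.2.2.2.1 hϑ.2.2.2.2.1 ?_ ?_ h
  · rw [inner_basePole_edgeNormal hϑ]
    ring
  · rw [inner_basePole_edgeNormal hϑ]
    ring
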